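/- Let $n\ge 2$. Fix a smooth function $\chi:\mathbb R^n\to\mathbb R$ that vanishes in a ball centred at $0$ and equals $1$ outside the unit ball. For $a\in\mathbb C$ let $\mathcal S^a$ be the set of $\sigma\in C^\infty(\mathbb R^n,\mathbb C)$ such that for every multiindex $\beta$ there is a constant $C(\beta)$ with $|\partial^\beta\sigma(\xi)|\le C(\beta)(1+|\xi|)^{\mathrm{Re}(a)-|\beta|}$ for all $\xi$. Let $CS^a$ be the set of classical symbols of order $a$ with constant coefficients, i.e. of those $\sigma\in\mathcal S^a$ for which there are smooth functions $\sigma_{a-j}$ on $\mathbb R^n\setminus\{0\}$ ($j=0,1,2,\dots$), positively homogeneous of degree $a-j$, such that for every $N\ge 0$ $$\sigma_{(N)}:=\sigma-\sum_{j=0}^{N-1}\chi\,\sigma_{a-j}\in\mathcal S^{a-N}.$$ Put $CS^{<p}=\bigcup_{\mathrm{Re}(a)<p}CS^a$ and $CS^{-\infty}=\bigcap_{a\in\mathbb C}CS^a$ (smoothing symbols). The Fréchet topology of $CS^a$ is given by the seminorms $\sup_{\xi}(1+|\xi|)^{-\mathrm{Re}(a)+N+|\beta|}|\partial^\beta\sigma_{(N)}(\xi)|$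 and $\sup_{|\xi|=1}|\partial^\beta\sigma_{a-j}(\xi)|$, for all multiindices $\beta$ and all $N,j\ge 0$. Let $S$ be one of the following sets: 1. $CS^{\notin\mathbb Z}=\bigcup_{a\in\mathbb C\setminus\mathbb Z}CS^a$ (non-integer order symbols); 2. $n$ is odd and $S$ is the set of odd-class symbols, i.e. of the $\sigma\in CS^a$ with $a\in\mathbb Z$ such that $\sigma_{a-j}(-\xi)=(-1)^{a-j}\sigma_{a-j}(\xi)$ for all $j\ge0$, $\xi\ne0$; 3. $n$ is even and $S$ is the set of even-class symbols, i.e. of the $\sigma\in CS^a$ with $a\in\mathbb Z$ such that $\sigma_{a-j}(-\xi)=(-1)^{a-j+1}\sigma_{a-j}(\xi)$ for all $j\ge0$, $\xi\ne0$. A map $\rho:S\to\mathbb C$ is called a linear form if $\rho(\alpha_1\sigma_1+\alpha_2\sigma_2)=\alpha_1\rho(\sigma_1)+\alpha_2\rho(\sigma_2)$ whenever $\alpha_1,\alpha_2\in\mathbb C$ and $\sigma_1$, $\sigma_2$, $\alpha_1\sigma_1+\alpha_2\sigma_2$ lie in $S$. It is called closed if $\rho(\partial_j\tau)=0$ for all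 $j\in\{1,\dots,n\}$ and all $\tau\in S$ with $\partial_j\tau\in S$. For $\sigma\in CS^a$ the cut-off regularised integral is $${-\!\!\!\!\!\!\int}_{\mathbb R^n}\sigma:=\int_{\mathbb R^n}\sigma_{(N)}(\xi)\,d\xi+\sum_{j=0}^{N-1}\int_{B(0,1)}\chi(\xi)\sigma_{a-j}(\xi)\,d\xi-\sum_{\substack{0\le j\le N-1\\ a-j+n\ne0}}\frac1{a-j+n}\int_{S^{n-1}}\sigma_{a-j}(\omega)\,d\mu_S(\omega),$$ where $N$ is any integer $\ge0$ with $\mathrm{Re}(a)-N<-n$ and $\mu_S$ is the surface measure of the unit sphere (the value does not depend on the choices of $a$ and $N$). Then closed linear forms on $S$ are determined by their values on symbols of arbitrarily negative order: for every $K\in\mathbb R$, two closed linear forms on $S$ that coincide on $S\cap CS^{<-K}$ are equal; moreover, two closed linear forms on $S$ that coincide on $CS^{-\infty}$ are equal. If a closed linear form $\rho$ on $S$ is continuous on symbols of constant order, i.e. its restriction to $S\cap CS^a$ is continuous for the topology of $CS^a$ for every $a\in\mathbb C$, then there is a constant $c\in\mathbb C$ such that $\rho(\sigma)=c\cdot {-\!\!\!\!\!\!\int}_{\mathbb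 R^n}\sigma$ for all $\sigma\in S$. -/

import Mathlib

open MeasureTheory
open scoped ContDiff

noncomputable section

namespace CCSymbol

/-- `ℝⁿ` with its Euclidean norm and Lebesgue measure. -/
abbrev E (n : ℕ) : Type := EuclideanSpace ℝ (Fin n)

variable {n : ℕ}

/-- A smooth cut-off function: it vanishes in a ball centred at `0` and equals `1` outside the
unit ball. -/
structure IsCutoff (χ : E n → ℝ) : Prop where
  smooth : ContDiff ℝ ∞ χ
  eq_zero : ∃ r : ℝ, 0 < r ∧ ∀ ξ : E n, ‖ξ‖ < r → χ ξ = 0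
  eq_one : ∀ ξ : E n, 1 ≤ ‖ξ‖ → χ ξ = 1

/-- Symbols of order `a` with constant coefficients: smooth functions with
`|∂^β σ(ξ)| ≤ C(β) (1 + |ξ|)^(Re a - |β|)` for every multiindex `β`; all partial derivatives of
order `k` are bounded together through the norm of the `k`-th iterated derivative. -/
structure IsSymbol (a : ℂ) (σ : E n → ℂ) : Prop where
  smooth : ContDiff ℝ ∞ σ
  bound : ∀ k : ℕ, ∃ C : ℝ, ∀ ξ : E n,
    ‖iteratedFDeriv ℝ k σ ξ‖ ≤ C * (1 + ‖ξ‖) ^ (a.re - (k : ℝ))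

/-- `f` is smooth on `ℝⁿ ∖ {0}` and positively homogeneous of degree `d` there.
The value `f 0` plays no role. -/
structure IsHomogeneous (d : ℂ) (f : E n → ℂ) : Prop where
  smooth : ContDiffOn ℝ ∞ f {0}ᶜ
  homogeneous : ∀ t : ℝ, 0 < t → ∀ ξ : E n, ξ ≠ 0 → f (t • ξ) = (t : ℂ) ^ d * f ξ

/-- The remainder `σ_(N) = σ - ∑_{j < N} χ σ_{a-j}`, where `s j` stands for `σ_{a-j}`. -/
def remainder (χ : E n → ℝ) (σ : E n → ℂ) (s : ℕ → E n → ℂ) (N : ℕ) (ξ : E n) : ℂ :=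
  σ ξ - ∑ j ∈ Finset.range N, (χ ξ : ℂ) * s j ξ

/-- `σ` is a symbol of order `a` with `σ ∼ ∑_j χ σ_{a-j}`, where `s j = σ_{a-j}` is positively
homogeneous of degree `a - j` and every remainder `σ_(N)` is a symbol of order `a - N`. -/
structure IsExpansion (χ : E n → ℝ) (a : ℂ) (σ : E n → ℂ) (s : ℕ → E n → ℂ) : Prop where
  symbol : IsSymbol a σ
  homogeneous : ∀ j : ℕ, IsHomogeneous (a - j) (s j)
  remainder_symbol : ∀ N : ℕ, IsSymbol (a - N) (remainder χ σ s N)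

/-- Classical symbols of order `a` with constant coefficients. -/
def CS (χ : E n → ℝ) (a : ℂ) : Set (E n → ℂ) :=
  {σ | ∃ s : ℕ → E n → ℂ, IsExpansion χ a σ s}

/-- Classical symbols whose order has real part `< p`. -/
def CSlt (χ : E n → ℝ) (p : ℝ) : Set (E n → ℂ) :=
  {σ | ∃ a : ℂ, a.re < p ∧ σ ∈ CS χ a}

/-- Smoothing symbols. -/
def smoothing (χ : E n → ℝ) : Set (E n → ℂ) :=
  {σ | ∀ a : ℂ, σ ∈ CS χ a}

/-- Classical symbols of non-integer order. -/
def nonIntegerOrder (χ : E n → ℝ) : Set (E n → ℂ) :=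
  {σ | ∃ a : ℂ, (∀ k : ℤ, a ≠ (k : ℂ)) ∧ σ ∈ CS χ a}

/-- Odd-class symbols: integer order `a` and `σ_{a-j}(-ξ) = (-1)^(a-j) σ_{a-j}(ξ)`. -/
def oddClass (χ : E n → ℝ) : Set (E n → ℂ) :=
  {σ | ∃ (a : ℤ) (s : ℕ → E n → ℂ), IsExpansion χ (a : ℂ) σ s ∧
    ∀ (j : ℕ) (ξ : E n), ξ ≠ 0 → s j (-ξ) = (-1 : ℂ) ^ (a - (j : ℤ)) * s j ξ}

/-- Even-class symbols: integer order `a` and `σ_{a-j}(-ξ) = (-1)^(a-j+1) σ_{a-j}(ξ)`. -/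
def evenClass (χ : E n → ℝ) : Set (E n → ℂ) :=
  {σ | ∃ (a : ℤ) (s : ℕ → E n → ℂ), IsExpansion χ (a : ℂ) σ s ∧
    ∀ (j : ℕ) (ξ : E n), ξ ≠ 0 → s j (-ξ) = (-1 : ℂ) ^ (a - (j : ℤ) + 1) * s j ξ}

/-- A linear form on a set of symbols that need not be a vector space: linearity is required
for those linear combinations that stay in the set. -/
def IsLinearForm {S : Set (E n → ℂ)} (ρ : S → ℂ) : Prop :=
  ∀ (α₁ α₂ : ℂ) (σ₁ σ₂ σ : S),
    (∀ ξ : E n, (σ : E n → ℂ) ξ = α₁ * (σ₁ : E n → ℂ) ξ + α₂ * (σ₂ : E n → ℂ) ξ) →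
      ρ σ = α₁ * ρ σ₁ + α₂ * ρ σ₂

/-- The partial derivative `∂_j τ`. -/
def partialDeriv (j : Fin n) (τ : E n → ℂ) (ξ : E n) : ℂ :=
  fderiv ℝ τ ξ (EuclideanSpace.single j (1 : ℝ))

/-- Closedness (Stokes' property): `ρ` vanishes on the partial derivatives in `S` of the
elements of `S`. -/
def IsClosedForm {S : Set (E n → ℂ)} (ρ : S → ℂ) : Prop :=
  ∀ (j : Fin n) (τ σ : S), (σ : E n → ℂ) = partialDeriv j (τ : E n → ℂ) → ρ σ = 0

/-- `sup_ξ (1 + |ξ|)^(k - r) ‖D^k f(ξ)‖`. -/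
def symbolSeminorm (r : ℝ) (k : ℕ) (f : E n → ℂ) : ENNReal :=
  ⨆ ξ : E n, ENNReal.ofReal ((1 + ‖ξ‖) ^ ((k : ℝ) - r) * ‖iteratedFDeriv ℝ k f ξ‖)

/-- `sup_{|ξ| = 1} ‖D^k f(ξ)‖`. -/
def sphereSeminorm (k : ℕ) (f : E n → ℂ) : ENNReal :=
  ⨆ ξ : Metric.sphere (0 : E n) 1, ENNReal.ofReal ‖iteratedFDeriv ℝ k f (ξ : E n)‖

/-- The Fréchet seminorms of a symbol `σ` of order `a` with homogeneous components `s`, for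
derivatives of order `≤ m`, components `j ≤ m` and remainders `N ≤ m`, are all `< δ`
(`N = 0` gives the seminorms of `σ` itself). Since the indices are exhausted as `m` grows,
these conditions define the basic neighbourhoods of `0` in the space of classical symbols
of order `a`. -/
structure SeminormsLT (χ : E n → ℝ) (a : ℂ) (m : ℕ) (δ : ℝ) (σ : E n → ℂ)
    (s : ℕ → E n → ℂ) : Prop where
  remainder_lt : ∀ k ≤ m, ∀ N ≤ m,
    symbolSeminorm (a.re - (N : ℝ)) k (remainder χ σ s N) < ENNReal.ofReal δ
  component_lt : ∀ k ≤ m, ∀ j ≤ m, sphereSeminorm k (s j) < ENNReal.ofReal δ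

/-- The restriction of `ρ` to `S ∩ CS^a` is continuous for the Fréchet topology of `CS^a`. -/
def IsContinuousOnOrder (χ : E n → ℝ) {S : Set (E n → ℂ)} (ρ : S → ℂ) (a : ℂ) : Prop :=
  ∀ σ₀ : S, (σ₀ : E n → ℂ) ∈ CS χ a → ∀ ε : ℝ, 0 < ε →
    ∃ (m : ℕ) (δ : ℝ), 0 < δ ∧
      ∀ σ : S, (σ : E n → ℂ) ∈ CS χ a →
        ∀ s : ℕ → E n → ℂ,
          IsExpansion χ a ((σ : E n → ℂ) - (σ₀ : E n → ℂ)) s →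
          SeminormsLT χ a m δ ((σ : E n → ℂ) - (σ₀ : E n → ℂ)) s →
            ‖ρ σ - ρ σ₀‖ < ε

/-- `ρ` is continuous on symbols of constant order. -/
def IsContinuousForm (χ : E n → ℝ) {S : Set (E n → ℂ)} (ρ : S → ℂ) : Prop :=
  ∀ a : ℂ, IsContinuousOnOrder χ ρ a

open Classical in
/-- The constant term in the expansion of `∫_{B(0,R)} σ` as `R → ∞`, for `σ` of order `a` with
components `s` and for `N > Re a + n`:
`∫ σ_(N) + ∑_{j<N} ∫_{B(0,1)} χ σ_{a-j} - ∑_{j<N, a-j+n≠0} (a-j+n)⁻¹ ∫_{S^{n-1}} σ_{a-j}`. -/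
def cutoffFormula (χ : E n → ℝ) (a : ℂ) (s : ℕ → E n → ℂ) (N : ℕ) (σ : E n → ℂ) : ℂ :=
  (∫ ξ : E n, remainder χ σ s N ξ)
    + (∑ j ∈ Finset.range N, ∫ ξ in Metric.ball (0 : E n) 1, (χ ξ : ℂ) * s j ξ)
    - ∑ j ∈ (Finset.range N).filter (fun j : ℕ => a - (j : ℂ) + (n : ℂ) ≠ 0),
        (1 / (a - (j : ℂ) + (n : ℂ))) *
          ∫ η : Metric.sphere (0 : E n) 1, s j (η : E n) ∂((volume : Measure (E n)).toSphere)

/-- `(a, s, N)` is admissible for computing the cut-off regularised integral of `σ`. -/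
def Admissible (χ : E n → ℝ) (σ : E n → ℂ) (p : ℂ × (ℕ → E n → ℂ) × ℕ) : Prop :=
  IsExpansion χ p.1 σ p.2.1 ∧ p.1.re - (p.2.2 : ℝ) < -(n : ℝ)

open Classical in
/-- The cut-off regularised integral of a classical symbol. Admissible data exist for every
classical symbol, and the value does not depend on their choice. -/
def cutoffIntegral (χ : E n → ℝ) (σ : E n → ℂ) : ℂ :=
  if h : ∃ p : ℂ × (ℕ → E n → ℂ) × ℕ, Admissible χ σ p then
    cutoffFormula χ h.choose.1 h.choose.2.1 h.choose.2.2 σ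
  else 0

end CCSymbol

end

/-! Modulo divergences of vector fields with components in S, every symbol of S equals a test
function φ supported in the closed unit ball whose integral is the cut-off integral of the symbol. A
closed form cannot tell the two apart. On test functions it is a multiple of the integral, since a
test function is determined by its integral up to the divergence of a compactly supported field
(`exists_sum_partialDeriv_eq`). As test functions are smoothing symbols, all three claims follow.

To reduce σ, write it as σ_(N) + ∑ χ σ_{a-j} with Re a - N < -n and treat each piece. For σ_(N),
take the radial field with coefficient ∫_1^∞ t^(n-1) σ_(N)(tξ) dt. Its divergence is -σ_(N) off the
origin, so after a cut-off and a sign it removes the tail; being the divergence of a decaying field,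
it leaves the integral unchanged. For a component f of degree d ≠ -n, Euler's identity gives div(ξ
f) = (d + n) f. The flux through the unit sphere then produces the term with 1/(d + n) in the
cut-off integral. Degree -n does not occur for non-integer orders. In the two parity classes a
component f of degree -n is odd, and `IsOddCritical.isEvenDivergence` writes it as the divergence of
an even field: f and its composition with a rotation in a coordinate plane differ by a divergence,
because rotation fields are divergence free, and rotations by π, together with an averaging over one
plane when n is odd, connect f to -f. With an even cut-off the corrected divergence is odd and
integrates to zero over the ball.

The three choices of S are handled together through `IsDegreeClass`. The regularised integral is
defined by an arbitrary expansion of σ, which may differ from the one witnessing σ ∈ S; uniqueness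
of the homogeneous components (`component_eq_zero_or`) reconciles them. -/

namespace CCSymbol

/-! ### Smoothness of integrals depending on a parameter -/

section ParametricIntegral

open Topology

variable {α : Type*} [MeasurableSpace α] {μ : Measure α}
  {X : Type*} [NormedAddCommGroup X] [NormedSpace ℝ X]
  {F : Type*} [NormedAddCommGroup F] [NormedSpace ℝ F]

/-- A family of functions, smooth on an open set, whose derivatives are locally dominated by
integrable functions of the parameter. -/
structure DominatedFamily (μ : Measure α) (U : Set X) (f : α → X → F) : Prop where
  smooth : ∀ t, ContDiffOn ℝ ∞ (f t) U
  measurable : ∀ k : ℕ, ∀ x ∈ U, AEStronglyMeasurable (fun t => iteratedFDeriv ℝ k (f t) x) μ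
  bound : ∀ k : ℕ, ∀ x ∈ U, ∃ b : α → ℝ, Integrable b μ ∧
    ∃ V ∈ 𝓝 x, ∀ᵐ t ∂μ, ∀ y ∈ V, ‖iteratedFDeriv ℝ k (f t) y‖ ≤ b t

namespace DominatedFamily

variable {U : Set X} {f : α → X → F}

theorem integrable (h : DominatedFamily μ U f) (k : ℕ) {x : X} (hx : x ∈ U) :
    Integrable (fun t => iteratedFDeriv ℝ k (f t) x) μ := by
  obtain ⟨b, hb, V, hV, hbV⟩ := h.bound k x hx
  refine hb.mono' (h.measurable k x hx) ?_
  filter_upwards [hbV] with t ht using ht x (mem_of_mem_nhds hV)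

theorem integrable_apply (h : DominatedFamily μ U f) {x : X} (hx : x ∈ U) :
    Integrable (fun t => f t x) μ := by
  have := (continuousMultilinearCurryFin0 ℝ X F).toContinuousLinearEquiv.toContinuousLinearMap
    |>.integrable_comp (h.integrable 0 hx)
  simpa using this

theorem hasFDerivAt_iteratedFDeriv (hU : IsOpen U) (h : DominatedFamily μ U f) (t : α) (k : ℕ)
    {x : X} (hx : x ∈ U) :
    HasFDerivAt (iteratedFDeriv ℝ k (f t)) (iteratedFDeriv ℝ (k + 1) (f t) x).curryLeft x := by
  have hd : DifferentiableAt ℝ (iteratedFDeriv ℝ k (f t)) x :=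
    ((h.smooth t).contDiffAt (hU.mem_nhds hx)).differentiableAt_iteratedFDeriv
      (by exact_mod_cast WithTop.coe_lt_top _)
  have := hd.hasFDerivAt
  rwa [fderiv_iteratedFDeriv] at this

variable [CompleteSpace F]

/-- The derivative of the k-th derivative is the curried (k+1)-st one, so the domination at level
k+1 is what differentiation under the integral needs at level k; currying, a linear isometry,
commutes with the integral. -/
theorem hasFDerivAt_integral (hU : IsOpen U) (h : DominatedFamily μ U f) (k : ℕ)
    {x : X} (hx : x ∈ U) :
    HasFDerivAt (fun y => ∫ t, iteratedFDeriv ℝ k (f t) y ∂μ)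
      (∫ t, iteratedFDeriv ℝ (k + 1) (f t) x ∂μ).curryLeft x := by
  obtain ⟨b, hb, V, hV, hbV⟩ := h.bound (k + 1) x hx
  have hL : (∫ t, iteratedFDeriv ℝ (k + 1) (f t) x ∂μ).curryLeft
      = ∫ t, (iteratedFDeriv ℝ (k + 1) (f t) x).curryLeft ∂μ := by
    let L : (X [×(k + 1)]→L[ℝ] F) →L[ℝ] (X →L[ℝ] (X [×k]→L[ℝ] F)) :=
      (continuousMultilinearCurryLeftEquiv ℝ (fun _ : Fin (k + 1) => X) F
        ).toContinuousLinearEquiv.toContinuousLinearMap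
    exact (ContinuousLinearMap.integral_comp_comm (𝕜 := ℝ) (Fₗ := X →L[ℝ] (X [×k]→L[ℝ] F)) L
      (h.integrable (k + 1) hx)).symm
  rw [hL]
  refine hasFDerivAt_integral_of_dominated_of_fderiv_le
    (F := fun y t => iteratedFDeriv ℝ k (f t) y)
    (F' := fun y t => (iteratedFDeriv ℝ (k + 1) (f t) y).curryLeft)
    (s := V ∩ U) (bound := b) (Filter.inter_mem hV (hU.mem_nhds hx))
    ?_ (h.integrable k hx) ?_ ?_ hb ?_
  · filter_upwards [hU.mem_nhds hx] with y hy using h.measurable k y hy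
  · exact (continuousMultilinearCurryLeftEquiv ℝ (fun _ : Fin (k + 1) => X) F
      ).continuous.comp_aestronglyMeasurable (h.measurable (k + 1) x hx)
  · filter_upwards [hbV] with t ht y hy
    have := ht y hy.1
    rwa [← ContinuousMultilinearMap.curryLeft_norm] at this
  · exact Filter.Eventually.of_forall fun t y hy => h.hasFDerivAt_iteratedFDeriv hU t k hy.2

theorem hasFTaylorSeriesUpToOn (hU : IsOpen U) (h : DominatedFamily μ U f) :
    HasFTaylorSeriesUpToOn ∞ (fun x => ∫ t, f t x ∂μ)
      (fun x k => ∫ t, iteratedFDeriv ℝ k (f t) x ∂μ) U where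
  zero_eq x hx := by
    have := (continuousMultilinearCurryFin0 ℝ X F).toContinuousLinearEquiv.toContinuousLinearMap
      |>.integral_comp_comm (h.integrable 0 hx)
    simpa using this.symm
  fderivWithin k _ x hx := (h.hasFDerivAt_integral hU k hx).hasFDerivWithinAt
  cont k _ x hx := (h.hasFDerivAt_integral hU k hx).continuousAt.continuousWithinAt

theorem contDiffOn_integral (hU : IsOpen U) (h : DominatedFamily μ U f) :
    ContDiffOn ℝ ∞ (fun x => ∫ t, f t x ∂μ) U :=
  (h.hasFTaylorSeriesUpToOn hU).contDiffOn

theorem iteratedFDeriv_integral (hU : IsOpen U) (h : DominatedFamily μ U f) (k : ℕ) {x : X}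
    (hx : x ∈ U) :
    iteratedFDeriv ℝ k (fun y => ∫ t, f t y ∂μ) x = ∫ t, iteratedFDeriv ℝ k (f t) x ∂μ := by
  rw [← iteratedFDerivWithin_of_isOpen k hU hx]
  exact ((h.hasFTaylorSeriesUpToOn hU).eq_iteratedFDerivWithin_of_uniqueDiffOn
    (by exact_mod_cast le_top) hU.uniqueDiffOn hx).symm

theorem fderiv_integral (hU : IsOpen U) (h : DominatedFamily μ U f) {x : X} (hx : x ∈ U) (v : X) :
    Integrable (fun t => fderiv ℝ (f t) x v) μ ∧
    fderiv ℝ (fun y => ∫ t, f t y ∂μ) x v = ∫ t, fderiv ℝ (f t) x v ∂μ := by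
  have h1 := h.iteratedFDeriv_integral hU 1 hx
  have h2 := (ContinuousMultilinearMap.apply ℝ (fun _ : Fin 1 => X) F (fun _ => v)
    ).integral_comp_comm (h.integrable 1 hx)
  have h3 := (ContinuousMultilinearMap.apply ℝ (fun _ : Fin 1 => X) F (fun _ => v)
    ).integrable_comp (h.integrable 1 hx)
  rw [← h1] at h2
  simp only [ContinuousMultilinearMap.apply_apply, iteratedFDeriv_one_apply] at h2 h3
  exact ⟨h3, h2.symm⟩

end DominatedFamily

end ParametricIntegral

/-! ### Symbol estimates as growth at infinity; homogeneous functions -/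

section Growth

open Topology Asymptotics Bornology Filter

variable {n : ℕ}

theorem iteratedFDeriv_comp_dilation {X F : Type*} [NormedAddCommGroup X] [NormedSpace ℝ X]
    [NormedAddCommGroup F] [NormedSpace ℝ F] (f : X → F) {t : ℝ} (ht : t ≠ 0) (k : ℕ) (x : X) :
    iteratedFDeriv ℝ k (fun y => f (t • y)) x = t ^ k • iteratedFDeriv ℝ k f (t • x) := by
  let g : X ≃L[ℝ] X := ContinuousLinearEquiv.smulLeft (Units.mk0 t ht)
  have h := g.iteratedFDerivWithin_comp_right f uniqueDiffOn_univ (x := x) (Set.mem_univ _) k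
  simp only [Set.preimage_univ, iteratedFDerivWithin_univ] at h
  have hg : ∀ y, g y = t • y := fun y => rfl
  have hfg : f ∘ g = fun y => f (t • y) := by ext y; simp [hg]
  rw [hfg] at h
  rw [h]
  ext v
  simp only [ContinuousMultilinearMap.compContinuousLinearMap_apply, hg,
    smul_apply]
  have : (fun i => ((g : X →L[ℝ] X) (v i))) = fun i => t • v i := by ext i; exact hg _
  rw [this, ContinuousMultilinearMap.map_smul_univ]
  simp

theorem eventually_one_lt_norm : ∀ᶠ ξ : E n in cobounded (E n), 1 < ‖ξ‖ :=
  tendsto_norm_cobounded_atTop.eventually_gt_atTop 1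

/-- All derivatives of `f` have the growth at infinity of those of a symbol of order `m`. -/
def HasGrowth (m : ℝ) (f : E n → ℂ) : Prop :=
  ∀ k : ℕ, iteratedFDeriv ℝ k f =O[cobounded (E n)] fun ξ => ‖ξ‖ ^ (m - (k : ℝ))

theorem iteratedFDeriv_eq_of_eqOn {f g : E n → ℂ} {U : Set (E n)} (hU : IsOpen U)
    (h : Set.EqOn f g U) (k : ℕ) : Set.EqOn (iteratedFDeriv ℝ k f) (iteratedFDeriv ℝ k g) U := by
  intro ξ hξ
  have : f =ᶠ[𝓝 ξ] g := by filter_upwards [hU.mem_nhds hξ] with y hy using h hy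
  exact this.iteratedFDeriv ℝ k |>.eq_of_nhds

theorem isOpen_one_lt_norm : IsOpen {ξ : E n | 1 < ‖ξ‖} :=
  isOpen_lt continuous_const continuous_norm

theorem HasGrowth.congr {m : ℝ} {f g : E n → ℂ} (hf : HasGrowth m f)
    (h : ∀ ξ, 1 < ‖ξ‖ → f ξ = g ξ) : HasGrowth m g := by
  intro k
  refine (hf k).congr' ?_ EventuallyEq.rfl
  filter_upwards [eventually_one_lt_norm] with ξ hξ
  exact iteratedFDeriv_eq_of_eqOn isOpen_one_lt_norm (fun ξ hξ => h ξ hξ) k hξ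

theorem HasGrowth.mono {m m' : ℝ} {f : E n → ℂ} (hf : HasGrowth m f) (h : m ≤ m') :
    HasGrowth m' f := by
  intro k
  refine (hf k).trans (IsBigO.of_bound 1 ?_)
  filter_upwards [eventually_one_lt_norm] with ξ hξ
  rw [Real.norm_of_nonneg (by positivity), Real.norm_of_nonneg (by positivity), one_mul]
  exact Real.rpow_le_rpow_of_exponent_le hξ.le (by linarith)

theorem HasGrowth.of_bound {m : ℝ} {f : E n → ℂ} (h : ∀ k : ℕ, ∃ C : ℝ, ∀ ξ : E n, 1 < ‖ξ‖ →
    ‖iteratedFDeriv ℝ k f ξ‖ ≤ C * ‖ξ‖ ^ (m - (k : ℝ))) : HasGrowth m f := by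
  intro k
  obtain ⟨C, hC⟩ := h k
  refine IsBigO.of_bound C ?_
  filter_upwards [eventually_one_lt_norm] with ξ hξ
  rw [Real.norm_of_nonneg (by positivity)]
  exact hC ξ hξ

theorem isTheta_one_add_norm (r : ℝ) :
    (fun ξ : E n => (1 + ‖ξ‖) ^ r) =Θ[cobounded (E n)] fun ξ => ‖ξ‖ ^ r := by
  have h : IsEquivalent (cobounded (E n)) (fun ξ : E n => 1 + ‖ξ‖) (fun ξ => ‖ξ‖) := by
    refine IsEquivalent.symm ?_
    have : (fun ξ : E n => ‖ξ‖) - (fun ξ : E n => 1 + ‖ξ‖) = fun _ => (-1 : ℝ) := by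
      ext ξ; simp
    rw [IsEquivalent, this, isLittleO_const_left]
    right
    have : Tendsto (fun ξ : E n => 1 + ‖ξ‖) (cobounded (E n)) atTop :=
      tendsto_atTop_add_const_left _ _ tendsto_norm_cobounded_atTop
    exact tendsto_norm_atTop_atTop.comp this
  exact (h.rpow (fun ξ => norm_nonneg ξ) (r := r)).isTheta

theorem exists_bound_of_isBigO {F : Type*} [NormedAddCommGroup F] {f : E n → F} {g : E n → ℝ}
    (hf : Continuous f) (hg : Continuous g) (hpos : ∀ ξ, 0 < g ξ)
    (h : f =O[cobounded (E n)] g) : ∃ C : ℝ, ∀ ξ, ‖f ξ‖ ≤ C * g ξ := by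
  obtain ⟨C, hC⟩ := h.bound
  rw [Metric.cobounded_eq_cocompact] at hC
  obtain ⟨K, hK, hKC⟩ := mem_cocompact.1 hC
  have hcont : Continuous fun ξ => ‖f ξ‖ / g ξ := hf.norm.div hg fun ξ => (hpos ξ).ne'
  obtain ⟨C', hC'⟩ := (hK.image hcont).bddAbove
  refine ⟨max C C', fun ξ => ?_⟩
  by_cases hξ : ξ ∈ K
  · have : ‖f ξ‖ / g ξ ≤ C' := hC' ⟨ξ, hξ, rfl⟩
    rw [div_le_iff₀ (hpos ξ)] at this
    exact this.trans (by have := hpos ξ; gcongr; exact le_max_right _ _)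
  · have : ‖f ξ‖ ≤ C * ‖g ξ‖ := hKC hξ
    rw [Real.norm_of_nonneg (hpos ξ).le] at this
    exact this.trans (by have := hpos ξ; gcongr; exact le_max_left _ _)

/-- On compact sets continuity gives the estimates, and at infinity 1 + |ξ| and |ξ| are comparable.
Hence only the behaviour near infinity has to be checked, away from the singularity of homogeneous
functions. -/
theorem isSymbol_iff {a : ℂ} {f : E n → ℂ} :
    IsSymbol a f ↔ ContDiff ℝ ∞ f ∧ HasGrowth a.re f := by
  constructor
  · refine fun h => ⟨h.smooth, fun k => ?_⟩
    obtain ⟨C, hC⟩ := h.bound k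
    refine IsBigO.trans ?_ (isTheta_one_add_norm (n := n) (a.re - k)).isBigO
    refine IsBigO.of_bound C (Eventually.of_forall fun ξ => ?_)
    rw [Real.norm_of_nonneg (by positivity)]
    exact hC ξ
  · rintro ⟨h1, h2⟩
    refine ⟨h1, fun k => exists_bound_of_isBigO (h1.continuous_iteratedFDeriv (mod_cast le_top))
      ?_ (fun ξ => by positivity) ((h2 k).trans (isTheta_one_add_norm (a.re - k)).symm.isBigO)⟩
    exact (continuous_const.add continuous_norm).rpow_const fun ξ =>
      Or.inl (by have := norm_nonneg ξ; simp only [ne_eq, Pi.add_apply]; linarith)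

theorem HasGrowth.lincomb {m : ℝ} {f g : E n → ℂ} (hf : HasGrowth m f) (hg : HasGrowth m g)
    (hf' : ContDiff ℝ ∞ f) (hg' : ContDiff ℝ ∞ g) (α β : ℂ) :
    HasGrowth m (α • f + β • g) := by
  intro k
  have : iteratedFDeriv ℝ k (α • f + β • g)
      = fun ξ => α • iteratedFDeriv ℝ k f ξ + β • iteratedFDeriv ℝ k g ξ := by
    ext1 ξ
    have h1 : ContDiffAt ℝ k f ξ := hf'.contDiffAt.of_le (mod_cast le_top)
    have h2 : ContDiffAt ℝ k g ξ := hg'.contDiffAt.of_le (mod_cast le_top)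
    have h3 : ContDiffAt ℝ k (α • f) ξ := h1.const_smul α
    have h4 : ContDiffAt ℝ k (β • g) ξ := h2.const_smul β
    rw [iteratedFDeriv_add_apply h3 h4, iteratedFDeriv_const_smul_apply h1,
      iteratedFDeriv_const_smul_apply h2]
  rw [this]
  exact ((hf k).const_smul_left α).add ((hg k).const_smul_left β)

theorem HasGrowth.mul {m m' : ℝ} {f g : E n → ℂ} (hf : HasGrowth m f) (hg : HasGrowth m' g)
    (hf' : ContDiff ℝ ∞ f) (hg' : ContDiff ℝ ∞ g) : HasGrowth (m + m') (f * g) := by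
  intro k
  have h1 : iteratedFDeriv ℝ k (f * g) =O[cobounded (E n)]
      fun ξ => ∑ i ∈ Finset.range (k + 1), (k.choose i : ℝ) * ‖iteratedFDeriv ℝ i f ξ‖ *
        ‖iteratedFDeriv ℝ (k - i) g ξ‖ := by
    refine IsBigO.of_bound 1 (Eventually.of_forall fun ξ => ?_)
    rw [one_mul, Real.norm_of_nonneg (by positivity)]
    exact norm_iteratedFDeriv_mul_le hf' hg' ξ (mod_cast le_top)
  refine h1.trans ?_
  rw [← Finset.sum_fn]
  refine IsBigO.sum fun i hi => ?_
  have hi' : i ≤ k := by simpa [Nat.lt_succ_iff] using hi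
  have h2 := ((hf i).norm_left.const_mul_left (k.choose i : ℝ)).mul (hg (k - i)).norm_left
  refine h2.congr' EventuallyEq.rfl ?_
  filter_upwards [eventually_one_lt_norm] with ξ hξ
  rw [← Real.rpow_add (by linarith), Nat.cast_sub hi']
  congr 1; ring

theorem HasGrowth.partialDeriv {m : ℝ} {f : E n → ℂ} (hf : HasGrowth m f)
    (hf' : ContDiff ℝ ∞ f) (i : Fin n) : HasGrowth (m - 1) (partialDeriv i f) := by
  intro k
  have h1 : iteratedFDeriv ℝ k (CCSymbol.partialDeriv i f) =O[cobounded (E n)]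
      iteratedFDeriv ℝ (k + 1) f := by
    refine IsBigO.of_bound ‖EuclideanSpace.single i (1 : ℝ)‖ (Eventually.of_forall fun ξ => ?_)
    have hd : ContDiffAt ℝ k (fderiv ℝ f) ξ :=
      (hf'.fderiv_right (m := k) (mod_cast le_top)).contDiffAt
    have := norm_iteratedFDeriv_clm_apply_const (𝕜 := ℝ) (f := fderiv ℝ f)
      (c := EuclideanSpace.single i (1 : ℝ)) (x := ξ) (N := k) (n := k) hd le_rfl
    rw [norm_iteratedFDeriv_fderiv] at this
    exact this
  refine (h1.trans (hf (k + 1))).congr_right fun ξ => ?_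
  push_cast
  congr 1; ring

theorem HasGrowth.of_eq_zero (m : ℝ) {f : E n → ℂ} {R : ℝ} (h : ∀ ξ, R < ‖ξ‖ → f ξ = 0) :
    HasGrowth m f := by
  intro k
  refine IsBigO.of_bound 0 ?_
  filter_upwards [tendsto_norm_cobounded_atTop.eventually_gt_atTop R] with ξ hξ
  have := iteratedFDeriv_eq_of_eqOn (g := fun _ => 0) (isOpen_lt continuous_const continuous_norm)
    (fun ξ hξ => h ξ hξ) k hξ
  simp [this, iteratedFDeriv_fun_zero]

theorem contDiff_partialDeriv {f : E n → ℂ} (hf : ContDiff ℝ ∞ f) (i : Fin n) :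
    ContDiff ℝ ∞ (partialDeriv i f) :=
  (hf.fderiv_right (m := ∞) le_rfl).clm_apply contDiff_const

namespace IsSymbol

theorem lincomb {a : ℂ} {f g : E n → ℂ} (hf : IsSymbol a f) (hg : IsSymbol a g) (α β : ℂ) :
    IsSymbol a (α • f + β • g) := by
  rw [isSymbol_iff] at *
  exact ⟨(hf.1.const_smul α).add (hg.1.const_smul β), hf.2.lincomb hg.2 hf.1 hg.1 α β⟩

theorem mono {a b : ℂ} {f : E n → ℂ} (hf : IsSymbol a f) (h : a.re ≤ b.re) : IsSymbol b f := by
  rw [isSymbol_iff] at *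
  exact ⟨hf.1, hf.2.mono h⟩

theorem mul {a b : ℂ} {f g : E n → ℂ} (hf : IsSymbol a f) (hg : IsSymbol b g) :
    IsSymbol (a + b) (f * g) := by
  rw [isSymbol_iff] at *
  exact ⟨hf.1.mul hg.1, hf.2.mul hg.2 hf.1 hg.1⟩

theorem partialDeriv {a : ℂ} {f : E n → ℂ} (hf : IsSymbol a f) (i : Fin n) :
    IsSymbol (a - 1) (partialDeriv i f) := by
  rw [isSymbol_iff] at *
  exact ⟨contDiff_partialDeriv hf.1 i, by simpa using hf.2.partialDeriv hf.1 i⟩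

theorem norm_le {a : ℂ} {f : E n → ℂ} (hf : IsSymbol a f) :
    ∃ C : ℝ, ∀ ξ, ‖f ξ‖ ≤ C * (1 + ‖ξ‖) ^ a.re := by
  obtain ⟨C, hC⟩ := hf.bound 0
  exact ⟨C, fun ξ => by simpa using hC ξ⟩

theorem integrable {a : ℂ} {f : E n → ℂ} (hf : IsSymbol a f) (ha : a.re < -(n : ℝ)) :
    Integrable f := by
  obtain ⟨C, hC⟩ := hf.norm_le
  have h := (integrable_one_add_norm (E := E n) (μ := volume) (r := -a.re)
    (by simpa using (by linarith : (n : ℝ) < -a.re))).const_mul C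
  refine h.mono' hf.smooth.continuous.aestronglyMeasurable (Filter.Eventually.of_forall fun ξ => ?_)
  simpa using hC ξ

end IsSymbol

theorem isOpen_compl_zero : IsOpen ({0}ᶜ : Set (E n)) := isOpen_compl_singleton

namespace IsHomogeneous

theorem contDiffAt {d : ℂ} {f : E n → ℂ} (hf : IsHomogeneous d f) {ξ : E n} (hξ : ξ ≠ 0) :
    ContDiffAt ℝ ∞ f ξ :=
  hf.smooth.contDiffAt (isOpen_compl_zero.mem_nhds hξ)

theorem differentiableAt {d : ℂ} {f : E n → ℂ} (hf : IsHomogeneous d f) {ξ : E n} (hξ : ξ ≠ 0) :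
    DifferentiableAt ℝ f ξ :=
  (hf.contDiffAt hξ).differentiableAt (by simp)

theorem zero (d : ℂ) : IsHomogeneous d (0 : E n → ℂ) :=
  ⟨contDiffOn_const, by simp⟩

theorem lincomb {d : ℂ} {f g : E n → ℂ} (hf : IsHomogeneous d f) (hg : IsHomogeneous d g)
    (α β : ℂ) : IsHomogeneous d (α • f + β • g) :=
  ⟨(hf.smooth.const_smul α).add (hg.smooth.const_smul β), fun t ht ξ hξ => by
    simp only [Pi.add_apply, Pi.smul_apply, smul_eq_mul, hf.homogeneous t ht ξ hξ,
      hg.homogeneous t ht ξ hξ]; ring⟩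

theorem mul {d e : ℂ} {f g : E n → ℂ} (hf : IsHomogeneous d f) (hg : IsHomogeneous e g) :
    IsHomogeneous (d + e) (f * g) :=
  ⟨hf.smooth.mul hg.smooth, fun t ht ξ hξ => by
    simp only [Pi.mul_apply, hf.homogeneous t ht ξ hξ, hg.homogeneous t ht ξ hξ]
    rw [Complex.cpow_add _ _ (by exact_mod_cast ht.ne')]; ring⟩

theorem iteratedFDeriv_smul {d : ℂ} {f : E n → ℂ} (hf : IsHomogeneous d f) {t : ℝ} (ht : 0 < t)
    (k : ℕ) {ξ : E n} (hξ : ξ ≠ 0) :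
    t ^ k • iteratedFDeriv ℝ k f (t • ξ) = (t : ℂ) ^ d • iteratedFDeriv ℝ k f ξ := by
  have h1 : Set.EqOn (fun y => f (t • y)) ((t : ℂ) ^ d • f) {0}ᶜ := fun y hy =>
    hf.homogeneous t ht y hy
  have h2 := iteratedFDeriv_eq_of_eqOn isOpen_compl_zero h1 k hξ
  rw [iteratedFDeriv_comp_dilation f ht.ne' k,
    iteratedFDeriv_const_smul_apply ((hf.contDiffAt hξ).of_le (mod_cast le_top))] at h2
  exact h2

/-- The k-th derivative is homogeneous of degree d - k, so it is controlled by its maximum on the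
compact unit sphere. -/
theorem hasGrowth {d : ℂ} {f : E n → ℂ} (hf : IsHomogeneous d f) : HasGrowth d.re f := by
  refine HasGrowth.of_bound fun k => ?_
  have hcont : ContinuousOn (iteratedFDeriv ℝ k f) (Metric.sphere 0 1) := by
    intro ξ hξ
    have h0 : ξ ≠ 0 := by rintro rfl; simp at hξ
    exact ((hf.contDiffAt h0).continuousAt_iteratedFDeriv (mod_cast le_top)).continuousWithinAt
  obtain ⟨C, hC⟩ := (isCompact_sphere (0 : E n) 1).exists_bound_of_continuousOn hcont
  refine ⟨C, fun ξ hξ => ?_⟩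
  have hpos : 0 < ‖ξ‖ := by linarith
  have h0 : ξ ≠ 0 := norm_pos_iff.1 hpos
  have hω : ‖ξ‖⁻¹ • ξ ∈ Metric.sphere (0 : E n) 1 := by
    simp [norm_smul, hpos.ne']
  have hω0 : ‖ξ‖⁻¹ • ξ ≠ 0 := by rintro h; rw [h] at hω; simp at hω
  have h := congrArg norm (hf.iteratedFDeriv_smul hpos k hω0)
  rw [smul_inv_smul₀ hpos.ne', norm_smul, norm_smul, norm_pow, norm_norm,
    Complex.norm_cpow_eq_rpow_re_of_pos hpos] at h
  have h2 : ‖iteratedFDeriv ℝ k f ξ‖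
      = ‖ξ‖ ^ (d.re - k) * ‖iteratedFDeriv ℝ k f (‖ξ‖⁻¹ • ξ)‖ := by
    rw [Real.rpow_sub hpos, Real.rpow_natCast, div_mul_eq_mul_div, ← h]
    field_simp
  rw [h2, mul_comm]
  gcongr
  exact hC _ hω

theorem partialDeriv {d : ℂ} {f : E n → ℂ} (hf : IsHomogeneous d f) (i : Fin n) :
    IsHomogeneous (d - 1) (partialDeriv i f) := by
  refine ⟨?_, fun t ht ξ hξ => ?_⟩
  · have := (hf.smooth.fderiv_of_isOpen (m := ∞) isOpen_compl_zero le_rfl)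
    exact this.clm_apply contDiffOn_const
  · have ht' : (t : ℂ) ≠ 0 := by exact_mod_cast ht.ne'
    have h1 : (fun y => f (t • y)) =ᶠ[𝓝 ξ] ((t : ℂ) ^ d • f) := by
      filter_upwards [isOpen_compl_zero.mem_nhds hξ] with y hy using hf.homogeneous t ht y hy
    have h2 := congrArg (fun L => L (EuclideanSpace.single i (1 : ℝ))) (h1.fderiv_eq (𝕜 := ℝ))
    have h3 : HasFDerivAt (fun y => f (t • y)) ((fderiv ℝ f (t • ξ)).comp
        (t • ContinuousLinearMap.id ℝ (E n))) ξ := by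
      have hd := (hf.differentiableAt (smul_ne_zero ht.ne' hξ)).hasFDerivAt
      exact hd.comp ξ ((hasFDerivAt_id ξ).const_smul t)
    rw [h3.fderiv, fderiv_const_smul (hf.differentiableAt hξ)] at h2
    simp only [ContinuousLinearMap.comp_apply, smul_apply,
      ContinuousLinearMap.id_apply, map_smul, smul_eq_mul, Complex.real_smul] at h2
    simp only [CCSymbol.partialDeriv]
    rw [Complex.cpow_sub _ _ ht', Complex.cpow_one, div_mul_eq_mul_div, eq_div_iff ht', ← h2]
    ring

end IsHomogeneous

/-- The coordinate function `ξ ↦ ξ_i` with complex values. -/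
def coord (i : Fin n) (ξ : E n) : ℂ := (ξ i : ℂ)

theorem contDiff_coord (i : Fin n) : ContDiff ℝ ∞ (coord i) := by
  have : coord i = fun ξ : E n => Complex.ofRealCLM (EuclideanSpace.proj (𝕜 := ℝ) i ξ) := rfl
  rw [this]
  exact (Complex.ofRealCLM.comp (EuclideanSpace.proj (𝕜 := ℝ) i)).contDiff

theorem fderiv_coord (i : Fin n) (ξ v : E n) : fderiv ℝ (coord i) ξ v = (v i : ℂ) := by
  have : coord i = fun ξ : E n => (Complex.ofRealCLM.comp (EuclideanSpace.proj (𝕜 := ℝ) i)) ξ := rfl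
  rw [this, ContinuousLinearMap.fderiv]
  rfl

theorem isHomogeneous_coord (i : Fin n) : IsHomogeneous 1 (coord i) :=
  ⟨(contDiff_coord i).contDiffOn, fun t _ ξ _ => by simp [coord]⟩

theorem isSymbol_coord (i : Fin n) : IsSymbol 1 (coord i) :=
  isSymbol_iff.2 ⟨contDiff_coord i, (isHomogeneous_coord i).hasGrowth⟩

namespace IsCutoff

theorem contDiff_mul {χ : E n → ℝ} (hχ : IsCutoff χ) {f : E n → ℂ} (hf : ContDiffOn ℝ ∞ f {0}ᶜ) :
    ContDiff ℝ ∞ fun ξ => (χ ξ : ℂ) * f ξ := by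
  obtain ⟨r, hr, h0⟩ := hχ.eq_zero
  rw [contDiff_iff_contDiffAt]
  intro ξ
  by_cases hξ : ξ = 0
  · have : (fun ξ => (χ ξ : ℂ) * f ξ) =ᶠ[𝓝 ξ] fun _ => 0 := by
      filter_upwards [Metric.ball_mem_nhds ξ hr] with y hy
      rw [hξ, mem_ball_zero_iff] at hy
      simp [h0 y hy]
    exact contDiffAt_const.congr_of_eventuallyEq this
  · have h1 : ContDiffAt ℝ ∞ (fun ξ => (χ ξ : ℂ)) ξ :=
      (Complex.ofRealCLM.contDiff.comp hχ.smooth).contDiffAt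
    exact h1.mul (hf.contDiffAt (isOpen_compl_zero.mem_nhds hξ))

theorem apply_zero {χ : E n → ℝ} (hχ : IsCutoff χ) : χ 0 = 0 := by
  obtain ⟨r, hr, h0⟩ := hχ.eq_zero
  exact h0 0 (by simpa)

end IsCutoff

end Growth

/-! ### Operations on expansions, and classes of degrees and components -/

section Expansions

open Topology Asymptotics Bornology Filter

variable {n : ℕ} {χ : E n → ℝ}

theorem remainder_eq (hχ : IsCutoff χ) (σ : E n → ℂ) (s : ℕ → E n → ℂ) (N : ℕ) {ξ : E n}
    (hξ : 1 ≤ ‖ξ‖) : remainder χ σ s N ξ = σ ξ - ∑ j ∈ Finset.range N, s j ξ := by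
  simp [remainder, hχ.eq_one ξ hξ]

theorem contDiff_remainder (hχ : IsCutoff χ) {σ : E n → ℂ} (hσ : ContDiff ℝ ∞ σ)
    {s : ℕ → E n → ℂ} (hs : ∀ j, ContDiffOn ℝ ∞ (s j) {0}ᶜ) (N : ℕ) :
    ContDiff ℝ ∞ (remainder χ σ s N) :=
  hσ.sub (ContDiff.sum fun j _ => hχ.contDiff_mul (hs j))

@[simp]
theorem remainder_zero (χ : E n → ℝ) (σ : E n → ℂ) (s : ℕ → E n → ℂ) :
    remainder χ σ s 0 = σ := by
  ext ξ; simp [remainder]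

theorem remainder_add (χ : E n → ℝ) (σ : E n → ℂ) (s : ℕ → E n → ℂ) (M N : ℕ) :
    remainder χ (remainder χ σ s M) (fun j => s (j + M)) N = remainder χ σ s (M + N) := by
  ext ξ
  simp only [remainder]
  have h : ∑ j ∈ Finset.range N, (χ ξ : ℂ) * s (j + M) ξ
      = ∑ j ∈ Finset.range N, (χ ξ : ℂ) * s (M + j) ξ :=
    Finset.sum_congr rfl fun j _ => by rw [add_comm]
  rw [Finset.sum_range_add, h]
  ring

theorem remainder_eq_self (hχ : IsCutoff χ) (σ : E n → ℂ) {s : ℕ → E n → ℂ}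
    (hs : ∀ j, Set.EqOn (s j) 0 {0}ᶜ) (N : ℕ) : remainder χ σ s N = σ := by
  ext ξ
  by_cases hξ : ξ = 0
  · simp [remainder, hξ, hχ.apply_zero]
  · simp [remainder, fun j => hs j hξ]

namespace IsExpansion

variable {a : ℂ} {σ : E n → ℂ} {s : ℕ → E n → ℂ}

/-- Only the behaviour at infinity matters for an expansion of a smooth function. -/
theorem of_growth (hχ : IsCutoff χ) (hσ : ContDiff ℝ ∞ σ)
    (hs : ∀ j : ℕ, IsHomogeneous (a - j) (s j)) (h : ∀ N : ℕ, ∃ g : E n → ℂ, HasGrowth (a.re - N) g ∧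
      ∀ ξ, 1 < ‖ξ‖ → g ξ = σ ξ - ∑ j ∈ Finset.range N, s j ξ) :
    IsExpansion χ a σ s := by
  have hr : ∀ N : ℕ, IsSymbol (a - N) (remainder χ σ s N) := by
    intro N
    obtain ⟨g, hg, hgσ⟩ := h N
    refine isSymbol_iff.2 ⟨contDiff_remainder hχ hσ (fun j => (hs j).smooth) N, ?_⟩
    have := hg.congr (g := remainder χ σ s N) fun ξ hξ => by
      rw [hgσ ξ hξ, remainder_eq hχ σ s N hξ.le]
    simpa using this
  exact ⟨by simpa using hr 0, hs, hr⟩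

theorem hasGrowth_remainder (h : IsExpansion χ a σ s) (N : ℕ) :
    HasGrowth (a.re - N) (remainder χ σ s N) := by
  simpa using (isSymbol_iff.1 (h.remainder_symbol N)).2

theorem lincomb (h : IsExpansion χ a σ s) {σ' : E n → ℂ} {s' : ℕ → E n → ℂ}
    (h' : IsExpansion χ a σ' s') (α β : ℂ) :
    IsExpansion χ a (α • σ + β • σ') (fun j => α • s j + β • s' j) := by
  refine ⟨h.symbol.lincomb h'.symbol α β,
    fun j => (h.homogeneous j).lincomb (h'.homogeneous j) α β, fun N => ?_⟩
  have : remainder χ (α • σ + β • σ') (fun j => α • s j + β • s' j) N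
      = α • remainder χ σ s N + β • remainder χ σ' s' N := by
    ext ξ
    simp only [remainder, Pi.add_apply, Pi.smul_apply, smul_eq_mul, mul_add,
      Finset.sum_add_distrib, Finset.mul_sum, mul_sub]
    rw [Finset.sum_congr rfl fun j _ => mul_left_comm (χ ξ : ℂ) α (s j ξ),
      Finset.sum_congr rfl fun j _ => mul_left_comm (χ ξ : ℂ) β (s' j ξ)]
    ring
  rw [this]
  exact (h.remainder_symbol N).lincomb (h'.remainder_symbol N) α β

/-- Derivatives of the cut-off appear only in the unit ball, where `of_growth` demands nothing but
smoothness. -/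
theorem partialDeriv (hχ : IsCutoff χ) (h : IsExpansion χ (a + 1) σ s) (i : Fin n) :
    IsExpansion χ a (partialDeriv i σ) (fun j => partialDeriv i (s j)) := by
  refine of_growth hχ (contDiff_partialDeriv h.symbol.smooth i) (fun j => ?_) fun N => ?_
  · have := (h.homogeneous j).partialDeriv i
    rwa [show a + 1 - (j : ℂ) - 1 = a - j by ring] at this
  · have hsm := contDiff_remainder hχ h.symbol.smooth (fun j => (h.homogeneous j).smooth) N
    have := (h.hasGrowth_remainder N).partialDeriv hsm i
    refine ⟨_, by convert! this using 1; simp; ring, fun ξ hξ => ?_⟩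
    have hξ0 : ξ ≠ 0 := by rintro rfl; simp at hξ; linarith
    have he : remainder χ σ s N =ᶠ[𝓝 ξ] fun ξ => σ ξ - ∑ j ∈ Finset.range N, s j ξ := by
      filter_upwards [isOpen_one_lt_norm.mem_nhds hξ] with y hy
      exact remainder_eq hχ σ s N (le_of_lt hy)
    simp only [CCSymbol.partialDeriv]
    rw [he.fderiv_eq, fderiv_fun_sub (h.symbol.smooth.differentiable (by simp) ξ)
      (DifferentiableAt.fun_sum fun j _ => (h.homogeneous j).differentiableAt hξ0),
      fderiv_fun_sum fun j _ => (h.homogeneous j).differentiableAt hξ0]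
    simp

theorem coord_mul (h : IsExpansion χ a σ s) (i : Fin n) :
    IsExpansion χ (a + 1) (coord i * σ) (fun j => coord i * s j) := by
  have he : ∀ N, remainder χ (coord i * σ) (fun j => coord i * s j) N
      = coord i * remainder χ σ s N := fun N => by
    ext ξ
    simp only [remainder, Pi.mul_apply, mul_sub, Finset.mul_sum]
    rw [Finset.sum_congr rfl fun j _ => mul_left_comm (χ ξ : ℂ) (coord i ξ) (s j ξ)]
  refine ⟨?_, fun j => ?_, fun N => ?_⟩
  · simpa [add_comm] using (isSymbol_coord i).mul h.symbol
  · convert! (isHomogeneous_coord i).mul (h.homogeneous j) using 1; ring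
  · rw [he]
    convert! (isSymbol_coord i).mul (h.remainder_symbol N) using 1; ring

theorem of_eq_zero (hχ : IsCutoff χ) (hσ : ContDiff ℝ ∞ σ) {R : ℝ}
    (h : ∀ ξ, R < ‖ξ‖ → σ ξ = 0) (a : ℂ) :
    IsExpansion χ a σ 0 :=
  of_growth hχ hσ (fun _ => IsHomogeneous.zero _) fun N =>
    ⟨σ, HasGrowth.of_eq_zero _ h, fun ξ _ => by simp⟩

theorem of_eq_homogeneous (hχ : IsCutoff χ) {d : ℂ} {f : E n → ℂ} (hf : IsHomogeneous d f)
    (hσ : ContDiff ℝ ∞ σ) (h : ∀ ξ, 1 < ‖ξ‖ → σ ξ = f ξ) :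
    IsExpansion χ d σ (fun j => if j = 0 then f else 0) := by
  refine of_growth hχ hσ (fun j => ?_) fun N => ?_
  · by_cases hj : j = 0
    · simpa [hj] using hf
    · simpa [hj] using IsHomogeneous.zero _
  · rcases N with _ | N
    · exact ⟨f, by simpa using hf.hasGrowth, fun ξ hξ => by simp [h ξ hξ]⟩
    · refine ⟨0, HasGrowth.of_eq_zero (R := 0) _ fun _ _ => rfl, fun ξ hξ => ?_⟩
      rw [Finset.sum_range_succ', h ξ hξ]
      simp

theorem tail (h : IsExpansion χ a σ s) (M : ℕ) :
    IsExpansion χ (a - M) (remainder χ σ s M) (fun j => s (j + M)) := by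
  refine ⟨h.remainder_symbol M, fun j => ?_, fun N => ?_⟩
  · convert! h.homogeneous (j + M) using 1; push_cast; ring
  · rw [remainder_add]
    convert! h.remainder_symbol (M + N) using 1; push_cast; ring

/-- Padding with zero components lets the pieces of order a - j of a decomposition live in the
single vector space of symbols of order a. -/
theorem shift (M : ℕ) (h : IsExpansion χ (a - M) σ s) :
    IsExpansion χ a σ (fun j => if j < M then 0 else s (j - M)) := by
  refine ⟨h.symbol.mono (by simp), fun j => ?_, fun N => ?_⟩
  · by_cases hj : j < M
    · simpa [hj] using IsHomogeneous.zero _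
    · have := h.homogeneous (j - M)
      rw [Nat.cast_sub (not_lt.1 hj)] at this
      simp only [hj, if_false]
      convert! this using 1; ring
  · rcases le_total N M with hN | hN
    · have : remainder χ σ (fun j => if j < M then 0 else s (j - M)) N = σ := by
        ext ξ
        have h0 : ∀ j ∈ Finset.range N,
            (χ ξ : ℂ) * (if j < M then (0 : E n → ℂ) else s (j - M)) ξ = 0 := fun j hj => by
          have : j < M := (Finset.mem_range.1 hj).trans_le hN
          simp [this]
        simp only [remainder, Finset.sum_eq_zero h0, sub_zero]
      rw [this]
      refine h.symbol.mono ?_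
      have : (N : ℝ) ≤ M := by exact_mod_cast hN
      simp only [Complex.sub_re, Complex.natCast_re]
      linarith
    · obtain ⟨N, rfl⟩ := Nat.exists_eq_add_of_le hN
      have : remainder χ σ (fun j => if j < M then 0 else s (j - M)) (M + N)
          = remainder χ σ s N := by
        ext ξ
        have h0 : ∀ j ∈ Finset.range M,
            (χ ξ : ℂ) * (if j < M then (0 : E n → ℂ) else s (j - M)) ξ = 0 := fun j hj => by
          simp [Finset.mem_range.1 hj]
        simp only [remainder, Finset.sum_range_add, Finset.sum_eq_zero h0, zero_add]
        simp
      rw [this]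
      convert! h.remainder_symbol N using 1; push_cast; ring

end IsExpansion

/-- A condition on homogeneous functions and their degrees that is compatible with the operations
on homogeneous components, and for which functions of the critical degree `-n` are divergences. -/
structure IsDegreeClass (P : ℂ → (E n → ℂ) → Prop) : Prop where
  -- `P d 0` plays the role of "the degree d is admissible", a property that must survive the
  -- integer shifts between components.
  zero_shift : ∀ {d : ℂ} {f : E n → ℂ}, P d f → ∀ k : ℤ, P (d + k) 0
  lincomb : ∀ {d : ℂ} {f g : E n → ℂ}, P d f → P d g → ∀ α β : ℂ, P d (α • f + β • g)
  partialDeriv : ∀ {d : ℂ} {f : E n → ℂ}, IsHomogeneous d f → P d f → ∀ i,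
    P (d - 1) (partialDeriv i f)
  coord_mul : ∀ {d : ℂ} {f : E n → ℂ}, P d f → ∀ i, P (d + 1) (coord i * f)
  congr : ∀ {d : ℂ} {f g : E n → ℂ}, P d f → Set.EqOn f g {0}ᶜ → P d g
  -- The cut-off χ₀ may differ from χ, to allow symmetrisation. The vanishing integral makes a
  -- critical component contribute only its ball integral, as in the cut-off formula.
  critical : ∀ {χ : E n → ℝ}, IsCutoff χ → ∀ {f : E n → ℂ}, IsHomogeneous (-(n : ℂ)) f →
    P (-(n : ℂ)) f → ∃ (g : Fin n → E n → ℂ) (χ₀ : E n → ℝ), IsCutoff χ₀ ∧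
      (∀ i, IsHomogeneous (-(n : ℂ) + 1) (g i) ∧ P (-(n : ℂ) + 1) (g i)) ∧
      (∀ ξ, ξ ≠ 0 → ∑ i, CCSymbol.partialDeriv i (g i) ξ = f ξ) ∧
      ∫ ξ in Metric.ball (0 : E n) 1,
        ∑ i, CCSymbol.partialDeriv i (fun η => (χ₀ η : ℂ) * g i η) ξ = 0

theorem IsDegreeClass.smul {P : ℂ → (E n → ℂ) → Prop} (hP : IsDegreeClass P) {d : ℂ}
    {f : E n → ℂ} (hf : P d f) (α : ℂ) : P d (α • f) := by
  simpa using hP.lincomb hf hf α 0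

/-- The classical symbols of order `a` whose components satisfy `P`. -/
def symbolSpace (χ : E n → ℝ) {P : ℂ → (E n → ℂ) → Prop} (hP : IsDegreeClass P) (a : ℂ)
    (ha : P a 0) : Submodule ℂ (E n → ℂ) where
  carrier := {σ | ∃ s, IsExpansion χ a σ s ∧ ∀ j : ℕ, P (a - j) (s j)}
  add_mem' := by
    rintro σ τ ⟨s, hs, hPs⟩ ⟨t, ht, hPt⟩
    refine ⟨_, by simpa using hs.lincomb ht 1 1, fun j => ?_⟩
    simpa using hP.lincomb (hPs j) (hPt j) 1 1
  smul_mem' := by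
    rintro c σ ⟨s, hs, hPs⟩
    refine ⟨_, by simpa using hs.lincomb hs c 0, fun j => ?_⟩
    simpa using hP.smul (hPs j) c
  zero_mem' := by
    refine ⟨0, ⟨⟨contDiff_const, fun k => ⟨0, fun ξ => ?_⟩⟩, fun _ => IsHomogeneous.zero _,
      fun N => ⟨?_, fun k => ⟨0, fun ξ => ?_⟩⟩⟩, fun j => ?_⟩
    · simp [show (0 : E n → ℂ) = fun _ => 0 from rfl, iteratedFDeriv_fun_zero]
    · have : remainder χ 0 0 N = fun _ : E n => 0 := by ext; simp [remainder]
      rw [this]; exact contDiff_const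
    · have : remainder χ 0 0 N = fun _ : E n => 0 := by ext; simp [remainder]
      simp [this, iteratedFDeriv_fun_zero]
    · simpa [sub_eq_add_neg] using hP.zero_shift ha (-(j : ℤ))

section SymbolSpace

variable {P : ℂ → (E n → ℂ) → Prop} (hP : IsDegreeClass P) {a : ℂ} (ha : P a 0)

theorem IsDegreeClass.zero_sub (hP : IsDegreeClass P) (ha : P a 0) (j : ℕ) : P (a - j) 0 := by
  simpa [sub_eq_add_neg] using hP.zero_shift ha (-(j : ℤ))

theorem IsDegreeClass.zero_add_one (hP : IsDegreeClass P) (ha : P a 0) : P (a + 1) 0 := by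
  simpa using hP.zero_shift ha 1

theorem mem_symbolSpace {σ : E n → ℂ} :
    σ ∈ symbolSpace χ hP a ha ↔ ∃ s, IsExpansion χ a σ s ∧ ∀ j : ℕ, P (a - j) (s j) := Iff.rfl

theorem symbolSpace_sub_le (M : ℕ) :
    symbolSpace χ hP (a - M) (hP.zero_sub ha M) ≤ symbolSpace χ hP a ha := by
  rintro σ ⟨s, hs, hPs⟩
  refine ⟨_, hs.shift M, fun j => ?_⟩
  by_cases hj : j < M
  · simpa [hj] using hP.zero_sub ha j
  · have := hPs (j - M)
    rw [Nat.cast_sub (not_lt.1 hj)] at this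
    simp only [hj, if_false]
    convert! this using 1; ring

theorem partialDeriv_mem_symbolSpace (hχ : IsCutoff χ) (i : Fin n) {τ : E n → ℂ}
    (hτ : τ ∈ symbolSpace χ hP (a + 1) (hP.zero_add_one ha)) :
    partialDeriv i τ ∈ symbolSpace χ hP a ha := by
  obtain ⟨s, hs, hPs⟩ := hτ
  refine ⟨_, hs.partialDeriv hχ i, fun j => ?_⟩
  have := hP.partialDeriv (hs.homogeneous j) (hPs j) i
  rwa [show a + 1 - (j : ℂ) - 1 = a - j by ring] at this

theorem coord_mul_mem_symbolSpace (i : Fin n) {σ : E n → ℂ} (hσ : σ ∈ symbolSpace χ hP a ha) :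
    coord i * σ ∈ symbolSpace χ hP (a + 1) (hP.zero_add_one ha) := by
  obtain ⟨s, hs, hPs⟩ := hσ
  refine ⟨_, hs.coord_mul i, fun j => ?_⟩
  have := hP.coord_mul (hPs j) i
  rwa [show a - (j : ℂ) + 1 = a + 1 - j by ring] at this

theorem mem_symbolSpace_of_eq_zero (hχ : IsCutoff χ) {σ : E n → ℂ} (hσ : ContDiff ℝ ∞ σ)
    {R : ℝ} (h : ∀ ξ, R < ‖ξ‖ → σ ξ = 0) : σ ∈ symbolSpace χ hP a ha :=
  ⟨0, IsExpansion.of_eq_zero hχ hσ h a, hP.zero_sub ha⟩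

theorem mem_symbolSpace_of_eq_homogeneous (hχ : IsCutoff χ) {σ f : E n → ℂ}
    (hf : IsHomogeneous a f) (hPf : P a f) (hσ : ContDiff ℝ ∞ σ)
    (h : ∀ ξ, 1 < ‖ξ‖ → σ ξ = f ξ) : σ ∈ symbolSpace χ hP a ha := by
  refine ⟨_, IsExpansion.of_eq_homogeneous hχ hf hσ h, fun j => ?_⟩
  by_cases hj : j = 0
  · simpa [hj] using hPf
  · simpa [hj] using hP.zero_sub ha j

end SymbolSpace

end Expansions

/-! ### Polar coordinates and divergences of radial fields -/

section PolarCoordinates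

open Topology Filter

variable {n : ℕ}

theorem integral_volumeIoiPow (m : ℕ) (f : ℝ → ℂ) :
    ∫ r : Set.Ioi (0 : ℝ), f r ∂(Measure.volumeIoiPow m)
      = ∫ r in Set.Ioi (0 : ℝ), r ^ m • f r := by
  simp only [Measure.volumeIoiPow, ENNReal.ofReal]
  rw [integral_withDensity_eq_integral_smul,
    integral_subtype_comap measurableSet_Ioi fun a ↦ Real.toNNReal (a ^ m) • f a,
    setIntegral_congr_fun measurableSet_Ioi fun x hx ↦ ?_]
  · rw [NNReal.smul_def, Real.coe_toNNReal _ (pow_nonneg (Set.mem_Ioi.1 hx).le _)]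
  · exact (measurable_subtype_coe.pow_const _).real_toNNReal

theorem integrable_volumeIoiPow_iff (m : ℕ) (f : ℝ → ℂ) :
    Integrable (fun r : Set.Ioi (0 : ℝ) => f r) (Measure.volumeIoiPow m)
      ↔ IntegrableOn (fun r => r ^ m • f r) (Set.Ioi 0) := by
  rw [integrableOn_iff_comap_subtypeVal (by measurability), Measure.volumeIoiPow,
    integrable_withDensity_iff_integrable_smul', integrable_congr]
  · refine .of_forall ?_
    rintro ⟨x, hx : 0 < x⟩
    simp (disch := positivity) [ENNReal.toReal_ofReal]
  · fun_prop
  · simp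

theorem integral_eq_integral_polar (hn : 1 ≤ n) {F : E n → ℂ} (hF : Integrable F) :
    (∫ ξ, F ξ = ∫ θ : Metric.sphere (0 : E n) 1, (∫ r in Set.Ioi (0 : ℝ),
      r ^ (n - 1) • F (r • (θ : E n))) ∂((volume : Measure (E n)).toSphere)) ∧
    ∀ᵐ θ : Metric.sphere (0 : E n) 1 ∂((volume : Measure (E n)).toSphere),
      IntegrableOn (fun r : ℝ => r ^ (n - 1) • F (r • (θ : E n))) (Set.Ioi 0) := by
  have : Nontrivial (E n) := by
    have : Nonempty (Fin n) := ⟨⟨0, hn⟩⟩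
    infer_instance
  have hmp := (volume : Measure (E n)).measurePreserving_homeomorphUnitSphereProd
  simp only [finrank_euclideanSpace, Fintype.card_fin] at hmp
  have hemb := (homeomorphUnitSphereProd (E n)).measurableEmbedding
  let G : Metric.sphere (0 : E n) 1 × Set.Ioi (0 : ℝ) → ℂ := fun p => F ((p.2 : ℝ) • (p.1 : E n))
  have hG : ∀ x : ({0}ᶜ : Set (E n)), G (homeomorphUnitSphereProd (E n) x) = F x := by
    intro x
    have hx : ‖(x : E n)‖ ≠ 0 := norm_ne_zero_iff.2 x.2
    simp [G, smul_smul, hx]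
  have hGi : Integrable G
      ((volume : Measure (E n)).toSphere.prod (Measure.volumeIoiPow (n - 1))) := by
    rw [← hmp.integrable_comp_emb hemb]
    have : G ∘ homeomorphUnitSphereProd (E n) = F ∘ Subtype.val := funext hG
    rw [this, ← integrableOn_iff_comap_subtypeVal (measurableSet_singleton _).compl]
    exact hF.integrableOn
  have h1 : ∫ ξ, F ξ = ∫ p, G p
      ∂((volume : Measure (E n)).toSphere.prod (Measure.volumeIoiPow (n - 1))) := by
    rw [← hmp.integral_comp hemb]
    simp only [hG]
    rw [integral_subtype_comap (measurableSet_singleton _).compl F, restrict_compl_singleton]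
  refine ⟨?_, ?_⟩
  · rw [h1, integral_prod _ hGi]
    congr 1
    ext θ
    exact integral_volumeIoiPow (n - 1) fun r => F (r • (θ : E n))
  · filter_upwards [hGi.prod_right_ae] with θ hθ
    exact (integrable_volumeIoiPow_iff (n - 1) fun r => F (r • (θ : E n))).1 hθ

/-- The divergence of the radial vector field `h(ξ) ξ`. -/
noncomputable def radialDiv (h : E n → ℂ) (ξ : E n) : ℂ := n * h ξ + fderiv ℝ h ξ ξ

theorem sum_partialDeriv_coord_mul {h : E n → ℂ} {ξ : E n} (hh : DifferentiableAt ℝ h ξ) :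
    ∑ i, partialDeriv i (coord i * h) ξ = radialDiv h ξ := by
  have h1 : ∀ i : Fin n, partialDeriv i (coord i * h) ξ
      = h ξ + (ξ i : ℂ) * fderiv ℝ h ξ (EuclideanSpace.single i 1) := fun i => by
    have hc := (contDiff_coord i).differentiable (by simp) ξ
    simp only [partialDeriv]
    rw [fderiv_mul hc hh]
    simp [fderiv_coord, coord]
    ring
  have h2 : ξ = ∑ i, ξ i • EuclideanSpace.single i (1 : ℝ) := by
    conv_lhs => rw [← (EuclideanSpace.basisFun (Fin n) ℝ).sum_repr ξ]
    simp
  rw [Finset.sum_congr rfl fun i _ => h1 i, Finset.sum_add_distrib, radialDiv]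
  conv_rhs => rw [h2, map_sum]
  rw [← h2]
  simp

theorem continuous_radialDiv {h : E n → ℂ} (hh : ContDiff ℝ ∞ h) : Continuous (radialDiv h) := by
  have := (hh.fderiv_right (m := ∞) le_rfl).continuous
  exact (continuous_const.mul hh.continuous).add (this.clm_apply continuous_id)

/-- The divergence times the Jacobian r^(n-1) is an exact derivative along each ray, which turns
integrals of radial divergences into boundary terms. -/
theorem hasDerivAt_pow_mul_radial (hn : 1 ≤ n) {h : E n → ℂ} (hh : Differentiable ℝ h) (θ : E n)
    (r : ℝ) : HasDerivAt (fun r : ℝ => r ^ n • h (r • θ))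
      (r ^ (n - 1) • radialDiv h (r • θ)) r := by
  have h1 : HasDerivAt (fun r : ℝ => h (r • θ)) (fderiv ℝ h (r • θ) θ) r := by
    have h2 := ((hasDerivAt_id r).smul_const θ)
    simp only [id_eq, one_smul] at h2
    exact (hh (r • θ)).hasFDerivAt.comp_hasDerivAt r h2
  convert! (hasDerivAt_pow n r).smul h1 using 1
  obtain ⟨m, rfl⟩ := Nat.exists_eq_add_of_le' hn
  simp only [radialDiv, map_smul, Complex.real_smul, Nat.add_sub_cancel]
  push_cast
  ring

/-- On each ray the boundary term at infinity vanishes by `hlim`, the one at 0 because n ≥ 1. -/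
theorem integral_radialDiv_eq_zero (hn : 1 ≤ n) {h : E n → ℂ} (hh : ContDiff ℝ ∞ h)
    (hi : Integrable (radialDiv h))
    (hlim : ∀ θ : E n, ‖θ‖ = 1 → Tendsto (fun r : ℝ => r ^ n • h (r • θ)) atTop (𝓝 0)) :
    ∫ ξ, radialDiv h ξ = 0 := by
  obtain ⟨h1, h2⟩ := integral_eq_integral_polar hn hi
  rw [h1]
  refine integral_eq_zero_of_ae ?_
  filter_upwards [h2] with θ hθ
  rw [integral_Ioi_of_hasDerivAt_of_tendsto'
    (fun r _ => hasDerivAt_pow_mul_radial hn (hh.differentiable (by simp)) θ r) hθ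
    (hlim θ (by simp))]
  simp [show n ≠ 0 by omega]

theorem integral_ball_radialDiv (hn : 1 ≤ n) {h : E n → ℂ} (hh : ContDiff ℝ ∞ h) :
    ∫ ξ in Metric.ball (0 : E n) 1, radialDiv h ξ
      = ∫ θ : Metric.sphere (0 : E n) 1, h θ ∂((volume : Measure (E n)).toSphere) := by
  have hi : IntegrableOn (radialDiv h) (Metric.ball (0 : E n) 1) :=
    ((continuous_radialDiv hh).continuousOn.integrableOn_compact
      (isCompact_closedBall 0 1)).mono_set Metric.ball_subset_closedBall
  rw [← integral_indicator Metric.isOpen_ball.measurableSet]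
  obtain ⟨h1, -⟩ := integral_eq_integral_polar hn
    (hi.integrable_indicator Metric.isOpen_ball.measurableSet)
  rw [h1]
  congr 1
  ext θ
  have hc : ∀ r ∈ Set.Ioi (0 : ℝ), r ^ (n - 1) •
      (Metric.ball (0 : E n) 1).indicator (radialDiv h) (r • (θ : E n))
      = (Set.Iio (1 : ℝ)).indicator (fun r => r ^ (n - 1) • radialDiv h (r • (θ : E n))) r := by
    intro r hr
    have hr' : ‖r • (θ : E n)‖ = r := by
      rw [norm_smul, Real.norm_of_nonneg (le_of_lt hr)]; simp
    by_cases h : r < 1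
    · rw [Set.indicator_of_mem (by simpa [hr'] using h), Set.indicator_of_mem (by simpa using h)]
    · rw [Set.indicator_of_notMem (by simpa [hr'] using h),
        Set.indicator_of_notMem (by simpa using h), smul_zero]
  rw [setIntegral_congr_fun measurableSet_Ioi hc, setIntegral_indicator measurableSet_Iio,
    Set.Ioi_inter_Iio, ← integral_Ioc_eq_integral_Ioo,
    ← intervalIntegral.integral_of_le zero_le_one,
    intervalIntegral.integral_eq_sub_of_hasDerivAt
      (fun r _ => hasDerivAt_pow_mul_radial hn (hh.differentiable (by simp)) θ r)]
  · simp [show n ≠ 0 by omega]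
  · refine Continuous.intervalIntegrable ?_ _ _
    exact (continuous_pow _).smul ((continuous_radialDiv hh).comp (by fun_prop))

end PolarCoordinates

/-! ### The radial primitive of an integrable symbol -/

section RadialPrimitive

open Topology Filter

variable {n : ℕ} {χ : E n → ℝ}

theorem IsSymbol.norm_iteratedFDeriv_le {b : ℂ} {σ : E n → ℂ} (hσ : IsSymbol b σ) (hb : b.re ≤ 0)
    (k : ℕ) : ∃ C : ℝ, 0 ≤ C ∧ ∀ ξ, ξ ≠ 0 →
      ‖iteratedFDeriv ℝ k σ ξ‖ ≤ C * ‖ξ‖ ^ (b.re - (k : ℝ)) := by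
  obtain ⟨C, hC⟩ := hσ.bound k
  have hC0 : 0 ≤ C := by
    have := (norm_nonneg _).trans (hC 0)
    simpa using this
  refine ⟨C, hC0, fun ξ hξ => (hC ξ).trans ?_⟩
  have hk : (0 : ℝ) ≤ k := k.cast_nonneg
  exact mul_le_mul_of_nonneg_left
    (Real.rpow_le_rpow_of_nonpos (norm_pos_iff.2 hξ) (by linarith) (by linarith)) hC0

theorem IsSymbol.tendsto_pow_smul {b : ℂ} {σ : E n → ℂ} (hσ : IsSymbol b σ)
    (hb : b.re < -(n : ℝ)) {ξ : E n} (hξ : ξ ≠ 0) :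
    Tendsto (fun t : ℝ => t ^ n • σ (t • ξ)) atTop (𝓝 0) := by
  have hn : (0 : ℝ) ≤ n := n.cast_nonneg
  obtain ⟨C, hC0, hC⟩ := hσ.norm_iteratedFDeriv_le (by linarith) 0
  simp only [norm_iteratedFDeriv_zero, Nat.cast_zero, sub_zero] at hC
  have hlim : Tendsto (fun t : ℝ => C * ‖ξ‖ ^ b.re * t ^ (-(-(n + b.re)))) atTop (𝓝 0) := by
    simpa using (tendsto_rpow_neg_atTop (y := -(n + b.re)) (by linarith)).const_mul
      (C * ‖ξ‖ ^ b.re)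
  refine squeeze_zero_norm' ?_ hlim
  filter_upwards [eventually_gt_atTop 0] with t ht
  have h := hC (t • ξ) (smul_ne_zero ht.ne' hξ)
  rw [norm_smul, Real.norm_of_nonneg ht.le, Real.mul_rpow ht.le (norm_nonneg _)] at h
  rw [norm_smul, norm_pow, Real.norm_of_nonneg ht.le, neg_neg, Real.rpow_add ht,
    Real.rpow_natCast]
  calc t ^ n * ‖σ (t • ξ)‖ ≤ t ^ n * (C * (t ^ b.re * ‖ξ‖ ^ b.re)) := by gcongr
    _ = _ := by ring

/-- `∫_1^∞ t^(n-1) σ(tξ) dt`. -/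
noncomputable def radialPrimitive (σ : E n → ℂ) (ξ : E n) : ℂ :=
  ∫ t in Set.Ioi (1 : ℝ), t ^ (n - 1) • σ (t • ξ)

theorem iteratedFDeriv_dilate {σ : E n → ℂ} (hσ : ContDiff ℝ ∞ σ) {t : ℝ} (ht : t ≠ 0) (k : ℕ)
    (ξ : E n) : iteratedFDeriv ℝ k (fun ξ => t ^ (n - 1) • σ (t • ξ)) ξ
      = (t ^ (n - 1) * t ^ k) • iteratedFDeriv ℝ k σ (t • ξ) := by
  have h1 : ContDiff ℝ ∞ fun ξ => σ (t • ξ) := hσ.comp (contDiff_const_smul t)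
  have h2 := iteratedFDeriv_const_smul_apply' (a := t ^ (n - 1))
    (h1.contDiffAt (x := ξ).of_le (m := k) (mod_cast le_top))
  rw [h2, iteratedFDeriv_comp_dilation σ ht, smul_smul]

/-- The factor t^k of the chain rule cancels the extra decay t^(-k) of the k-th derivative. The
exponent of t is therefore n - 1 + Re b < -1 for every k, which is integrable at infinity. -/
theorem IsSymbol.norm_dilate_le (hn : 1 ≤ n) {b : ℂ} {σ : E n → ℂ} (hσ : IsSymbol b σ)
    (hb : b.re < -(n : ℝ)) (k : ℕ) : ∃ C : ℝ, 0 ≤ C ∧ ∀ ξ, ξ ≠ 0 → ∀ t : ℝ, 1 < t →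
      ‖iteratedFDeriv ℝ k (fun ξ => t ^ (n - 1) • σ (t • ξ)) ξ‖
        ≤ C * ‖ξ‖ ^ (b.re - (k : ℝ)) * t ^ ((n : ℝ) - 1 + b.re) := by
  have hn' : (0 : ℝ) ≤ n := n.cast_nonneg
  obtain ⟨C, hC0, hC⟩ := hσ.norm_iteratedFDeriv_le (by linarith) k
  refine ⟨C, hC0, fun ξ hξ t ht => ?_⟩
  have ht0 : 0 < t := by linarith
  rw [iteratedFDeriv_dilate hσ.smooth ht0.ne', norm_smul, Real.norm_of_nonneg (by positivity)]
  have h := hC (t • ξ) (smul_ne_zero ht0.ne' hξ)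
  rw [norm_smul, Real.norm_of_nonneg ht0.le, Real.mul_rpow ht0.le (norm_nonneg _)] at h
  have h2 : t ^ (n - 1) * t ^ k * t ^ (b.re - (k : ℝ)) = t ^ ((n : ℝ) - 1 + b.re) := by
    rw [← Real.rpow_natCast t (n - 1), ← Real.rpow_natCast t k, ← Real.rpow_add ht0,
      ← Real.rpow_add ht0, Nat.cast_sub hn]
    congr 1; push_cast; ring
  calc _ ≤ t ^ (n - 1) * t ^ k * (C * (t ^ (b.re - (k : ℝ)) * ‖ξ‖ ^ (b.re - (k : ℝ)))) := by gcongr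
    _ = C * ‖ξ‖ ^ (b.re - (k : ℝ)) * (t ^ (n - 1) * t ^ k * t ^ (b.re - (k : ℝ))) := by ring
    _ = _ := by rw [h2]

theorem IsSymbol.dominatedFamily_dilate (hn : 1 ≤ n) {b : ℂ} {σ : E n → ℂ} (hσ : IsSymbol b σ)
    (hb : b.re < -(n : ℝ)) : DominatedFamily (volume.restrict (Set.Ioi (1 : ℝ))) {0}ᶜ
      (fun (t : ℝ) (ξ : E n) => t ^ (n - 1) • σ (t • ξ)) where
  smooth t := ((hσ.smooth.comp (contDiff_const_smul t)).const_smul _).contDiffOn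
  measurable k ξ _ := by
    have hc : ContinuousOn (fun t : ℝ =>
        (t ^ (n - 1) * t ^ k) • iteratedFDeriv ℝ k σ (t • ξ)) (Set.Ioi 1) := by
      have h1 := hσ.smooth.continuous_iteratedFDeriv (m := k) (mod_cast le_top)
      have h2 : Continuous fun t : ℝ => iteratedFDeriv ℝ k σ (t • ξ) :=
        h1.comp (continuous_id.smul continuous_const)
      exact (((continuous_pow _).mul (continuous_pow _)).smul h2).continuousOn
    refine (hc.aestronglyMeasurable measurableSet_Ioi).congr ?_
    filter_upwards [ae_restrict_mem measurableSet_Ioi] with t ht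
    rw [iteratedFDeriv_dilate hσ.smooth (by have := Set.mem_Ioi.1 ht; linarith)]
  bound k ξ hξ := by
    obtain ⟨C, hC0, hC⟩ := hσ.norm_dilate_le hn hb k
    have hξ0 : 0 < ‖ξ‖ := norm_pos_iff.2 hξ
    have hn' : (0 : ℝ) ≤ n := n.cast_nonneg
    have hk : (0 : ℝ) ≤ k := k.cast_nonneg
    refine ⟨fun t => C * (‖ξ‖ / 2) ^ (b.re - (k : ℝ)) * t ^ ((n : ℝ) - 1 + b.re),
      (integrableOn_Ioi_rpow_of_lt (by linarith) one_pos).const_mul _,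
      {y | ‖ξ‖ / 2 < ‖y‖}, (isOpen_lt continuous_const continuous_norm).mem_nhds (by simpa), ?_⟩
    filter_upwards [ae_restrict_mem measurableSet_Ioi] with t ht y hy
    have hy' : ‖ξ‖ / 2 < ‖y‖ := hy
    have hy0 : y ≠ 0 := norm_pos_iff.1 (by linarith)
    have ht0 : 0 < t := by have := Set.mem_Ioi.1 ht; linarith
    refine (hC y hy0 t ht).trans ?_
    have h := Real.rpow_le_rpow_of_nonpos (z := b.re - k) (half_pos hξ0) hy'.le (by linarith)
    exact mul_le_mul_of_nonneg_right (mul_le_mul_of_nonneg_left h hC0) (by positivity)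

theorem IsSymbol.contDiffOn_radialPrimitive (hn : 1 ≤ n) {b : ℂ} {σ : E n → ℂ} (hσ : IsSymbol b σ)
    (hb : b.re < -(n : ℝ)) : ContDiffOn ℝ ∞ (radialPrimitive σ) {0}ᶜ :=
  (hσ.dominatedFamily_dilate hn hb).contDiffOn_integral isOpen_compl_zero

theorem IsSymbol.hasGrowth_radialPrimitive (hn : 1 ≤ n) {b : ℂ} {σ : E n → ℂ} (hσ : IsSymbol b σ)
    (hb : b.re < -(n : ℝ)) : HasGrowth b.re (radialPrimitive σ) := by
  refine HasGrowth.of_bound fun k => ?_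
  obtain ⟨C, hC0, hC⟩ := hσ.norm_dilate_le hn hb k
  refine ⟨C * ∫ t in Set.Ioi (1 : ℝ), t ^ ((n : ℝ) - 1 + b.re), fun ξ hξ => ?_⟩
  have hξ0 : ξ ≠ 0 := norm_pos_iff.1 (by linarith)
  have h := (hσ.dominatedFamily_dilate hn hb).iteratedFDeriv_integral isOpen_compl_zero k hξ0
  have h2 := norm_integral_le_of_norm_le
    (((integrableOn_Ioi_rpow_of_lt (a := (n : ℝ) - 1 + b.re) (by linarith) one_pos).const_mul
      (C * ‖ξ‖ ^ (b.re - (k : ℝ)))))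
    (by filter_upwards [ae_restrict_mem measurableSet_Ioi] with t ht using hC ξ hξ0 t ht)
  rw [← h, integral_const_mul] at h2
  exact h2.trans_eq (by ring)

/-- Under the integral sign the divergence becomes t^(n-1) `radialDiv σ (t • ξ)`, the t-derivative
of t^n σ(tξ); this function tends to 0 at infinity and equals σ(ξ) at t = 1. -/
theorem IsSymbol.radialDiv_radialPrimitive (hn : 1 ≤ n) {b : ℂ} {σ : E n → ℂ} (hσ : IsSymbol b σ)
    (hb : b.re < -(n : ℝ)) {ξ : E n} (hξ : ξ ≠ 0) :
    radialDiv (radialPrimitive σ) ξ = -σ ξ := by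
  have hdom := hσ.dominatedFamily_dilate hn hb
  obtain ⟨h1, h2⟩ := hdom.fderiv_integral isOpen_compl_zero hξ ξ
  have h3 := hdom.integrable_apply hξ
  have hσd : Differentiable ℝ σ := hσ.smooth.differentiable (by simp)
  have h4 : ∀ t : ℝ, (n : ℂ) * (t ^ (n - 1) • σ (t • ξ))
      + fderiv ℝ (fun ξ => t ^ (n - 1) • σ (t • ξ)) ξ ξ
      = t ^ (n - 1) • radialDiv σ (t • ξ) := by
    intro t
    have hd : HasFDerivAt (fun y => t ^ (n - 1) • σ (t • y)) (t ^ (n - 1) •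
        (fderiv ℝ σ (t • ξ)).comp (t • ContinuousLinearMap.id ℝ (E n))) ξ := by
      have h5 : HasFDerivAt (fun y => σ (t • y)) _ ξ :=
        (hσd (t • ξ)).hasFDerivAt.comp ξ ((hasFDerivAt_id ξ).const_smul t)
      exact h5.const_smul (t ^ (n - 1))
    rw [hd.fderiv]
    simp only [radialDiv, smul_apply, ContinuousLinearMap.comp_apply,
      ContinuousLinearMap.id_apply, Complex.real_smul]
    ring
  have h5 : radialDiv (radialPrimitive σ) ξ
      = ∫ t in Set.Ioi (1 : ℝ), t ^ (n - 1) • radialDiv σ (t • ξ) := by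
    rw [← integral_congr_ae (Eventually.of_forall h4), integral_add (h3.const_mul _) h1,
      ← h2, integral_const_mul]
    rfl
  have h6 : IntegrableOn (fun t : ℝ => t ^ (n - 1) • radialDiv σ (t • ξ)) (Set.Ioi 1) :=
    ((h3.const_mul _).add h1).congr (Eventually.of_forall h4)
  rw [h5, integral_Ioi_of_hasDerivAt_of_tendsto'
    (fun t _ => hasDerivAt_pow_mul_radial hn hσd ξ t) h6 (hσ.tendsto_pow_smul hb hξ)]
  simp

theorem IsHomogeneous.integral_dilate {d : ℂ} (hn : 1 ≤ n) {f : E n → ℂ} (hf : IsHomogeneous d f)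
    (hd : d.re < -(n : ℝ)) {ξ : E n} (hξ : ξ ≠ 0) :
    IntegrableOn (fun t : ℝ => t ^ (n - 1) • f (t • ξ)) (Set.Ioi 1) ∧
    ∫ t in Set.Ioi (1 : ℝ), t ^ (n - 1) • f (t • ξ) = -(1 / (d + n)) * f ξ := by
  have h1 : ∀ t ∈ Set.Ioi (1 : ℝ), t ^ (n - 1) • f (t • ξ) = (t : ℂ) ^ (d + n - 1) * f ξ := by
    intro t ht
    have ht0 : 0 < t := by have := Set.mem_Ioi.1 ht; linarith
    have ht' : (t : ℂ) ≠ 0 := by exact_mod_cast ht0.ne'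
    rw [hf.homogeneous t ht0 ξ hξ, Complex.real_smul, Complex.ofReal_pow, ← Complex.cpow_natCast,
      ← mul_assoc, ← Complex.cpow_add _ _ ht', Nat.cast_sub hn]
    congr 2; push_cast; ring
  have hre : (d + n - 1).re < -1 := by simp; linarith
  refine ⟨(integrableOn_congr_fun h1 measurableSet_Ioi).2
    ((integrableOn_Ioi_cpow_of_lt hre one_pos).mul_const _), ?_⟩
  rw [setIntegral_congr_fun measurableSet_Ioi h1, integral_mul_const,
    integral_Ioi_cpow_of_lt hre one_pos]
  simp
  ring

/-- For |ξ| > 1 the whole ray tξ, t > 1, lies where χ = 1, and on degree b - j the primitive is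
multiplication by -1/(b - j + n). Primitives of remainders are thus remainders of the primitive. -/
theorem radialPrimitive_remainder (hn : 1 ≤ n) (hχ : IsCutoff χ) {b : ℂ} {σ : E n → ℂ}
    {s : ℕ → E n → ℂ} (hs : IsExpansion χ b σ s) (hb : b.re < -(n : ℝ)) (N : ℕ) {ξ : E n}
    (hξ : 1 < ‖ξ‖) : radialPrimitive (remainder χ σ s N) ξ = radialPrimitive σ ξ
      - ∑ j ∈ Finset.range N, -(1 / (b - j + n)) * s j ξ := by
  have hξ0 : ξ ≠ 0 := norm_pos_iff.1 (by linarith)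
  have hre : ∀ j : ℕ, (b - j).re < -(n : ℝ) := fun j => by
    have : (0 : ℝ) ≤ j := j.cast_nonneg
    simp; linarith
  have h1 : ∀ t ∈ Set.Ioi (1 : ℝ), t ^ (n - 1) • remainder χ σ s N (t • ξ)
      = t ^ (n - 1) • σ (t • ξ) - ∑ j ∈ Finset.range N, t ^ (n - 1) • s j (t • ξ) := by
    intro t ht
    have ht1 := Set.mem_Ioi.1 ht
    rw [remainder_eq hχ σ s N, smul_sub, Finset.smul_sum]
    rw [norm_smul, Real.norm_of_nonneg (by linarith)]
    nlinarith
  have h2 := fun j => (hs.homogeneous j).integral_dilate hn (hre j) hξ0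
  have h3 : Integrable (fun t : ℝ => t ^ (n - 1) • σ (t • ξ)) (volume.restrict (Set.Ioi 1)) :=
    (hs.symbol.dominatedFamily_dilate hn hb).integrable_apply hξ0
  rw [radialPrimitive, setIntegral_congr_fun measurableSet_Ioi h1,
    integral_sub h3 (integrable_finsetSum _ fun j _ => (h2 j).1),
    integral_finsetSum _ fun j _ => (h2 j).1, Finset.sum_congr rfl fun j _ => (h2 j).2]
  rfl

theorem IsExpansion.radialPrimitive (hn : 1 ≤ n) (hχ : IsCutoff χ) {b : ℂ} {σ : E n → ℂ}
    {s : ℕ → E n → ℂ} (hs : IsExpansion χ b σ s) (hb : b.re < -(n : ℝ)) :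
    IsExpansion χ b (fun ξ => (χ ξ : ℂ) * radialPrimitive σ ξ)
      (fun j => (-(1 / (b - j + n))) • s j) := by
  refine IsExpansion.of_growth hχ
    (hχ.contDiff_mul (hs.symbol.contDiffOn_radialPrimitive hn hb)) (fun j => ?_) fun N => ?_
  · simpa using (hs.homogeneous j).lincomb (hs.homogeneous j) (-(1 / (b - j + n))) 0
  · have hN : (0 : ℝ) ≤ N := N.cast_nonneg
    have := (hs.remainder_symbol N).hasGrowth_radialPrimitive hn (by simp; linarith)
    refine ⟨_, by simpa using this, fun ξ hξ => ?_⟩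
    rw [radialPrimitive_remainder hn hχ hs hb N hξ, hχ.eq_one ξ hξ.le]
    simp

/-! ### Removing the tail of a symbol by a radial divergence -/

section Decomposition

variable {P : ℂ → (E n → ℂ) → Prop} (hP : IsDegreeClass P)

theorem integral_radialDiv_of_isSymbol (hn : 1 ≤ n) {b : ℂ} {h : E n → ℂ} (hh : IsSymbol b h)
    (hb : b.re < -(n : ℝ)) : Integrable (radialDiv h) ∧ ∫ ξ, radialDiv h ξ = 0 := by
  have h1 : radialDiv h = fun ξ => ∑ i, partialDeriv i (coord i * h) ξ := by
    ext ξ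
    rw [sum_partialDeriv_coord_mul (hh.smooth.differentiable (by simp) ξ)]
  have hi : Integrable (radialDiv h) := by
    rw [h1]
    refine integrable_finsetSum _ fun i _ => ?_
    exact (((isSymbol_coord i).mul hh).partialDeriv i).integrable (by simpa using hb)
  exact ⟨hi, integral_radialDiv_eq_zero hn hh.smooth hi fun η hη =>
    hh.tendsto_pow_smul hb (by rintro rfl; simp at hη)⟩

theorem contDiff_radialDiv {h : E n → ℂ} (hh : ContDiff ℝ ∞ h) : ContDiff ℝ ∞ (radialDiv h) :=
  (contDiff_const.mul hh).add ((hh.fderiv_right (m := ∞) le_rfl).clm_apply contDiff_id)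

theorem radialDiv_congr {f g : E n → ℂ} {ξ : E n} (h : f =ᶠ[𝓝 ξ] g) :
    radialDiv f ξ = radialDiv g ξ := by
  simp only [radialDiv, h.fderiv_eq, h.eq_of_nhds]

theorem radialDiv_smul (c : ℂ) {f : E n → ℂ} {ξ : E n} (hf : DifferentiableAt ℝ f ξ) :
    radialDiv (c • f) ξ = c * radialDiv f ξ := by
  simp only [radialDiv, Pi.smul_apply, fderiv_const_smul hf, smul_apply, smul_eq_mul]
  ring

/-- An integrable classical symbol is, up to the divergence of a radial field, a test function
with the same integral. -/
theorem exists_radialDiv_of_order_lt (hn : 1 ≤ n) (hχ : IsCutoff χ) {b : ℂ} (hPb : P b 0)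
    (hb : b.re < -(n : ℝ)) {σ : E n → ℂ} (hσ : σ ∈ symbolSpace χ hP b hPb) :
    ∃ h ∈ symbolSpace χ hP b hPb, ContDiff ℝ ∞ h ∧
      (∀ ξ, 1 < ‖ξ‖ → σ ξ - radialDiv h ξ = 0) ∧
      ∫ ξ, (σ ξ - radialDiv h ξ) = ∫ ξ, σ ξ := by
  obtain ⟨s, hs, hPs⟩ := hσ
  have hs' := hs.radialPrimitive hn hχ hb
  -- The sign compensates that the divergence of the primitive is -σ; the cut-off removes the
  -- singularity at 0.
  let h : E n → ℂ := (-1 : ℂ) • fun ξ => (χ ξ : ℂ) * radialPrimitive σ ξ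
  have hmem : h ∈ symbolSpace χ hP b hPb :=
    Submodule.smul_mem _ _ ⟨_, hs', fun j => hP.smul (hPs j) _⟩
  have hsym : IsSymbol b h := by
    obtain ⟨t, ht, -⟩ := hmem
    exact ht.symbol
  refine ⟨h, hmem, hsym.smooth, fun ξ hξ => ?_, ?_⟩
  · have hξ0 : ξ ≠ 0 := norm_pos_iff.1 (by linarith)
    have he : (fun ξ => (χ ξ : ℂ) * radialPrimitive σ ξ) =ᶠ[𝓝 ξ] radialPrimitive σ := by
      filter_upwards [isOpen_one_lt_norm.mem_nhds hξ] with y hy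
      simp [hχ.eq_one y (le_of_lt hy)]
    rw [radialDiv_smul _ (hs'.symbol.smooth.differentiable (by simp) ξ), radialDiv_congr he,
      hs.symbol.radialDiv_radialPrimitive hn hb hξ0]
    ring
  · obtain ⟨h1, h2⟩ := integral_radialDiv_of_isSymbol hn hsym hb
    rw [integral_sub (hs.symbol.integrable hb) h1, h2, sub_zero]

theorem IsHomogeneous.fderiv_self {d : ℂ} {f : E n → ℂ} (hf : IsHomogeneous d f) {ξ : E n}
    (hξ : ξ ≠ 0) : fderiv ℝ f ξ ξ = d * f ξ := by
  have h1 : HasDerivAt (fun t : ℝ => f (t • ξ)) (fderiv ℝ f ξ ξ) 1 := by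
    have h2 := ((hasDerivAt_id (1 : ℝ)).smul_const ξ)
    simp only [id_eq, one_smul] at h2
    have h3 : HasFDerivAt f (fderiv ℝ f ξ) ((1 : ℝ) • ξ) := by
      simpa using (hf.differentiableAt hξ).hasFDerivAt
    exact h3.comp_hasDerivAt 1 h2
  have h2 : HasDerivAt (fun t : ℝ => (t : ℂ) ^ d * f ξ) (d * f ξ) 1 := by
    have h4 : HasDerivAt (fun z : ℂ => z ^ d) d ((1 : ℝ) : ℂ) := by
      simpa using (hasDerivAt_id (1 : ℂ)).cpow_const (c := d) (by simp)
    simpa using (h4.comp_ofReal).mul_const (f ξ)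
  have h3 : (fun t : ℝ => f (t • ξ)) =ᶠ[𝓝 1] fun t : ℝ => (t : ℂ) ^ d * f ξ := by
    filter_upwards [lt_mem_nhds one_pos] with t ht using hf.homogeneous t ht ξ hξ
  exact h1.unique (h2.congr_of_eventuallyEq h3)

/-- A homogeneous function of non-critical degree is, up to the divergence of a radial field, a
test function. -/
theorem exists_radialDiv_of_homogeneous (hn : 1 ≤ n) (hχ : IsCutoff χ) {d : ℂ} (hPd : P d 0)
    (hd : d + n ≠ 0) {f : E n → ℂ} (hf : IsHomogeneous d f) (hPf : P d f) :
    ∃ h ∈ symbolSpace χ hP d hPd, ContDiff ℝ ∞ h ∧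
      (∀ ξ, 1 < ‖ξ‖ → (χ ξ : ℂ) * f ξ - radialDiv h ξ = 0) ∧
      ∫ ξ in Metric.ball (0 : E n) 1, ((χ ξ : ℂ) * f ξ - radialDiv h ξ)
        = (∫ ξ in Metric.ball (0 : E n) 1, (χ ξ : ℂ) * f ξ) - 1 / (d + n) *
          ∫ η : Metric.sphere (0 : E n) 1, f η ∂((volume : Measure (E n)).toSphere) := by
  have hsm := hχ.contDiff_mul hf.smooth
  have hmem : (fun ξ => (χ ξ : ℂ) * f ξ) ∈ symbolSpace χ hP d hPd :=
    mem_symbolSpace_of_eq_homogeneous hP hPd hχ hf hPf hsm fun ξ hξ => by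
      simp [hχ.eq_one ξ hξ.le]
  -- By Euler's identity the divergence of the radial field with coefficient f is (d + n) f. The
  -- flux of the normalised field through the sphere is the sphere term of the cut-off integral.
  have hhs : ContDiff ℝ ∞ ((1 / (d + n)) • fun ξ => (χ ξ : ℂ) * f ξ) := hsm.const_smul (1 / (d + n))
  refine ⟨(1 / (d + n)) • fun ξ => (χ ξ : ℂ) * f ξ, Submodule.smul_mem _ _ hmem,
    hhs, fun ξ hξ => ?_, ?_⟩
  · have hξ0 : ξ ≠ 0 := norm_pos_iff.1 (by linarith)
    have he : (fun ξ => (χ ξ : ℂ) * f ξ) =ᶠ[𝓝 ξ] f := by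
      filter_upwards [isOpen_one_lt_norm.mem_nhds hξ] with y hy
      simp [hχ.eq_one y (le_of_lt hy)]
    rw [radialDiv_smul _ (hsm.differentiable (by simp) ξ), radialDiv_congr he, radialDiv,
      hf.fderiv_self hξ0, hχ.eq_one ξ hξ.le]
    field_simp
    push_cast
    ring
  · have hint : ∀ {g : E n → ℂ}, Continuous g → IntegrableOn g (Metric.ball (0 : E n) 1) :=
      fun hg => (hg.continuousOn.integrableOn_compact
        (isCompact_closedBall 0 1)).mono_set Metric.ball_subset_closedBall
    rw [integral_sub (hint hsm.continuous) (hint (continuous_radialDiv hhs)),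
      integral_ball_radialDiv hn hhs, ← integral_const_mul]
    congr 2
    ext η
    simp [hχ.eq_one η (by simp)]

end Decomposition

end RadialPrimitive

/-! ### Jointly smooth families over a compact parameter set -/

section CompactParameter

open Topology

/-- Derivatives in x are restrictions of joint derivatives to the subspace 0 × X, hence jointly
continuous and bounded on K times a compact neighbourhood. -/
theorem DominatedFamily.of_contDiffOn {A X F : Type*} [NormedAddCommGroup A] [NormedSpace ℝ A]
    [MeasurableSpace A] [OpensMeasurableSpace A] [SecondCountableTopology A]
    [NormedAddCommGroup X] [NormedSpace ℝ X]
    [LocallyCompactSpace X] [NormedAddCommGroup F] [NormedSpace ℝ F] {μ : Measure A}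
    [IsFiniteMeasureOnCompacts μ] {K : Set A} (hK : IsCompact K) (hKm : MeasurableSet K)
    {U : Set X} (hU : IsOpen U) {G : A × X → F} (hG : ContDiffOn ℝ ∞ G (Set.univ ×ˢ U)) :
    DominatedFamily (μ.restrict K) U (fun t x => G (t, x)) := by
  have hs : ∀ t, ContDiffOn ℝ ∞ (fun x => G (t, x)) U := fun t =>
    hG.comp (contDiff_prodMk_right t).contDiffOn fun x hx => ⟨Set.mem_univ _, hx⟩
  have hopen : IsOpen ((Set.univ : Set A) ×ˢ U) := isOpen_univ.prod hU
  have hslice : ∀ (k : ℕ) (t : A), ∀ x ∈ U, iteratedFDeriv ℝ k (fun x => G (t, x)) x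
      = (iteratedFDeriv ℝ k G (t, x)).compContinuousLinearMap
        fun _ => ContinuousLinearMap.inr ℝ A X := by
    intro k t x hx
    -- Translating by (t, 0) makes the slice a composition with the linear inclusion of X.
    have h1 : ContDiffOn ℝ ∞ (fun y => G (y + (t, 0))) (Set.univ ×ˢ U) :=
      hG.comp (contDiff_id.add contDiff_const).contDiffOn fun y hy => ⟨Set.mem_univ _, by
        simpa using hy.2⟩
    have hpre : ContinuousLinearMap.inr ℝ A X ⁻¹' (Set.univ ×ˢ U) = U := by ext; simp
    have h2 := (ContinuousLinearMap.inr ℝ A X).iteratedFDerivWithin_comp_right h1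
      hopen.uniqueDiffOn (by rw [hpre]; exact hU.uniqueDiffOn) (x := x) (by simpa using hx)
      (i := k) (mod_cast le_top)
    rw [hpre, iteratedFDerivWithin_of_isOpen k hU hx,
      iteratedFDerivWithin_of_isOpen k hopen (by simpa using hx),
      iteratedFDeriv_comp_add_right] at h2
    simpa [Function.comp_def] using h2
  have hcont : ∀ k : ℕ, ContinuousOn (fun p : A × X => iteratedFDeriv ℝ k (fun x => G (p.1, x)) p.2)
      (Set.univ ×ˢ U) := by
    intro k
    have h1 : ContinuousOn (iteratedFDeriv ℝ k G) (Set.univ ×ˢ U) := by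
      intro p hp
      exact ((hG.contDiffAt (hopen.mem_nhds hp)).continuousAt_iteratedFDeriv
        (mod_cast le_top)).continuousWithinAt
    have h2 := (ContinuousMultilinearMap.compContinuousLinearMapL (𝕜 := ℝ) (F := F)
      (fun _ : Fin k => ContinuousLinearMap.inr ℝ A X)).continuous.comp_continuousOn h1
    exact h2.congr fun p hp => hslice k p.1 p.2 hp.2
  refine ⟨hs, fun k x hx => ?_, fun k x hx => ?_⟩
  · have h1 : Continuous fun t => iteratedFDeriv ℝ k (fun x => G (t, x)) x :=
      (hcont k).comp_continuous (f := fun t => (t, x)) (by fun_prop) fun t => ⟨Set.mem_univ _, hx⟩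
    exact h1.aestronglyMeasurable
  · obtain ⟨V, hV, hVU, hVc⟩ := local_compact_nhds (hU.mem_nhds hx)
    obtain ⟨C, hC⟩ := (hK.prod hVc).exists_bound_of_continuousOn
      ((hcont k).mono (Set.prod_mono (Set.subset_univ _) hVU))
    refine ⟨fun _ => C, ?_, V, hV, ?_⟩
    · have : IsFiniteMeasure (μ.restrict K) := ⟨by simpa using hK.measure_lt_top⟩
      exact integrable_const C
    · filter_upwards [ae_restrict_mem hKm] with t ht y hy using hC (t, y) ⟨ht, hy⟩

end CompactParameter

/-! ### Test functions modulo divergences -/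

section TestFunctions

open Topology

variable {n : ℕ}

/-- The vector field transporting `φ` to its convolution with `θ`. -/
noncomputable def transportField (θ φ : E n → ℂ) (i : Fin n) (x : E n) : ℂ :=
  ∫ p in Metric.closedBall (0 : E n) 1 ×ˢ Set.Icc (0 : ℝ) 1,
    (θ p.1 * coord i p.1) * φ (x - p.2 • p.1)

variable {θ φ : E n → ℂ}

theorem dominatedFamily_transport (hθ : ContDiff ℝ ∞ θ) (hφ : ContDiff ℝ ∞ φ) (i : Fin n) :
    DominatedFamily (volume.restrict (Metric.closedBall (0 : E n) 1 ×ˢ Set.Icc (0 : ℝ) 1))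
      (Set.univ : Set (E n)) (fun p x => (θ p.1 * coord i p.1) * φ (x - p.2 • p.1)) := by
  have hG : ContDiff ℝ ∞ fun q : (E n × ℝ) × E n =>
      (θ q.1.1 * coord i q.1.1) * φ (q.2 - q.1.2 • q.1.1) := by
    have h1 : ContDiff ℝ ∞ fun q : (E n × ℝ) × E n => q.1.1 := contDiff_fst.fst
    have h2 : ContDiff ℝ ∞ fun q : (E n × ℝ) × E n => q.2 - q.1.2 • q.1.1 :=
      contDiff_snd.sub (contDiff_fst.snd.smul h1)
    exact ((hθ.comp h1).mul ((contDiff_coord i).comp h1)).mul (hφ.comp h2)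
  exact DominatedFamily.of_contDiffOn ((isCompact_closedBall _ _).prod isCompact_Icc)
    (Metric.isClosed_closedBall.measurableSet.prod measurableSet_Icc) isOpen_univ hG.contDiffOn

theorem contDiff_transportField (hθ : ContDiff ℝ ∞ θ) (hφ : ContDiff ℝ ∞ φ) (i : Fin n) :
    ContDiff ℝ ∞ (transportField θ φ i) :=
  contDiffOn_univ.1 ((dominatedFamily_transport hθ hφ i).contDiffOn_integral isOpen_univ)

theorem transportField_eq_zero (hφ0 : ∀ ξ, 1 < ‖ξ‖ → φ ξ = 0) (i : Fin n) (x : E n)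
    (hx : 2 < ‖x‖) : transportField θ φ i x = 0 := by
  refine integral_eq_zero_of_ae ?_
  filter_upwards [ae_restrict_mem (Metric.isClosed_closedBall.measurableSet.prod measurableSet_Icc)]
    with p hp
  have h1 : ‖p.1‖ ≤ 1 := by simpa using hp.1
  have h2 : ‖p.2 • p.1‖ ≤ 1 := by
    rw [norm_smul, Real.norm_of_nonneg hp.2.1]
    exact mul_le_one₀ hp.2.2 (norm_nonneg _) h1
  have h3 := norm_sub_norm_le x (p.2 • p.1)
  rw [hφ0 _ (by linarith)]
  simp

/-- The integrand of the divergence is θ(h) times the s-derivative of -φ(x - sh); integrating over s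
from 0 to 1 leaves θ(h) (φ(x) - φ(x - h)). -/
theorem sum_partialDeriv_transportField (hθ : ContDiff ℝ ∞ θ) (hφ : ContDiff ℝ ∞ φ)
    (hθ0 : ∀ ξ, 1 < ‖ξ‖ → θ ξ = 0) (x : E n) :
    ∑ i, partialDeriv i (transportField θ φ i) x
      = (∫ h, θ h) * φ x - ∫ h, θ h * φ (x - h) := by
  have hφd : Differentiable ℝ φ := hφ.differentiable (by simp)
  have hder := fun i => (dominatedFamily_transport hθ hφ i).fderiv_integral isOpen_univ
    (Set.mem_univ x) (EuclideanSpace.single i (1 : ℝ))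
  have hpt : ∀ p : E n × ℝ, ∑ i, fderiv ℝ (fun x => (θ p.1 * coord i p.1) * φ (x - p.2 • p.1)) x
      (EuclideanSpace.single i (1 : ℝ)) = θ p.1 * fderiv ℝ φ (x - p.2 • p.1) p.1 := by
    intro p
    have h1 : ∀ i : Fin n, fderiv ℝ (fun x => (θ p.1 * coord i p.1) * φ (x - p.2 • p.1)) x
        = (θ p.1 * coord i p.1) • fderiv ℝ φ (x - p.2 • p.1) := fun i => by
      have hd : DifferentiableAt ℝ (fun x => φ (x - p.2 • p.1)) x :=
        (hφd _).comp x (differentiableAt_id.sub_const _)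
      rw [fderiv_const_mul hd, fderiv_comp_sub]
    have h2 : p.1 = ∑ i, p.1 i • EuclideanSpace.single i (1 : ℝ) := by
      conv_lhs => rw [← (EuclideanSpace.basisFun (Fin n) ℝ).sum_repr p.1]
      simp
    conv_rhs => enter [2, 2]; rw [h2]
    simp only [h1]
    simp only [map_sum, map_smul, Finset.mul_sum, smul_apply, smul_eq_mul, Complex.real_smul,
      coord]
    exact Finset.sum_congr rfl fun i _ => by ring
  have h1 : ∑ i, partialDeriv i (transportField θ φ i) x
      = ∫ p in Metric.closedBall (0 : E n) 1 ×ˢ Set.Icc (0 : ℝ) 1,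
        θ p.1 * fderiv ℝ φ (x - p.2 • p.1) p.1 := by
    rw [← integral_congr_ae (Filter.Eventually.of_forall hpt),
      integral_finsetSum _ fun i _ => (hder i).1]
    exact Finset.sum_congr rfl fun i _ => (hder i).2
  have hφ' : Continuous (fderiv ℝ φ) := (hφ.fderiv_right (m := ∞) le_rfl).continuous
  have hc : Continuous fun p : E n × ℝ => θ p.1 * fderiv ℝ φ (x - p.2 • p.1) p.1 :=
    (hθ.continuous.comp continuous_fst).mul
      ((hφ'.comp (by fun_prop : Continuous fun p : E n × ℝ => x - p.2 • p.1)).clm_apply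
        continuous_fst)
  have hint : IntegrableOn (fun p : E n × ℝ => θ p.1 * fderiv ℝ φ (x - p.2 • p.1) p.1)
      (Metric.closedBall (0 : E n) 1 ×ˢ Set.Icc (0 : ℝ) 1) (volume.prod volume) :=
    hc.continuousOn.integrableOn_compact ((isCompact_closedBall _ _).prod isCompact_Icc)
  have hinner : ∀ h : E n, ∫ s in Set.Icc (0 : ℝ) 1, θ h * fderiv ℝ φ (x - s • h) h
      = θ h * φ x - θ h * φ (x - h) := by
    intro h
    have hd : ∀ s : ℝ, HasDerivAt (fun s : ℝ => -φ (x - s • h)) (fderiv ℝ φ (x - s • h) h) s := by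
      intro s
      have h2 := ((hasDerivAt_id s).smul_const h).const_sub x
      simp only [id_eq, one_smul] at h2
      have h3 := ((hφd (x - s • h)).hasFDerivAt.comp_hasDerivAt s h2).neg
      convert! h3 using 1
      simp
    rw [integral_const_mul, integral_Icc_eq_integral_Ioc, ← intervalIntegral.integral_of_le
      zero_le_one, intervalIntegral.integral_eq_sub_of_hasDerivAt (fun s _ => hd s)]
    · simp; ring
    · exact Continuous.intervalIntegrable ((hφ'.comp (by fun_prop)).clm_apply continuous_const) _ _
  have hθi : ∀ g : E n → ℂ, Continuous g → Integrable (fun h => θ h * g h) := by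
    intro g hg
    refine (hθ.continuous.mul hg).integrable_of_hasCompactSupport ?_
    refine HasCompactSupport.intro (isCompact_closedBall (0 : E n) 1) fun h hh => ?_
    simp [hθ0 h (by simpa using hh)]
  have hball : ∀ g : E n → ℂ, ∫ h in Metric.closedBall (0 : E n) 1, θ h * g h
      = ∫ h, θ h * g h := by
    intro g
    refine setIntegral_eq_integral_of_forall_compl_eq_zero fun h hh => ?_
    rw [hθ0 h (by simpa using hh), zero_mul]
  have hg1 := hθi (fun _ => φ x) continuous_const
  have hg2 := hθi (fun h => φ (x - h)) (hφ.continuous.comp (by fun_prop))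
  rw [h1, Measure.volume_eq_prod, setIntegral_prod _ hint,
    integral_congr_ae (Filter.Eventually.of_forall hinner),
    integral_sub hg1.integrableOn hg2.integrableOn, hball, hball, integral_mul_const]

/-- A test function is determined by its integral up to the divergence of a compactly supported
vector field. -/
theorem exists_sum_partialDeriv_eq (hθ : ContDiff ℝ ∞ θ) (hφ : ContDiff ℝ ∞ φ)
    (hθ0 : ∀ ξ, 1 < ‖ξ‖ → θ ξ = 0) (hφ0 : ∀ ξ, 1 < ‖ξ‖ → φ ξ = 0) :
    ∃ W : Fin n → E n → ℂ, (∀ i, ContDiff ℝ ∞ (W i) ∧ ∀ ξ, 2 < ‖ξ‖ → W i ξ = 0) ∧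
      ∀ ξ, (∫ h, θ h) * φ ξ - (∫ h, φ h) * θ ξ = ∑ i, partialDeriv i (W i) ξ := by
  have h1 := contDiff_transportField hθ hφ
  have h2 := contDiff_transportField hφ hθ
  -- Antisymmetrising cancels the convolution terms, because convolution is commutative.
  refine ⟨fun i => transportField θ φ i - transportField φ θ i, fun i => ⟨(h1 i).sub (h2 i),
    fun ξ hξ => ?_⟩, fun ξ => ?_⟩
  · simp [transportField_eq_zero hφ0 i ξ hξ, transportField_eq_zero hθ0 i ξ hξ]
  · have h3 : ∀ i, partialDeriv i (transportField θ φ i - transportField φ θ i) ξ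
        = partialDeriv i (transportField θ φ i) ξ - partialDeriv i (transportField φ θ i) ξ := by
      intro i
      simp only [partialDeriv]
      rw [fderiv_sub ((h1 i).differentiable (by simp) ξ) ((h2 i).differentiable (by simp) ξ)]
      rfl
    have h4 : ∫ h, θ h * φ (ξ - h) = ∫ h, φ h * θ (ξ - h) := by
      rw [← integral_sub_left_eq_self (fun h => φ h * θ (ξ - h)) volume ξ]
      simp [mul_comm]
    rw [Finset.sum_congr rfl fun i _ => h3 i, Finset.sum_sub_distrib,
      sum_partialDeriv_transportField hθ hφ hθ0, sum_partialDeriv_transportField hφ hθ hφ0, h4]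
    ring

end TestFunctions

/-! ### Odd functions of degree -n are divergences, by rotations -/

section Rotations

open Topology

variable {n : ℕ}

/-- The infinitesimal rotation in the plane of the `i`-th and `j`-th coordinates. -/
noncomputable def rotGen (i j : Fin n) : E n →L[ℝ] E n :=
  (EuclideanSpace.proj (𝕜 := ℝ) i).smulRight (EuclideanSpace.single j (1 : ℝ)) -
    (EuclideanSpace.proj (𝕜 := ℝ) j).smulRight (EuclideanSpace.single i (1 : ℝ))

/-- The rotation by the angle `t` in the plane of the `i`-th and `j`-th coordinates. -/
noncomputable def rot (i j : Fin n) (t : ℝ) : E n →L[ℝ] E n :=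
  ContinuousLinearMap.id ℝ (E n) + (Real.cos t - 1) •
    ((EuclideanSpace.proj (𝕜 := ℝ) i).smulRight (EuclideanSpace.single i (1 : ℝ)) +
      (EuclideanSpace.proj (𝕜 := ℝ) j).smulRight (EuclideanSpace.single j (1 : ℝ)))
    + Real.sin t • rotGen i j

theorem rotGen_apply (i j : Fin n) (ξ : E n) (k : Fin n) :
    rotGen i j ξ k = (if k = j then ξ i else 0) - (if k = i then ξ j else 0) := by
  simp [rotGen]

theorem rot_apply (i j : Fin n) (t : ℝ) (ξ : E n) (k : Fin n) :
    rot i j t ξ k = ξ k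
      + (Real.cos t - 1) * ((if k = i then ξ i else 0) + (if k = j then ξ j else 0))
      + Real.sin t * ((if k = j then ξ i else 0) - (if k = i then ξ j else 0)) := by
  simp [rot, rotGen]
  split_ifs <;> ring

theorem rot_rot {i j : Fin n} (hij : i ≠ j) (s t : ℝ) (ξ : E n) :
    rot i j s (rot i j t ξ) = rot i j (s + t) ξ := by
  ext k
  simp only [rot_apply, Real.cos_add, Real.sin_add, hij, hij.symm, if_true, if_false]
  by_cases hi : k = i
  · subst hi; simp only [hij, if_true, if_false]; ring
  · by_cases hj : k = j
    · subst hj; simp only [hi, if_true, if_false]; ring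
    · simp [hi, hj]

theorem rot_zero (i j : Fin n) (ξ : E n) : rot i j 0 ξ = ξ := by
  ext k; simp [rot_apply]

theorem rot_two_pi (i j : Fin n) (ξ : E n) : rot i j (2 * Real.pi) ξ = ξ := by
  ext k; simp [rot_apply]

theorem rot_ne_zero {i j : Fin n} (hij : i ≠ j) (t : ℝ) {ξ : E n} (hξ : ξ ≠ 0) :
    rot i j t ξ ≠ 0 := by
  intro h
  have := rot_rot hij (-t) t ξ
  rw [h, map_zero, neg_add_cancel, rot_zero] at this
  exact hξ this.symm

theorem rot_rotGen {i j : Fin n} (hij : i ≠ j) (t : ℝ) (ξ : E n) :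
    rot i j t (rotGen i j ξ) = rotGen i j (rot i j t ξ) := by
  ext k
  simp only [rot_apply, rotGen_apply, hij, hij.symm, if_true, if_false]
  by_cases hi : k = i
  · subst hi; simp only [hij, if_true, if_false]; ring
  · by_cases hj : k = j
    · subst hj; simp only [hi, if_true, if_false]; ring
    · simp [hi, hj]

theorem hasDerivAt_rot {i j : Fin n} (hij : i ≠ j) (t : ℝ) (ξ : E n) :
    HasDerivAt (fun t => rot i j t ξ) (rotGen i j (rot i j t ξ)) t := by
  have h1 := ((((Real.hasDerivAt_cos t).sub_const 1).smul_const
    (ξ i • EuclideanSpace.single i (1 : ℝ) + ξ j • EuclideanSpace.single j (1 : ℝ))).const_add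
      ξ).add ((Real.hasDerivAt_sin t).smul_const (rotGen i j ξ))
  convert! h1 using 1
  ext k
  simp only [rotGen_apply, rot_apply, hij, hij.symm, if_true,
    if_false]
  by_cases hi : k = i
  · subst hi; simp [rotGen_apply, hij]; ring
  · by_cases hj : k = j
    · subst hj; simp [rotGen_apply, hi]; ring
    · simp [rotGen_apply, hi, hj]

theorem contDiff_rot (i j : Fin n) : ContDiff ℝ ∞ fun p : ℝ × E n => rot i j p.1 p.2 := by
  have : ContDiff ℝ ∞ fun t : ℝ => rot i j t :=
    (contDiff_const.add ((Real.contDiff_cos.sub contDiff_const).smul contDiff_const)).add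
      (Real.contDiff_sin.smul contDiff_const)
  exact (this.comp contDiff_fst).clm_apply contDiff_snd

/-- The rotation field ξ_i e_j - ξ_j e_i is divergence free, so the divergence of g times this field
is the derivative of g along it. -/
theorem sum_partialDeriv_rotGen {i j : Fin n} (hij : i ≠ j) {g : E n → ℂ} {ξ : E n}
    (hg : DifferentiableAt ℝ g ξ) :
    ∑ k, partialDeriv k ((if k = j then (1 : ℂ) else 0) • (coord i * g) +
      (if k = i then (-1 : ℂ) else 0) • (coord j * g)) ξ = fderiv ℝ g ξ (rotGen i j ξ) := by
  have hc : ∀ k : Fin n, DifferentiableAt ℝ (coord k) ξ := fun k =>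
    (contDiff_coord k).differentiable (by simp) ξ
  have h1 : ∀ k l : Fin n, partialDeriv k (coord l * g) ξ
      = (if k = l then g ξ else 0) + (ξ l : ℂ) * fderiv ℝ g ξ (EuclideanSpace.single k 1) := by
    intro k l
    simp only [partialDeriv]
    rw [fderiv_mul (hc l) hg]
    simp [fderiv_coord, coord, eq_comm]
    split_ifs
    · simp [add_comm]
    · simp
  have h2 : ∀ k, partialDeriv k ((if k = j then (1 : ℂ) else 0) • (coord i * g) +
      (if k = i then (-1 : ℂ) else 0) • (coord j * g)) ξ
      = (if k = j then partialDeriv k (coord i * g) ξ else 0)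
        - (if k = i then partialDeriv k (coord j * g) ξ else 0) := by
    intro k
    simp only [partialDeriv]
    rw [fderiv_add (((hc i).mul hg).const_smul _) (((hc j).mul hg).const_smul _),
      fderiv_const_smul ((hc i).mul hg), fderiv_const_smul ((hc j).mul hg)]
    simp only [add_apply, smul_apply, smul_eq_mul]
    split_ifs <;> ring
  rw [Finset.sum_congr rfl fun k _ => h2 k, Finset.sum_sub_distrib, Finset.sum_ite_eq' ,
    Finset.sum_ite_eq', h1, h1]
  simp [hij, hij.symm, rotGen]

/-- The odd homogeneous functions of the critical degree `-n`. -/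
structure IsOddCritical (f : E n → ℂ) : Prop where
  homogeneous : IsHomogeneous (-(n : ℂ)) f
  odd : ∀ ξ, ξ ≠ 0 → f (-ξ) = -f ξ

/-- The divergences of even homogeneous vector fields of degree `1 - n`. -/
def IsEvenDivergence (f : E n → ℂ) : Prop :=
  ∃ g : Fin n → E n → ℂ, (∀ k, IsHomogeneous (-(n : ℂ) + 1) (g k)) ∧
    (∀ k ξ, ξ ≠ 0 → g k (-ξ) = g k ξ) ∧ ∀ ξ, ξ ≠ 0 → ∑ k, partialDeriv k (g k) ξ = f ξ

theorem IsEvenDivergence.lincomb {f₁ f₂ f : E n → ℂ} (h₁ : IsEvenDivergence f₁)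
    (h₂ : IsEvenDivergence f₂) (α β : ℂ) (hf : ∀ ξ, ξ ≠ 0 → α * f₁ ξ + β * f₂ ξ = f ξ) :
    IsEvenDivergence f := by
  obtain ⟨g₁, hg₁, he₁, hd₁⟩ := h₁
  obtain ⟨g₂, hg₂, he₂, hd₂⟩ := h₂
  refine ⟨fun k => α • g₁ k + β • g₂ k, fun k => (hg₁ k).lincomb (hg₂ k) α β,
    fun k ξ hξ => by simp [he₁ k ξ hξ, he₂ k ξ hξ], fun ξ hξ => ?_⟩
  rw [← hf ξ hξ, ← hd₁ ξ hξ, ← hd₂ ξ hξ, Finset.mul_sum, Finset.mul_sum, ← Finset.sum_add_distrib]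
  refine Finset.sum_congr rfl fun k _ => ?_
  have h1 := (hg₁ k).differentiableAt hξ
  have h2 := (hg₂ k).differentiableAt hξ
  simp only [partialDeriv]
  rw [fderiv_add (h1.const_smul _) (h2.const_smul _), fderiv_const_smul h1, fderiv_const_smul h2]
  rfl

theorem IsOddCritical.comp_rot {f : E n → ℂ} (hf : IsOddCritical f) {i j : Fin n} (hij : i ≠ j)
    (t : ℝ) : IsOddCritical fun ξ => f (rot i j t ξ) := by
  refine ⟨⟨hf.homogeneous.smooth.comp (rot i j t).contDiff.contDiffOn fun ξ hξ =>
    rot_ne_zero hij t hξ, fun r hr ξ hξ => ?_⟩, fun ξ hξ => ?_⟩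
  · rw [map_smul, hf.homogeneous.homogeneous r hr _ (rot_ne_zero hij t hξ)]
  · rw [map_neg, hf.odd _ (rot_ne_zero hij t hξ)]

/-- A weighted integral of `f` over rotations. -/
noncomputable def rotIntegral (i j : Fin n) (w : ℝ → ℂ) (T : ℝ) (f : E n → ℂ) (ξ : E n) : ℂ :=
  ∫ t in Set.Icc 0 T, w t * f (rot i j t ξ)

theorem IsOddCritical.dominatedFamily_rot {f : E n → ℂ} (hf : IsOddCritical f) {i j : Fin n}
    (hij : i ≠ j) {w : ℝ → ℂ} (hw : ContDiff ℝ ∞ w) (T : ℝ) :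
    DominatedFamily (volume.restrict (Set.Icc 0 T)) {0}ᶜ
      (fun (t : ℝ) (ξ : E n) => w t * f (rot i j t ξ)) := by
  have hG : ContDiffOn ℝ ∞ (fun p : ℝ × E n => w p.1 * f (rot i j p.1 p.2))
      (Set.univ ×ˢ {0}ᶜ) :=
    (hw.comp contDiff_fst).contDiffOn.mul (hf.homogeneous.smooth.comp
      (contDiff_rot i j).contDiffOn fun p hp => rot_ne_zero hij p.1 hp.2)
  exact DominatedFamily.of_contDiffOn isCompact_Icc measurableSet_Icc isOpen_compl_zero hG

theorem IsOddCritical.rotIntegral {f : E n → ℂ} (hf : IsOddCritical f) {i j : Fin n}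
    (hij : i ≠ j) {w : ℝ → ℂ} (hw : ContDiff ℝ ∞ w) (T : ℝ) :
    IsOddCritical (rotIntegral i j w T f) := by
  refine ⟨⟨(hf.dominatedFamily_rot hij hw T).contDiffOn_integral isOpen_compl_zero,
    fun r hr ξ hξ => ?_⟩, fun ξ hξ => ?_⟩
  · simp only [CCSymbol.rotIntegral]
    rw [← integral_const_mul]
    congr 1; ext t
    rw [(hf.comp_rot hij t).homogeneous.homogeneous r hr ξ hξ]; ring
  · simp only [CCSymbol.rotIntegral]
    rw [← integral_neg]
    congr 1; ext t
    rw [(hf.comp_rot hij t).odd ξ hξ]; ring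

/-- Rotations commute with their generator, so differentiating f(rot t ξ) along the generator in ξ
is differentiating in t; then integrate by parts against w. -/
theorem IsOddCritical.fderiv_rotIntegral {f : E n → ℂ} (hf : IsOddCritical f) {i j : Fin n}
    (hij : i ≠ j) {w w' : ℝ → ℂ} (hw : ContDiff ℝ ∞ w) (hw' : ∀ t, HasDerivAt w (w' t) t)
    (hwc : Continuous w') {T : ℝ} (hT : 0 ≤ T) {ξ : E n} (hξ : ξ ≠ 0) :
    fderiv ℝ (CCSymbol.rotIntegral i j w T f) ξ (rotGen i j ξ)
      = w T * f (rot i j T ξ) - w 0 * f ξ - ∫ t in (0 : ℝ)..T, w' t * f (rot i j t ξ) := by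
  have h1 := (hf.dominatedFamily_rot hij hw T).fderiv_integral isOpen_compl_zero hξ (rotGen i j ξ)
  have hd : ∀ t : ℝ, DifferentiableAt ℝ f (rot i j t ξ) := fun t =>
    hf.homogeneous.differentiableAt (rot_ne_zero hij t hξ)
  have h2 : ∀ t : ℝ, fderiv ℝ (fun ξ => w t * f (rot i j t ξ)) ξ (rotGen i j ξ)
      = w t * fderiv ℝ f (rot i j t ξ) (rotGen i j (rot i j t ξ)) := by
    intro t
    have h3 : HasFDerivAt (fun ξ => w t * f (rot i j t ξ))
        (w t • (fderiv ℝ f (rot i j t ξ)).comp (rot i j t)) ξ :=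
      ((hd t).hasFDerivAt.comp ξ (rot i j t).hasFDerivAt).const_mul (w t)
    rw [h3.fderiv]
    simp [rot_rotGen hij]
  have hf' : ContinuousOn (fderiv ℝ f) {0}ᶜ :=
    (hf.homogeneous.smooth.fderiv_of_isOpen (m := ∞) isOpen_compl_zero le_rfl).continuousOn
  have hrc : Continuous fun t : ℝ => rot i j t ξ :=
    continuous_iff_continuousAt.2 fun t => (hasDerivAt_rot hij t ξ).continuousAt
  have hfc : Continuous fun t : ℝ => fderiv ℝ f (rot i j t ξ) :=
    hf'.comp_continuous hrc fun t => rot_ne_zero hij t hξ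
  have hc : Continuous fun t : ℝ => fderiv ℝ f (rot i j t ξ) (rotGen i j (rot i j t ξ)) :=
    hfc.clm_apply ((rotGen i j).continuous.comp hrc)
  have h4 : ∀ t : ℝ, HasDerivAt (fun t => f (rot i j t ξ))
      (fderiv ℝ f (rot i j t ξ) (rotGen i j (rot i j t ξ))) t := fun t =>
    (hd t).hasFDerivAt.comp_hasDerivAt t (hasDerivAt_rot hij t ξ)
  have h5 := intervalIntegral.integral_mul_deriv_eq_deriv_mul (a := 0) (b := T)
    (fun t _ => hw' t) (fun t _ => h4 t) (hwc.intervalIntegrable _ _) (hc.intervalIntegrable _ _)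
  rw [rot_zero] at h5
  have h6 : fderiv ℝ (CCSymbol.rotIntegral i j w T f) ξ (rotGen i j ξ)
      = ∫ t in Set.Icc 0 T, w t * fderiv ℝ f (rot i j t ξ) (rotGen i j (rot i j t ξ)) := by
    rw [← integral_congr_ae (Filter.Eventually.of_forall h2)]
    exact h1.2
  rw [h6, ← h5, intervalIntegral.integral_of_le hT, ← integral_Icc_eq_integral_Ioc]

/-- The field is the rotational integral of f times the rotation field: a product of two odd
factors, of degrees -n and 1. -/
theorem IsOddCritical.isEvenDivergence_rot {f : E n → ℂ} (hf : IsOddCritical f) {i j : Fin n}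
    (hij : i ≠ j) {w w' : ℝ → ℂ} (hw : ContDiff ℝ ∞ w) (hw' : ∀ t, HasDerivAt w (w' t) t)
    (hwc : Continuous w') {T : ℝ} (hT : 0 ≤ T) :
    IsEvenDivergence fun ξ => w T * f (rot i j T ξ) - w 0 * f ξ
      - ∫ t in (0 : ℝ)..T, w' t * f (rot i j t ξ) := by
  have hg := hf.rotIntegral hij hw T
  refine ⟨fun k => (if k = j then (1 : ℂ) else 0) • (coord i * CCSymbol.rotIntegral i j w T f) +
      (if k = i then (-1 : ℂ) else 0) • (coord j * CCSymbol.rotIntegral i j w T f),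
      fun k => ?_, fun k ξ hξ => ?_, fun ξ hξ => ?_⟩
  · rw [add_comm]
    exact ((isHomogeneous_coord i).mul hg.homogeneous).lincomb
      ((isHomogeneous_coord j).mul hg.homogeneous) _ _
  · simp only [Pi.add_apply, Pi.smul_apply, Pi.mul_apply, smul_eq_mul, coord, hg.odd ξ hξ,
      PiLp.neg_apply, Complex.ofReal_neg, neg_mul_neg]
  · rw [sum_partialDeriv_rotGen hij (hg.homogeneous.differentiableAt hξ),
      hf.fderiv_rotIntegral hij hw hw' hwc hT hξ]

/-- The reflection that changes the signs of the coordinates in `A`. -/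
noncomputable def flip (A : Finset (Fin n)) (ξ : E n) : E n :=
  WithLp.toLp 2 fun k => if k ∈ A then -ξ k else ξ k

theorem flip_apply (A : Finset (Fin n)) (ξ : E n) (k : Fin n) :
    flip A ξ k = if k ∈ A then -ξ k else ξ k := rfl

/-- Changing 2m signs is a product of m rotations by π in disjoint coordinate planes, and the weight
w = 1 shows that each of them changes f by a divergence. -/
theorem IsOddCritical.isEvenDivergence_flip (m : ℕ) : ∀ (A : Finset (Fin n)), A.card = 2 * m →
    ∀ f : E n → ℂ, IsOddCritical f → IsEvenDivergence fun ξ => f (flip A ξ) - f ξ := by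
  induction m with
  | zero =>
    intro A hA f hf
    have hA' : A = ∅ := by simpa using hA
    have h : ∀ ξ, flip A ξ = ξ := fun ξ => by ext k; simp [flip_apply, hA']
    refine ⟨0, fun k => IsHomogeneous.zero _, fun k ξ _ => rfl, fun ξ hξ => ?_⟩
    simp [h, partialDeriv]
  | succ m ih =>
    intro A hA f hf
    obtain ⟨i, hi, j, hj, hij⟩ := Finset.one_lt_card.1 (show 1 < A.card by omega)
    have hcard : ((A.erase i).erase j).card = 2 * m := by
      rw [Finset.card_erase_of_mem (Finset.mem_erase.2 ⟨hij.symm, hj⟩), Finset.card_erase_of_mem hi]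
      omega
    -- The difference telescopes through f ∘ rot π, to which the induction hypothesis applies with
    -- the two signs i, j removed.
    have h1 := ih _ hcard _ (hf.comp_rot hij Real.pi)
    have h2 := hf.isEvenDivergence_rot hij (w := fun _ => 1) (w' := fun _ => 0) contDiff_const
      (fun t => hasDerivAt_const t 1) continuous_const Real.pi_pos.le
    refine h1.lincomb h2 1 1 fun ξ _ => ?_
    have h3 : rot i j Real.pi (flip ((A.erase i).erase j) ξ) = flip A ξ := by
      ext k
      simp only [rot_apply, flip_apply, Finset.mem_erase, Real.cos_pi, Real.sin_pi]
      by_cases hki : k = i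
      · subst hki; simp [hij, hi]; ring
      · by_cases hkj : k = j
        · subst hkj; simp [hki, hj]; ring
        · simp [hki, hkj]
    simp [h3]

/-- The reflection sends the polar angle α of (ξ_i, ξ_j) to π - α, which is a rotation by π - 2α, an
angle depending on ξ. -/
theorem exists_rot_eq_flip {i j : Fin n} (hij : i ≠ j) (ξ : E n) :
    ∃ s : ℝ, rot i j s ξ = flip {i} ξ := by
  let z : ℂ := ⟨ξ i, ξ j⟩
  have hx : ‖z‖ * Real.cos z.arg = ξ i := Complex.norm_mul_cos_arg z
  have hy : ‖z‖ * Real.sin z.arg = ξ j := Complex.norm_mul_sin_arg z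
  refine ⟨Real.pi - 2 * z.arg, ?_⟩
  have h := Real.sin_sq_add_cos_sq z.arg
  ext k
  simp only [rot_apply, flip_apply, Finset.mem_singleton, Real.cos_pi_sub, Real.sin_pi_sub,
    Real.cos_two_mul, Real.sin_two_mul]
  by_cases hki : k = i
  · subst hki
    simp only [hij, if_true, if_false, ← hx, ← hy]
    linear_combination (-2 * ‖z‖ * Real.cos z.arg) * h
  · by_cases hkj : k = j
    · subst hkj
      simp only [hki, if_true, if_false, ← hx, ← hy]
      ring
    · simp [hki, hkj]

/-- The average over all angles is constant on rotation orbits, and the reflected point lies on the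
orbit of ξ. -/
theorem IsOddCritical.average_flip {f : E n → ℂ} {i j : Fin n}
    (hij : i ≠ j) (ξ : E n) :
    CCSymbol.rotIntegral i j (fun _ => 1) (2 * Real.pi) f (flip {i} ξ)
      = CCSymbol.rotIntegral i j (fun _ => 1) (2 * Real.pi) f ξ := by
  obtain ⟨s, hs⟩ := exists_rot_eq_flip hij ξ
  have hper : Function.Periodic (fun t : ℝ => f (rot i j t ξ)) (2 * Real.pi) := by
    intro t
    simp only
    rw [← rot_rot hij, rot_two_pi]
  have h1 : ∀ η : E n, CCSymbol.rotIntegral i j (fun _ => 1) (2 * Real.pi) f η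
      = ∫ t in (0 : ℝ)..2 * Real.pi, f (rot i j t η) := by
    intro η
    simp only [CCSymbol.rotIntegral, one_mul]
    rw [intervalIntegral.integral_of_le Real.two_pi_pos.le, integral_Icc_eq_integral_Ioc]
  rw [h1, h1, ← hs]
  simp only [rot_rot hij]
  rw [intervalIntegral.integral_comp_add_right (fun t => f (rot i j t ξ)) s, zero_add, add_comm,
    hper.intervalIntegral_add_eq s 0, zero_add]

/-- Odd homogeneous functions of degree `-n` on `ℝⁿ`, `n ≥ 2`, are divergences. -/
theorem IsOddCritical.isEvenDivergence (hn : 2 ≤ n) {f : E n → ℂ} (hf : IsOddCritical f) :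
    IsEvenDivergence f := by
  rcases Nat.even_or_odd n with ⟨m, hm⟩ | ⟨m, hm⟩
  -- For n even, flipping all signs is ξ ↦ -ξ, so the difference is -2f; hence the coefficient -1/2.
  · have h1 := IsOddCritical.isEvenDivergence_flip m Finset.univ (by simp; omega) f hf
    refine h1.lincomb h1 (-1 / 2) 0 fun ξ hξ => ?_
    have : flip Finset.univ ξ = -ξ := by ext k; simp [flip_apply]
    rw [this, hf.odd ξ hξ]
    ring
  -- For n odd, let F be the integral of f over the full circle of rotations in the plane (i, j).
  -- Flipping the n - 1 signs other than i is minus the flip of i, under which F is invariant; as F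
  -- is odd, the difference is -2F, so F is a divergence.
  · let i : Fin n := ⟨0, by omega⟩
    let j : Fin n := ⟨1, by omega⟩
    have hij : i ≠ j := by simp [i, j]
    have hF := hf.rotIntegral hij (w := fun _ => 1) contDiff_const (2 * Real.pi)
    have h1 := IsOddCritical.isEvenDivergence_flip m (Finset.univ.erase i)
      (by rw [Finset.card_erase_of_mem (Finset.mem_univ i)]; simp; omega) _ hF
    -- With w(t) = t the boundary term is 2πf and the integral term is F, so 2πf - F is a
    -- divergence. Combining it with -2F gives the coefficients 1/(2π) and -1/(4π).
    have h2 := hf.isEvenDivergence_rot hij (w := fun t => (t : ℂ)) (w' := fun _ => 1)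
      Complex.ofRealCLM.contDiff (fun t => (hasDerivAt_id t).ofReal_comp) continuous_const
      Real.two_pi_pos.le
    have hpi : (Real.pi : ℂ) ≠ 0 := by exact_mod_cast Real.pi_ne_zero
    refine h1.lincomb h2 (-1 / (4 * Real.pi)) (1 / (2 * Real.pi)) fun ξ hξ => ?_
    have h3 : flip (Finset.univ.erase i) ξ = -flip {i} ξ := by
      ext k
      by_cases hk : k = i <;> simp [flip_apply, hk]
    have h4 : flip {i} ξ ≠ 0 := by
      obtain ⟨s, hs⟩ := exists_rot_eq_flip hij ξ
      rw [← hs]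
      exact rot_ne_zero hij s hξ
    rw [h3, hF.odd _ h4, IsOddCritical.average_flip hij, rot_two_pi,
      intervalIntegral.integral_of_le Real.two_pi_pos.le, ← integral_Icc_eq_integral_Ioc]
    simp only [CCSymbol.rotIntegral]
    field_simp
    push_cast
    ring

end Rotations

/-! ### The parity and non-integer conditions as degree classes -/

section OddClass

variable {n : ℕ}

theorem IsCutoff.symmetrize {χ : E n → ℝ} (hχ : IsCutoff χ) :
    IsCutoff fun ξ => (χ ξ + χ (-ξ)) / 2 := by
  obtain ⟨r, hr, h0⟩ := hχ.eq_zero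
  refine ⟨(hχ.smooth.add (hχ.smooth.comp contDiff_neg)).div_const 2, ⟨r, hr, fun ξ hξ => ?_⟩,
    fun ξ hξ => ?_⟩
  · rw [h0 ξ hξ, h0 (-ξ) (by simpa using hξ)]; simp
  · rw [hχ.eq_one ξ hξ, hχ.eq_one (-ξ) (by simpa using hξ)]; norm_num

theorem partialDeriv_comp_neg {u : E n → ℂ} {ξ : E n} (hu : DifferentiableAt ℝ u (-ξ))
    (i : Fin n) : partialDeriv i (fun η => u (-η)) ξ = -partialDeriv i u (-ξ) := by
  have h : HasFDerivAt (fun η => u (-η)) ((fderiv ℝ u (-ξ)).comp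
      (-ContinuousLinearMap.id ℝ (E n))) ξ :=
    hu.hasFDerivAt.comp ξ (hasFDerivAt_id ξ).neg
  simp only [partialDeriv]
  rw [h.fderiv]
  simp

theorem partialDeriv_neg_of_even {u : E n → ℂ} (hd : Differentiable ℝ u)
    (hu : ∀ ξ, u (-ξ) = u ξ) (i : Fin n) (ξ : E n) :
    partialDeriv i u (-ξ) = -partialDeriv i u ξ := by
  have h := partialDeriv_comp_neg (hd (-ξ)) i
  simp only [hu] at h
  rw [← neg_inj, ← h, neg_neg]

theorem setIntegral_ball_of_odd {v : E n → ℂ} (hv : ∀ ξ, v (-ξ) = -v ξ) :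
    ∫ ξ in Metric.ball (0 : E n) 1, v ξ = 0 := by
  rw [← integral_indicator Metric.isOpen_ball.measurableSet]
  have h := integral_neg_eq_self ((Metric.ball (0 : E n) 1).indicator v) volume
  have h2 : ∀ ξ, (Metric.ball (0 : E n) 1).indicator v (-ξ)
      = -(Metric.ball (0 : E n) 1).indicator v ξ := fun ξ => by
    by_cases hξ : ξ ∈ Metric.ball (0 : E n) 1
    · rw [Set.indicator_of_mem hξ, Set.indicator_of_mem (by simpa using hξ), hv]
    · rw [Set.indicator_of_notMem hξ, Set.indicator_of_notMem (by simpa using hξ), neg_zero]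
  simp only [h2, integral_neg] at h
  exact CharZero.eq_neg_self_iff.1 h.symm

/-- The parity condition on homogeneous components that makes those of degree `-n` odd. -/
def OddParity (d : ℂ) (f : E n → ℂ) : Prop :=
  ∃ m : ℤ, d = m ∧ ∀ ξ, ξ ≠ 0 → f (-ξ) = (-1 : ℂ) ^ (m + n + 1) * f ξ

theorem isDegreeClass_oddParity (hn : 2 ≤ n) : IsDegreeClass (OddParity (n := n)) where
  zero_shift := by
    rintro d f ⟨m, rfl, -⟩ k
    exact ⟨m + k, by push_cast; ring, by simp⟩
  lincomb := by
    rintro d f g ⟨m, rfl, hf⟩ ⟨m', hm, hg⟩ α β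
    obtain rfl : m = m' := by exact_mod_cast hm
    refine ⟨m, rfl, fun ξ hξ => ?_⟩
    simp only [Pi.add_apply, Pi.smul_apply, smul_eq_mul, hf ξ hξ, hg ξ hξ]
    ring
  partialDeriv := by
    rintro d f hhom ⟨m, rfl, hf⟩ i
    refine ⟨m - 1, by push_cast; ring, fun ξ hξ => ?_⟩
    have h1 : (fun η => f (-η)) =ᶠ[nhds ξ] (-1 : ℂ) ^ (m + n + 1) • f := by
      filter_upwards [isOpen_compl_zero.mem_nhds hξ] with η hη using hf η hη
    have h2 := partialDeriv_comp_neg (hhom.differentiableAt (neg_ne_zero.2 hξ)) i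
    have h3 : CCSymbol.partialDeriv i (fun η => f (-η)) ξ
        = (-1 : ℂ) ^ (m + n + 1) * CCSymbol.partialDeriv i f ξ := by
      simp only [CCSymbol.partialDeriv]
      rw [h1.fderiv_eq, fderiv_const_smul (hhom.differentiableAt hξ)]
      rfl
    rw [show m - 1 + (n : ℤ) + 1 = m + n + 1 - 1 by ring, zpow_sub_one₀ (by norm_num),
      ← neg_inj, ← h2, h3]
    norm_num
  coord_mul := by
    rintro d f ⟨m, rfl, hf⟩ i
    refine ⟨m + 1, by push_cast; ring, fun ξ hξ => ?_⟩
    rw [show m + 1 + (n : ℤ) + 1 = m + n + 1 + 1 by ring, zpow_add_one₀ (by norm_num)]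
    simp [coord, hf ξ hξ]
    ring
  congr := by
    rintro d f g ⟨m, rfl, hf⟩ h
    refine ⟨m, rfl, fun ξ hξ => ?_⟩
    rw [← h (neg_ne_zero.2 hξ : -ξ ∈ ({0}ᶜ : Set (E n))), ← h (hξ : ξ ∈ ({0}ᶜ : Set (E n))),
      hf ξ hξ]
  critical := by
    rintro χ hχ f hf ⟨m, hm, hodd⟩
    obtain rfl : m = -n := by exact_mod_cast hm.symm
    obtain ⟨g, hg, he, hd⟩ := IsOddCritical.isEvenDivergence hn ⟨hf, fun ξ hξ => by
      simpa using hodd ξ hξ⟩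
    -- With an even cut-off the fields χ₀ g_i are even, so their divergence is odd and has zero
    -- integral over the ball.
    refine ⟨g, _, hχ.symmetrize, fun i => ⟨hg i, 1 - n, by push_cast; ring, fun ξ hξ => ?_⟩, hd, ?_⟩
    · rw [he i ξ hξ, show 1 - (n : ℤ) + n + 1 = 2 by ring]
      norm_num
    · refine setIntegral_ball_of_odd fun ξ => ?_
      rw [← Finset.sum_neg_distrib]
      refine Finset.sum_congr rfl fun i _ => partialDeriv_neg_of_even
        ((hχ.symmetrize.contDiff_mul (hg i).smooth).differentiable (by simp)) (fun η => ?_) i ξ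
      by_cases hη : η = 0
      · simp [hη]
      · rw [neg_neg, he i η hη, add_comm]

/-- The condition that the degree is not an integer. -/
def NonIntegerDegree (d : ℂ) (_ : E n → ℂ) : Prop := ∀ k : ℤ, d ≠ k

theorem isDegreeClass_nonIntegerDegree : IsDegreeClass (NonIntegerDegree (n := n)) where
  zero_shift := fun h k l hl => h (l - k) (by push_cast; rw [← hl]; ring)
  lincomb := fun h _ _ _ => h
  partialDeriv := fun _ h _ l hl => h (l + 1) (by push_cast; rw [← hl]; ring)
  coord_mul := fun h _ l hl => h (l - 1) (by push_cast; rw [← hl]; ring)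
  congr := fun h _ => h
  -- The critical degree -n is an integer, so this case is void.
  critical := fun _ _ _ h => (h (-n) (by push_cast; rfl)).elim

end OddClass

/-! ### Uniqueness of homogeneous components -/

section Uniqueness

open Asymptotics Filter

variable {n : ℕ} {χ : E n → ℝ}

theorem isLittleO_rpow_of_lt {p q : ℝ} (h : p < q) :
    (fun t : ℝ => t ^ p) =o[atTop] fun t : ℝ => t ^ q := by
  have h1 : Tendsto (fun t : ℝ => t ^ (-(q - p))) atTop (nhds 0) :=
    tendsto_rpow_neg_atTop (by linarith)
  refine (isLittleO_iff_tendsto' ?_).2 (h1.congr' ?_)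
  · filter_upwards [eventually_gt_atTop 0] with t ht h0
    exact absurd h0 (Real.rpow_pos_of_pos ht q).ne'
  · filter_upwards [eventually_gt_atTop 0] with t ht
    rw [← Real.rpow_sub ht]
    congr 1; ring

theorem exists_cpow_ne {z w : ℂ} (h : z ≠ w) : ∃ r : ℝ, 0 < r ∧ (r : ℂ) ^ z ≠ (r : ℂ) ^ w := by
  have hd : ‖z - w‖ ≠ 0 := norm_ne_zero_iff.2 (sub_ne_zero.2 h)
  -- For this r, r^(z-w) is the exponential of a number of modulus 1, which is not an integer
  -- multiple of 2πi.
  refine ⟨Real.exp (1 / ‖z - w‖), Real.exp_pos _, fun he => ?_⟩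
  have hne : ((Real.exp (1 / ‖z - w‖) : ℝ) : ℂ) ≠ 0 := by exact_mod_cast (Real.exp_pos _).ne'
  have h1 : ((Real.exp (1 / ‖z - w‖) : ℝ) : ℂ) ^ (z - w) = 1 := by
    rw [Complex.cpow_sub _ _ hne, he, div_self]
    simp [Complex.cpow_eq_zero_iff]
  rw [Complex.cpow_def_of_ne_zero hne, ← Complex.ofReal_log (Real.exp_pos _).le, Real.log_exp,
    Complex.exp_eq_one_iff] at h1
  obtain ⟨m, hm⟩ := h1
  have h2 := congrArg norm hm
  simp only [norm_mul, Complex.norm_real, Complex.norm_intCast, Complex.norm_I, mul_one,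
    Complex.norm_ofNat, norm_norm, one_div, norm_inv] at h2
  rw [inv_mul_cancel₀ hd, Real.norm_of_nonneg Real.pi_pos.le] at h2
  rcases eq_or_ne m 0 with rfl | hm0
  · simp at h2
  · have h3 : (1 : ℝ) ≤ |(m : ℝ)| := by exact_mod_cast Int.one_le_abs hm0
    have := Real.pi_gt_three
    nlinarith

/-- Asymptotic independence of complex powers. -/
theorem coeff_eq_zero_of_isLittleO (m : ℝ) (Z : Finset ℂ) : ∀ c : ℂ → ℂ, (∀ z ∈ Z, m ≤ z.re) →
    (fun t : ℝ => ∑ z ∈ Z, c z * (t : ℂ) ^ z) =o[atTop] (fun t : ℝ => t ^ m) →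
    ∀ z ∈ Z, c z = 0 := by
  classical
  induction Z using Finset.induction_on with
  | empty => simp
  | insert w Z hw ih =>
    intro c hZ ho
    have hrest : ∀ z ∈ Z, c z = 0 := by
      intro z hz
      -- Subtracting r^w times the sum at t from the sum at rt kills the w-term and multiplies the
      -- coefficient of t^z by r^z - r^w, nonzero for the chosen z; the induction hypothesis then
      -- applies.
      obtain ⟨r, hr, hne⟩ := exists_cpow_ne (show z ≠ w by rintro rfl; exact hw hz)
      have h1 : (fun t : ℝ => ∑ z ∈ insert w Z, c z * ((r * t : ℝ) : ℂ) ^ z)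
          =o[atTop] (fun t : ℝ => t ^ m) := by
        have h2 := ho.comp_tendsto (tendsto_id.const_mul_atTop hr)
        refine h2.trans_isBigO (IsBigO.of_bound (r ^ m) ?_)
        filter_upwards [eventually_gt_atTop 0] with t ht
        simp only [Function.comp_apply, id_eq]
        rw [Real.mul_rpow hr.le ht.le, norm_mul, Real.norm_of_nonneg (Real.rpow_nonneg hr.le m)]
      have h3 := h1.sub (ho.const_mul_left ((r : ℂ) ^ w))
      have h4 : (fun t : ℝ => ∑ z ∈ Z, (c z * ((r : ℂ) ^ z - (r : ℂ) ^ w)) * (t : ℂ) ^ z)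
          =o[atTop] (fun t : ℝ => t ^ m) := by
        refine h3.congr' ?_ EventuallyEq.rfl
        filter_upwards [eventually_gt_atTop 0] with t ht
        rw [Finset.sum_insert hw, Finset.sum_insert hw, mul_add, Finset.mul_sum]
        simp only [Complex.ofReal_mul, Complex.mul_cpow_ofReal_nonneg hr.le ht.le]
        rw [show ∀ a b x y : ℂ, a + b - (x + y) = (a - x) + (b - y) by intros; ring,
          ← Finset.sum_sub_distrib]
        rw [show c w * ((r : ℂ) ^ w * (t : ℂ) ^ w) - (r : ℂ) ^ w * (c w * (t : ℂ) ^ w) = 0 by ring,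
          zero_add]
        exact Finset.sum_congr rfl fun z _ => by ring
      have h5 := ih _ (fun z hz => hZ z (Finset.mem_insert_of_mem hz)) h4 z hz
      exact (mul_eq_zero.1 h5).resolve_right (sub_ne_zero.2 hne)
    intro z hz
    rcases Finset.mem_insert.1 hz with rfl | hz
    · by_contra hc
      have hpos : 0 < ‖c z‖ := norm_pos_iff.2 hc
      have h1 := (isLittleO_iff.1 ho) (half_pos hpos)
      obtain ⟨t, ht, ht1⟩ := (h1.and (eventually_ge_atTop 1)).exists
      rw [Finset.sum_insert hw, Finset.sum_eq_zero fun y hy => by rw [hrest y hy, zero_mul],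
        add_zero, norm_mul, Complex.norm_cpow_eq_rpow_re_of_pos (by linarith),
        Real.norm_of_nonneg (by positivity)] at ht
      have h2 : t ^ m ≤ t ^ z.re := Real.rpow_le_rpow_of_exponent_le ht1 (hZ z (by simp))
      have h3 : 0 < t ^ m := Real.rpow_pos_of_pos (by linarith) m
      nlinarith
    · exact hrest z hz

namespace IsExpansion

variable {a b : ℂ} {σ : E n → ℂ} {s s' : ℕ → E n → ℂ}

theorem isLittleO_along_ray (hχ : IsCutoff χ) (h : IsExpansion χ a σ s) {m : ℝ} {N : ℕ}
    (hN : a.re - N < m) {ξ : E n} (hξ : ξ ≠ 0) :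
    (fun t : ℝ => σ (t • ξ) - ∑ j ∈ Finset.range N, s j ξ * (t : ℂ) ^ (a - j))
      =o[atTop] fun t : ℝ => t ^ m := by
  have hξ0 : 0 < ‖ξ‖ := norm_pos_iff.2 hξ
  have ht : Tendsto (fun t : ℝ => t • ξ) atTop (Bornology.cobounded (E n)) := by
    rw [← tendsto_norm_atTop_iff_cobounded]
    simp only [norm_smul]
    exact tendsto_norm_atTop_atTop.atTop_mul_const hξ0
  have h1 : (fun t : ℝ => remainder χ σ s N (t • ξ)) =O[atTop] fun t : ℝ => t ^ (a.re - N) := by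
    have h2 := (h.hasGrowth_remainder N 0).norm_left
    simp only [norm_iteratedFDeriv_zero, Nat.cast_zero, sub_zero] at h2
    refine (h2.of_norm_left.comp_tendsto ht).trans (IsBigO.of_bound (‖ξ‖ ^ (a.re - N)) ?_)
    filter_upwards [eventually_gt_atTop 0] with t ht0
    simp only [Function.comp_apply]
    rw [norm_smul, Real.norm_of_nonneg ht0.le, Real.mul_rpow ht0.le hξ0.le, norm_mul, mul_comm,
      Real.norm_of_nonneg (Real.rpow_nonneg hξ0.le _)]
  refine (h1.trans_isLittleO (isLittleO_rpow_of_lt hN)).congr' ?_ EventuallyEq.rfl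
  filter_upwards [eventually_gt_atTop 0, eventually_ge_atTop ‖ξ‖⁻¹] with t ht0 ht1
  rw [remainder_eq hχ]
  · congr 1
    exact Finset.sum_congr rfl fun j _ => by
      rw [(h.homogeneous j).homogeneous t ht0 ξ hξ, mul_comm]
  · rw [norm_smul, Real.norm_of_nonneg ht0.le]
    rwa [inv_le_iff_one_le_mul₀ hξ0] at ht1

/-- Along the ray through ξ both expansions describe the same function up to o(t^(Re w)). Grouping
terms by exponent and absorbing the exponents of real part below Re w, asymptotic independence
forces the coefficients of t^w to agree. -/
theorem sum_filter_eq (hχ : IsCutoff χ) (h : IsExpansion χ a σ s) (h' : IsExpansion χ b σ s')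
    (w : ℂ) {M N : ℕ} (hN : a.re - N < w.re) (hM : b.re - M < w.re) {ξ : E n} (hξ : ξ ≠ 0) :
    ∑ j ∈ (Finset.range N).filter (fun l : ℕ => a - (l : ℂ) = w), s j ξ
      = ∑ k ∈ (Finset.range M).filter (fun l : ℕ => b - (l : ℂ) = w), s' k ξ := by
  classical
  let C : ℂ → ℂ := fun z => ∑ j ∈ (Finset.range N).filter (fun l : ℕ => a - (l : ℂ) = z), s j ξ
    - ∑ k ∈ (Finset.range M).filter (fun l : ℕ => b - (l : ℂ) = z), s' k ξ
  let Z : Finset ℂ := (Finset.range N).image (fun j : ℕ => a - (j : ℂ)) ∪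
    (Finset.range M).image (fun k : ℕ => b - (k : ℂ))
  have h1 := (h'.isLittleO_along_ray hχ hM hξ).sub (h.isLittleO_along_ray hχ hN hξ)
  have hfib : ∀ (L : ℕ) (d : ℂ) (q : ℕ → E n → ℂ) (t : ℝ),
      (∀ j ∈ Finset.range L, d - (j : ℂ) ∈ Z) →
      ∑ j ∈ Finset.range L, q j ξ * (t : ℂ) ^ (d - j)
        = ∑ z ∈ Z, (∑ j ∈ (Finset.range L).filter (fun l : ℕ => d - (l : ℂ) = z), q j ξ)
          * (t : ℂ) ^ z := by
    intro L d q t hL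
    rw [← Finset.sum_fiberwise_of_maps_to hL]
    refine Finset.sum_congr rfl fun z _ => ?_
    rw [Finset.sum_mul]
    exact Finset.sum_congr rfl fun j hj => by rw [(Finset.mem_filter.1 hj).2]
  have h2 : (fun t : ℝ => ∑ z ∈ Z, C z * (t : ℂ) ^ z) =o[atTop] fun t : ℝ => t ^ w.re := by
    refine h1.congr_left fun t => ?_
    rw [hfib N a s t fun j hj => Finset.mem_union_left _ (Finset.mem_image_of_mem _ hj),
      hfib M b s' t fun j hj => Finset.mem_union_right _ (Finset.mem_image_of_mem _ hj)]
    simp only [C, sub_mul, Finset.sum_sub_distrib]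
    ring
  have h3 : (fun t : ℝ => ∑ z ∈ Z with ¬ w.re ≤ z.re, C z * (t : ℂ) ^ z)
      =o[atTop] fun t : ℝ => t ^ w.re := by
    rw [← Finset.sum_fn]
    refine IsLittleO.sum fun z hz => IsLittleO.const_mul_left ?_ _
    refine IsBigO.trans_isLittleO (g := fun t : ℝ => t ^ z.re) (IsBigO.of_bound 1 ?_)
      (isLittleO_rpow_of_lt (not_le.1 (Finset.mem_filter.1 hz).2))
    filter_upwards [eventually_gt_atTop 0] with t ht
    rw [Complex.norm_cpow_eq_rpow_re_of_pos ht, one_mul, Real.norm_of_nonneg (by positivity)]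
  have h4 : (fun t : ℝ => ∑ z ∈ Z with w.re ≤ z.re, C z * (t : ℂ) ^ z)
      =o[atTop] fun t : ℝ => t ^ w.re := by
    refine (h2.sub h3).congr_left fun t => ?_
    rw [← Finset.sum_filter_add_sum_filter_not Z (fun z => w.re ≤ z.re), add_sub_cancel_right]
  have h5 := coeff_eq_zero_of_isLittleO w.re _ C (fun z hz => (Finset.mem_filter.1 hz).2) h4 w
  have h6 : C w = 0 := by
    by_cases hw : w ∈ Z
    · exact h5 (Finset.mem_filter.2 ⟨hw, le_rfl⟩)
    · have h7 : ∀ j ∈ Finset.range N, a - (j : ℂ) ≠ w := fun j hj he =>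
        hw (Finset.mem_union_left _ (Finset.mem_image.2 ⟨j, hj, he⟩))
      have h8 : ∀ j ∈ Finset.range M, b - (j : ℂ) ≠ w := fun j hj he =>
        hw (Finset.mem_union_right _ (Finset.mem_image.2 ⟨j, hj, he⟩))
      simp only [C, Finset.filter_false_of_mem h7, Finset.filter_false_of_mem h8,
        Finset.sum_empty, sub_zero]
  exact sub_eq_zero.1 h6

theorem sum_filter_sub_eq (d : ℂ) (q : ℕ → E n → ℂ) {j N : ℕ} (hj : j < N) (ξ : E n) :
    ∑ i ∈ (Finset.range N).filter (fun l : ℕ => d - (l : ℂ) = d - j), q i ξ = q j ξ := by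
  have : (Finset.range N).filter (fun i : ℕ => d - (i : ℂ) = d - j) = {j} := by
    ext i
    simp only [Finset.mem_filter, Finset.mem_range, Finset.mem_singleton, sub_right_inj,
      Nat.cast_inj]
    exact ⟨fun h => h.2, fun h => ⟨h ▸ hj, h⟩⟩
  rw [this, Finset.sum_singleton]

/-- The homogeneous components of a classical symbol are unique. -/
theorem component_eq_zero_or (hχ : IsCutoff χ) (h : IsExpansion χ a σ s)
    (h' : IsExpansion χ b σ s') (j : ℕ) : Set.EqOn (s j) 0 {0}ᶜ ∨
      ∃ k : ℕ, a - j = b - k ∧ Set.EqOn (s j) (s' k) {0}ᶜ := by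
  obtain ⟨M, hM⟩ := exists_nat_gt (b.re - (a - (j : ℂ)).re)
  have hM' : b.re - M < (a - (j : ℂ)).re := by linarith
  have hN : a.re - ((j + 1 : ℕ) : ℝ) < (a - (j : ℂ)).re := by simp
  have key := fun ξ (hξ : ξ ≠ 0) => h.sum_filter_eq hχ h' (a - j) hN hM' hξ
  simp only [sum_filter_sub_eq a s (Nat.lt_succ_self j)] at key
  by_cases hk : ∃ k : ℕ, a - j = b - k
  · obtain ⟨k, hk⟩ := hk
    have hkM : k < M := by
      rw [hk] at hM'
      simp only [Complex.sub_re, Complex.natCast_re] at hM'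
      exact_mod_cast (by linarith : (k : ℝ) < M)
    refine Or.inr ⟨k, hk, fun ξ hξ => ?_⟩
    rw [key ξ hξ, hk, sum_filter_sub_eq b s' hkM]
  · refine Or.inl fun ξ hξ => ?_
    rw [key ξ hξ, Finset.filter_false_of_mem fun k _ he => hk ⟨k, he.symm⟩]
    rfl

end IsExpansion

end Uniqueness

/-! ### Reduction of symbols to test functions -/

section Reduction

open Topology Filter

variable {n : ℕ} {χ : E n → ℝ} {P : ℂ → (E n → ℂ) → Prop} (hP : IsDegreeClass P)

/-- `σ` is the sum of the test function `φ` and of the divergence of a vector field with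
components of order `a + 1`. -/
def Reduces (χ : E n → ℝ) {P : ℂ → (E n → ℂ) → Prop} (hP : IsDegreeClass P) {a : ℂ} (ha : P a 0)
    (σ φ : E n → ℂ) : Prop :=
  ContDiff ℝ ∞ φ ∧ (∀ ξ, 1 < ‖ξ‖ → φ ξ = 0) ∧
    ∃ u : Fin n → E n → ℂ, (∀ i, u i ∈ symbolSpace χ hP (a + 1) (hP.zero_add_one ha)) ∧
      σ = φ + ∑ i, partialDeriv i (u i)

theorem contDiff_of_mem_symbolSpace {a : ℂ} {ha : P a 0} {σ : E n → ℂ}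
    (hσ : σ ∈ symbolSpace χ hP a ha) : ContDiff ℝ ∞ σ := by
  obtain ⟨s, hs, -⟩ := hσ
  exact hs.symbol.smooth

theorem partialDeriv_add (i : Fin n) {u v : E n → ℂ} (hu : ContDiff ℝ ∞ u) (hv : ContDiff ℝ ∞ v) :
    partialDeriv i (u + v) = partialDeriv i u + partialDeriv i v := by
  ext ξ
  simp only [partialDeriv]
  rw [fderiv_add (hu.differentiable (by simp) ξ) (hv.differentiable (by simp) ξ)]
  rfl

namespace Reduces

variable {hP} {a : ℂ} {ha : P a 0} {σ φ : E n → ℂ}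

theorem add (h : Reduces χ hP ha σ φ) {σ' φ' : E n → ℂ} (h' : Reduces χ hP ha σ' φ') :
    Reduces χ hP ha (σ + σ') (φ + φ') := by
  obtain ⟨h1, h2, u, hu, rfl⟩ := h
  obtain ⟨h1', h2', u', hu', rfl⟩ := h'
  refine ⟨h1.add h1', fun ξ hξ => by simp [h2 ξ hξ, h2' ξ hξ], fun i => u i + u' i,
    fun i => Submodule.add_mem _ (hu i) (hu' i), ?_⟩
  rw [Finset.sum_congr rfl fun i _ => partialDeriv_add i (contDiff_of_mem_symbolSpace hP (hu i))
    (contDiff_of_mem_symbolSpace hP (hu' i)), Finset.sum_add_distrib]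
  abel

theorem zero (ha : P a 0) : Reduces χ hP ha 0 0 := by
  refine ⟨contDiff_const, fun _ _ => rfl, 0, fun i => Submodule.zero_mem _, ?_⟩
  ext ξ
  simp [partialDeriv]

theorem sum (f g : ℕ → E n → ℂ) (h : ∀ j, Reduces χ hP ha (f j) (g j)) (N : ℕ) :
    Reduces χ hP ha (∑ j ∈ Finset.range N, f j) (∑ j ∈ Finset.range N, g j) := by
  induction N with
  | zero => simpa using zero ha
  | succ N ih =>
    rw [Finset.sum_range_succ, Finset.sum_range_succ]
    exact ih.add (h N)

theorem of_sub (M : ℕ) (h : Reduces χ hP (hP.zero_sub ha M) σ φ) : Reduces χ hP ha σ φ := by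
  obtain ⟨h1, h2, u, hu, h3⟩ := h
  refine ⟨h1, h2, u, fun i => symbolSpace_sub_le hP (hP.zero_add_one ha) M ?_, h3⟩
  have := hu i
  rw [mem_symbolSpace] at this ⊢
  rwa [show a - (M : ℂ) + 1 = a + 1 - M by ring] at this

theorem of_radialDiv (hσ : ContDiff ℝ ∞ σ) {h : E n → ℂ} (hh : h ∈ symbolSpace χ hP a ha)
    (h0 : ∀ ξ, 1 < ‖ξ‖ → σ ξ - radialDiv h ξ = 0) :
    Reduces χ hP ha σ (fun ξ => σ ξ - radialDiv h ξ) := by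
  have hs := contDiff_of_mem_symbolSpace hP hh
  refine ⟨hσ.sub (contDiff_radialDiv hs), h0, fun i => coord i * h,
    fun i => coord_mul_mem_symbolSpace hP ha i hh, ?_⟩
  ext ξ
  simp only [Pi.add_apply, Finset.sum_apply,
    sum_partialDeriv_coord_mul (hs.differentiable (by simp) ξ), sub_add_cancel]

theorem integral_eq (h : Reduces χ hP ha σ φ) :
    ∫ ξ, φ ξ = ∫ ξ in Metric.ball (0 : E n) 1, φ ξ := by
  refine (setIntegral_eq_integral_of_ae_compl_eq_zero ?_).symm
  have hs : (volume : Measure (E n)) (Metric.sphere 0 1) = 0 :=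
    Measure.addHaar_sphere_of_ne_zero _ _ one_ne_zero
  filter_upwards [compl_mem_ae_iff.2 hs] with ξ hξ hb
  have h1 : ‖ξ‖ ≠ 1 := by simpa using hξ
  have h2 : ¬ ‖ξ‖ < 1 := by simpa using hb
  exact h.2.1 ξ (lt_of_le_of_ne (not_lt.1 h2) h1.symm)

theorem integrable (h : Reduces χ hP ha σ φ) : Integrable φ := by
  refine h.1.continuous.integrable_of_hasCompactSupport
    (HasCompactSupport.intro (isCompact_closedBall (0 : E n) 1) fun ξ hξ => ?_)
  exact h.2.1 ξ (by simpa using hξ)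

end Reduces

open Classical in
/-- The contribution of a homogeneous component of degree `d` to the cut-off integral. -/
noncomputable def componentIntegral (χ : E n → ℝ) (d : ℂ) (f : E n → ℂ) : ℂ :=
  (∫ ξ in Metric.ball (0 : E n) 1, (χ ξ : ℂ) * f ξ) - if d + n ≠ 0 then
    1 / (d + n) * ∫ η : Metric.sphere (0 : E n) 1, f η ∂((volume : Measure (E n)).toSphere) else 0

theorem cutoffFormula_eq (χ : E n → ℝ) (a : ℂ) (s : ℕ → E n → ℂ) (N : ℕ) (σ : E n → ℂ) :
    cutoffFormula χ a s N σ = (∫ ξ, remainder χ σ s N ξ)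
      + ∑ j ∈ Finset.range N, componentIntegral χ (a - j) (s j) := by
  simp only [cutoffFormula, componentIntegral, Finset.sum_sub_distrib, Finset.sum_filter]
  ring

/-- Away from degree -n a radial field does it; at degree -n the field supplied by
`IsDegreeClass.critical` is used, and its divergence has no integral over the ball. -/
theorem exists_reduces_component (hn : 1 ≤ n) (hχ : IsCutoff χ) {d : ℂ} (hPd : P d 0)
    {f : E n → ℂ} (hf : IsHomogeneous d f) (hPf : P d f) :
    ∃ φ, Reduces χ hP hPd (fun ξ => (χ ξ : ℂ) * f ξ) φ ∧ ∫ ξ, φ ξ = componentIntegral χ d f := by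
  have hsm := hχ.contDiff_mul hf.smooth
  by_cases hd : d + n = 0
  · obtain rfl : d = -(n : ℂ) := eq_neg_of_add_eq_zero_left hd
    obtain ⟨g, χ₀, hχ₀, hg, hdiv, hint⟩ := hP.critical hχ hf hPf
    have hu : ∀ i, ContDiff ℝ ∞ fun η => (χ₀ η : ℂ) * g i η := fun i =>
      hχ₀.contDiff_mul (hg i).1.smooth
    have hu' : ContDiff ℝ ∞ fun ξ => ∑ i, partialDeriv i (fun η => (χ₀ η : ℂ) * g i η) ξ :=
      ContDiff.sum fun i _ => contDiff_partialDeriv (hu i) i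
    have hred : Reduces χ hP hPd (fun ξ => (χ ξ : ℂ) * f ξ) (fun ξ => (χ ξ : ℂ) * f ξ
        - ∑ i, partialDeriv i (fun η => (χ₀ η : ℂ) * g i η) ξ) := by
      refine ⟨hsm.sub hu', fun ξ hξ => ?_, fun i η => (χ₀ η : ℂ) * g i η, fun i => ?_, ?_⟩
      · have hξ0 : ξ ≠ 0 := norm_pos_iff.1 (by linarith)
        beta_reduce
        rw [hχ.eq_one ξ hξ.le, ← hdiv ξ hξ0, Complex.ofReal_one, one_mul, sub_eq_zero]
        refine Finset.sum_congr rfl fun i _ => ?_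
        have he : (fun η => (χ₀ η : ℂ) * g i η) =ᶠ[𝓝 ξ] g i := by
          filter_upwards [isOpen_one_lt_norm.mem_nhds hξ] with y hy
          simp [hχ₀.eq_one y (le_of_lt hy)]
        simp only [partialDeriv, he.fderiv_eq]
      · exact mem_symbolSpace_of_eq_homogeneous hP _ hχ (hg i).1 (hg i).2 (hu i) fun ξ hξ => by
          simp [hχ₀.eq_one ξ hξ.le]
      · ext ξ
        simp
    refine ⟨_, hred, ?_⟩
    have hball : ∀ {v : E n → ℂ}, Continuous v → IntegrableOn v (Metric.ball (0 : E n) 1) :=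
      fun hv => (hv.continuousOn.integrableOn_compact
        (isCompact_closedBall 0 1)).mono_set Metric.ball_subset_closedBall
    rw [hred.integral_eq, integral_sub (hball hsm.continuous) (hball hu'.continuous), hint]
    simp [componentIntegral]
  · obtain ⟨h, hh, -, h0, hint⟩ := exists_radialDiv_of_homogeneous hP hn hχ hPd hd hf hPf
    have hred := Reduces.of_radialDiv hsm hh h0
    refine ⟨_, hred, ?_⟩
    rw [hred.integral_eq, hint, componentIntegral, if_pos hd]

/-- The remainder and the components are reduced separately; the integrals of the resulting test
functions are exactly the terms of the cut-off formula. -/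
theorem exists_reduces (hn : 1 ≤ n) (hχ : IsCutoff χ) {a : ℂ} (ha : P a 0) {σ : E n → ℂ}
    {s : ℕ → E n → ℂ} (hs : IsExpansion χ a σ s) (hPs : ∀ j : ℕ, P (a - j) (s j)) {N : ℕ}
    (hN : a.re - N < -(n : ℝ)) :
    ∃ φ, Reduces χ hP ha σ φ ∧ ∫ ξ, φ ξ = cutoffFormula χ a s N σ := by
  choose g hg hgi using fun j : ℕ =>
    exists_reduces_component hP hn hχ (hP.zero_sub ha j) (hs.homogeneous j) (hPs j)
  have hrem : remainder χ σ s N ∈ symbolSpace χ hP (a - N) (hP.zero_sub ha N) := by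
    refine ⟨_, hs.tail N, fun j => ?_⟩
    have := hPs (j + N)
    rwa [show a - ((j + N : ℕ) : ℂ) = a - N - j by push_cast; ring] at this
  obtain ⟨h, hh, -, h0, hint⟩ := exists_radialDiv_of_order_lt hP hn hχ (hP.zero_sub ha N)
    (by simpa using hN) hrem
  have hr1 := Reduces.of_sub (ha := ha) N
    (Reduces.of_radialDiv (contDiff_of_mem_symbolSpace hP hrem) hh h0)
  have hr2 := Reduces.sum (ha := ha) _ g (fun j => Reduces.of_sub j (hg j)) N
  have hσ : σ = remainder χ σ s N + ∑ j ∈ Finset.range N, fun ξ => (χ ξ : ℂ) * s j ξ := by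
    ext ξ
    simp [remainder]
  have hr := hr1.add hr2
  rw [← hσ] at hr
  refine ⟨_, hr, ?_⟩
  simp only [Pi.add_apply, Finset.sum_apply]
  rw [integral_add hr1.integrable (integrable_finsetSum _ fun j _ => (hg j).integrable), hint,
      integral_finsetSum _ fun j _ => (hg j).integrable, cutoffFormula_eq]
  simp only [hgi]

theorem cutoffFormula_of_eqOn_zero (hχ : IsCutoff χ) (a : ℂ) {s : ℕ → E n → ℂ}
    (hs : ∀ j, Set.EqOn (s j) 0 {0}ᶜ) (N : ℕ) (σ : E n → ℂ) :
    cutoffFormula χ a s N σ = ∫ ξ, σ ξ := by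
  have h1 : ∀ j : ℕ, componentIntegral χ (a - j) (s j) = 0 := fun j => by
    have h2 : ∀ ξ : E n, (χ ξ : ℂ) * s j ξ = 0 := fun ξ => by
      by_cases hξ : ξ = 0
      · simp [hξ, hχ.apply_zero]
      · simp [hs j hξ]
    have h3 : ∀ η : Metric.sphere (0 : E n) 1, s j η = 0 := fun η =>
      hs j (ne_zero_of_mem_unit_sphere η)
    simp [componentIntegral, h2, h3]
  simp [cutoffFormula_eq, remainder_eq_self hχ σ hs, h1]

/-- The classical symbols whose components satisfy `P`. -/
def symbolClass (χ : E n → ℝ) (P : ℂ → (E n → ℂ) → Prop) : Set (E n → ℂ) :=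
  {σ | ∃ (a : ℂ) (s : ℕ → E n → ℂ), IsExpansion χ a σ s ∧ ∀ j : ℕ, P (a - j) (s j)}

theorem IsDegreeClass.zero_of_component (hP : IsDegreeClass P) {a : ℂ} {s : ℕ → E n → ℂ}
    (hPs : ∀ j : ℕ, P (a - j) (s j)) : P a 0 := by
  simpa using hP.zero_shift (hPs 0) 0

theorem symbolSpace_subset_symbolClass {a : ℂ} (ha : P a 0) {σ : E n → ℂ}
    (hσ : σ ∈ symbolSpace χ hP a ha) : σ ∈ symbolClass χ P := ⟨a, hσ⟩

/-- Every symbol of the class reduces to a test function whose integral is the cut-off integral. -/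
theorem exists_reduces_cutoffIntegral (hn : 1 ≤ n) (hχ : IsCutoff χ) {σ : E n → ℂ}
    (hσ : σ ∈ symbolClass χ P) : ∃ (a : ℂ) (ha : P a 0) (φ : E n → ℂ), Reduces χ hP ha σ φ ∧
      ∫ ξ, φ ξ = cutoffIntegral χ σ := by
  obtain ⟨b, s', hs', hPs'⟩ := hσ
  obtain ⟨M, hM⟩ := exists_nat_gt (b.re + n)
  have hM' : b.re - M < -(n : ℝ) := by linarith
  have hex : ∃ p : ℂ × (ℕ → E n → ℂ) × ℕ, Admissible χ σ p := ⟨(b, s', M), hs', hM'⟩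
  rw [cutoffIntegral, dif_pos hex]
  obtain ⟨hs, hN⟩ := hex.choose_spec
  generalize hex.choose.1 = a at hs hN ⊢
  generalize hex.choose.2.1 = s at hs ⊢
  generalize hex.choose.2.2 = N at hN ⊢
  -- The expansion chosen in `cutoffIntegral` need not satisfy `P`. If all its components vanish,
  -- its order a carries no information; the components of the given expansion then vanish too, and
  -- both formulas reduce to ∫ σ.
  by_cases hz : ∀ j, Set.EqOn (s j) 0 {0}ᶜ
  · have hz' : ∀ j, Set.EqOn (s' j) 0 {0}ᶜ := fun j => by
      rcases hs'.component_eq_zero_or hχ hs j with h | ⟨k, -, h⟩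
      · exact h
      · exact h.trans (hz k)
    obtain ⟨φ, hφ, hi⟩ := exists_reduces hP hn hχ (hP.zero_of_component hPs') hs' hPs' hM'
    refine ⟨b, _, φ, hφ, ?_⟩
    rw [hi, cutoffFormula_of_eqOn_zero hχ a hz, cutoffFormula_of_eqOn_zero hχ b hz']
  -- A nonvanishing component occurs in both expansions, so a and b differ by an integer. Hence `P`
  -- passes to the chosen components, which are either zero or components of the given expansion.
  · push Not at hz
    obtain ⟨i, hi⟩ := hz
    obtain ⟨k, hk, -⟩ := (hs.component_eq_zero_or hχ hs' i).resolve_left hi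
    have hPs : ∀ j : ℕ, P (a - j) (s j) := fun j => by
      rcases hs.component_eq_zero_or hχ hs' j with h | ⟨l, hl, h⟩
      · have h0 := hP.zero_shift (hPs' 0) ((i : ℤ) - k - j)
        have he : b - ((0 : ℕ) : ℂ) + (((i : ℤ) - k - j : ℤ) : ℂ) = a - j := by
          push_cast
          linear_combination -hk
        rw [he] at h0
        exact hP.congr h0 h.symm
      · rw [hl]
        exact hP.congr (hPs' l) h.symm
    obtain ⟨φ, hφ, hi⟩ := exists_reduces hP hn hχ (hP.zero_of_component hPs) hs hPs hN
    exact ⟨a, _, φ, hφ, hi⟩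

end Reduction

/-! ### Closed linear forms -/

section ClosedForms

variable {n : ℕ} {χ : E n → ℝ} {P : ℂ → (E n → ℂ) → Prop} (hP : IsDegreeClass P)

/-- The restriction of a linear form to the symbols of a fixed order. -/
def restrictForm {ρ : symbolClass χ P → ℂ} (hρ : IsLinearForm ρ) {a : ℂ} (ha : P a 0) :
    symbolSpace χ hP a ha →ₗ[ℂ] ℂ where
  toFun v := ρ ⟨v, symbolSpace_subset_symbolClass hP ha v.2⟩
  map_add' v w := by
    simpa using hρ 1 1 ⟨v, symbolSpace_subset_symbolClass hP ha v.2⟩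
      ⟨w, symbolSpace_subset_symbolClass hP ha w.2⟩
      ⟨_, symbolSpace_subset_symbolClass hP ha (v + w).2⟩ (fun ξ => by simp)
  map_smul' c v := by
    simpa using hρ c 0 ⟨v, symbolSpace_subset_symbolClass hP ha v.2⟩
      ⟨v, symbolSpace_subset_symbolClass hP ha v.2⟩
      ⟨_, symbolSpace_subset_symbolClass hP ha (c • v).2⟩ (fun ξ => by simp)

/-- Since S need not be a vector space, the sum is formed among symbols of one fixed order, where ρ
is genuinely linear. -/
theorem restrictForm_sum_partialDeriv (hχ : IsCutoff χ) {ρ : symbolClass χ P → ℂ}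
    (hρ : IsLinearForm ρ) (hc : IsClosedForm ρ) {a : ℂ} (ha : P a 0) {u : Fin n → E n → ℂ}
    (hu : ∀ i, u i ∈ symbolSpace χ hP (a + 1) (hP.zero_add_one ha)) :
    restrictForm hP hρ ha
      (∑ i, ⟨partialDeriv i (u i), partialDeriv_mem_symbolSpace hP ha hχ i (hu i)⟩) = 0 := by
  rw [map_sum]
  refine Finset.sum_eq_zero fun i _ => ?_
  exact hc i ⟨u i, symbolSpace_subset_symbolClass hP _ (hu i)⟩
    ⟨_, symbolSpace_subset_symbolClass hP ha
      (partialDeriv_mem_symbolSpace hP ha hχ i (hu i))⟩ rfl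

variable {hP} in
theorem Reduces.apply_eq (hχ : IsCutoff χ) {ρ : symbolClass χ P → ℂ}
    (hρ : IsLinearForm ρ) (hc : IsClosedForm ρ) {a : ℂ} {ha : P a 0} {σ φ : E n → ℂ}
    (h : Reduces χ hP ha σ φ) (hσ : σ ∈ symbolClass χ P) (hφ : φ ∈ symbolClass χ P) :
    ρ ⟨σ, hσ⟩ = ρ ⟨φ, hφ⟩ := by
  obtain ⟨h1, h2, u, hu, h3⟩ := h
  have hφ' : φ ∈ symbolSpace χ hP a ha := mem_symbolSpace_of_eq_zero hP ha hχ h1 h2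
  have hσ' : σ ∈ symbolSpace χ hP a ha := by
    rw [h3]
    exact Submodule.add_mem _ hφ' (Submodule.sum_mem _ fun i _ =>
      partialDeriv_mem_symbolSpace hP ha hχ i (hu i))
  have h4 : (⟨σ, hσ'⟩ : symbolSpace χ hP a ha) = ⟨φ, hφ'⟩ +
      ∑ i, ⟨partialDeriv i (u i), partialDeriv_mem_symbolSpace hP ha hχ i (hu i)⟩ := by
    ext1
    simpa using h3
  have h5 := congrArg (restrictForm hP hρ ha) h4
  rw [map_add, restrictForm_sum_partialDeriv hP hχ hρ hc ha hu, add_zero] at h5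
  exact h5

/-- Modulo a compactly supported divergence φ equals (∫ φ) θ, and compactly supported smooth
functions are symbols of every order, so the fields are available at order a + 1. -/
theorem apply_testFunction (hP : IsDegreeClass P) (hχ : IsCutoff χ) {ρ : symbolClass χ P → ℂ}
    (hρ : IsLinearForm ρ) (hc : IsClosedForm ρ) {a : ℂ} (ha : P a 0) {θ φ : E n → ℂ}
    (hθ : ContDiff ℝ ∞ θ) (hφ : ContDiff ℝ ∞ φ) (hθ0 : ∀ ξ, 1 < ‖ξ‖ → θ ξ = 0)
    (hφ0 : ∀ ξ, 1 < ‖ξ‖ → φ ξ = 0) (hθ1 : ∫ ξ, θ ξ = 1) (hθS : θ ∈ symbolClass χ P)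
    (hφS : φ ∈ symbolClass χ P) : ρ ⟨φ, hφS⟩ = ρ ⟨θ, hθS⟩ * ∫ ξ, φ ξ := by
  obtain ⟨W, hW, hWs⟩ := exists_sum_partialDeriv_eq hθ hφ hθ0 hφ0
  have hW' : ∀ i, W i ∈ symbolSpace χ hP (a + 1) (hP.zero_add_one ha) := fun i =>
    mem_symbolSpace_of_eq_zero hP _ hχ (hW i).1 (hW i).2
  have hθ' : θ ∈ symbolSpace χ hP a ha := mem_symbolSpace_of_eq_zero hP ha hχ hθ hθ0
  have hφ' : φ ∈ symbolSpace χ hP a ha := mem_symbolSpace_of_eq_zero hP ha hχ hφ hφ0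
  have h4 : (⟨φ, hφ'⟩ : symbolSpace χ hP a ha) = (∫ ξ, φ ξ) • ⟨θ, hθ'⟩ +
      ∑ i, ⟨partialDeriv i (W i), partialDeriv_mem_symbolSpace hP ha hχ i (hW' i)⟩ := by
    ext ξ
    have := hWs ξ
    rw [hθ1, one_mul, sub_eq_iff_eq_add'] at this
    simpa using this
  have h5 := congrArg (restrictForm hP hρ ha) h4
  rw [map_add, restrictForm_sum_partialDeriv hP hχ hρ hc ha hW', add_zero, map_smul,
    smul_eq_mul, mul_comm] at h5
  exact h5

theorem exists_testFunction_integral_one (n : ℕ) : ∃ θ : E n → ℂ, ContDiff ℝ ∞ θ ∧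
    (∀ ξ, 1 < ‖ξ‖ → θ ξ = 0) ∧ ∫ ξ, θ ξ = 1 := by
  let b : ContDiffBump (0 : E n) := ⟨1 / 2, 1, by norm_num, by norm_num⟩
  refine ⟨fun ξ => ((b.normed volume ξ : ℝ) : ℂ),
    Complex.ofRealCLM.contDiff.comp b.contDiff_normed, fun ξ hξ => ?_, ?_⟩
  · have : ξ ∉ Function.support (b.normed volume) := by
      rw [b.support_normed_eq]
      simp only [b, mem_ball_zero_iff, not_lt]
      exact hξ.le
    simpa using this
  · beta_reduce
    rw [integral_complex_ofReal, b.integral_normed]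
    simp

/-- Closed linear forms on a class of symbols are determined by their values on smoothing symbols,
and are proportional to the cut-off integral. -/
theorem closedForm_classification (hP : IsDegreeClass P) (hn : 1 ≤ n) (hχ : IsCutoff χ) :
    (∀ ρ₁ ρ₂ : symbolClass χ P → ℂ, IsLinearForm ρ₁ → IsClosedForm ρ₁ →
      IsLinearForm ρ₂ → IsClosedForm ρ₂ →
      (∀ σ : symbolClass χ P, (σ : E n → ℂ) ∈ smoothing χ → ρ₁ σ = ρ₂ σ) → ρ₁ = ρ₂) ∧
    (∀ ρ : symbolClass χ P → ℂ, IsLinearForm ρ → IsClosedForm ρ →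
      ∃ c : ℂ, ∀ σ : symbolClass χ P, ρ σ = c * cutoffIntegral χ (σ : E n → ℂ)) := by
  refine ⟨fun ρ₁ ρ₂ hl₁ hc₁ hl₂ hc₂ h => ?_, fun ρ hl hc => ?_⟩
  · ext ⟨σ, hσ⟩
    obtain ⟨a, ha, φ, hφ, -⟩ := exists_reduces_cutoffIntegral hP hn hχ hσ
    have hφS : φ ∈ symbolClass χ P := symbolSpace_subset_symbolClass hP ha
      (mem_symbolSpace_of_eq_zero hP ha hχ hφ.1 hφ.2.1)
    rw [hφ.apply_eq hχ hl₁ hc₁ hσ hφS, hφ.apply_eq hχ hl₂ hc₂ hσ hφS]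
    -- Zero components expand a test function at every order, so it is smoothing.
    exact h ⟨φ, hφS⟩ fun b => ⟨0, IsExpansion.of_eq_zero hχ hφ.1 hφ.2.1 b⟩
  · obtain ⟨θ, hθ, hθ0, hθ1⟩ := exists_testFunction_integral_one n
    by_cases hθS : θ ∈ symbolClass χ P
    · refine ⟨ρ ⟨θ, hθS⟩, fun ⟨σ, hσ⟩ => ?_⟩
      obtain ⟨a, ha, φ, hφ, hi⟩ := exists_reduces_cutoffIntegral hP hn hχ hσ
      have hφS : φ ∈ symbolClass χ P := symbolSpace_subset_symbolClass hP ha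
        (mem_symbolSpace_of_eq_zero hP ha hχ hφ.1 hφ.2.1)
      rw [hφ.apply_eq hχ hl hc hσ hφS, ← hi]
      exact apply_testFunction hP hχ hl hc ha hθ hφ.1 hθ0 hφ.2.1 hθ1 hθS hφS
    -- A nonempty class has an admissible degree and thus contains every test function; if θ is
    -- missing, the class is empty and any constant serves.
    · refine ⟨0, fun ⟨σ, hσ⟩ => (hθS ?_).elim⟩
      obtain ⟨a, ha, -⟩ := exists_reduces_cutoffIntegral hP hn hχ hσ
      exact symbolSpace_subset_symbolClass hP ha (mem_symbolSpace_of_eq_zero hP ha hχ hθ hθ0)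

theorem nonIntegerOrder_eq_symbolClass (χ : E n → ℝ) :
    nonIntegerOrder χ = symbolClass χ NonIntegerDegree := by
  ext σ
  constructor
  · rintro ⟨a, ha, s, hs⟩
    exact ⟨a, s, hs, fun j k hk => ha (k + j) (by push_cast; rw [← hk]; ring)⟩
  · rintro ⟨a, s, hs, h⟩
    exact ⟨a, fun k hk => h 0 k (by simpa using hk), s, hs⟩

/-- Here ε is 0 for n odd and 1 for n even; in both cases it has the parity of n + 1, so the odd and
the even class are the same condition relative to the dimension. -/
theorem parityClass_eq_symbolClass (χ : E n → ℝ) (ε : ℤ) (hε : Even (n + 1 - ε)) :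
    {σ : E n → ℂ | ∃ (a : ℤ) (s : ℕ → E n → ℂ), IsExpansion χ (a : ℂ) σ s ∧
      ∀ (j : ℕ) (ξ : E n), ξ ≠ 0 → s j (-ξ) = (-1 : ℂ) ^ (a - (j : ℤ) + ε) * s j ξ}
      = symbolClass χ OddParity := by
  have hsign : ∀ m : ℤ, (-1 : ℂ) ^ (m + ε) = (-1 : ℂ) ^ (m + n + 1) := fun m => by
    rw [show m + (n : ℤ) + 1 = m + ε + (n + 1 - ε) by ring, zpow_add₀ (by norm_num) (m + ε),
      hε.neg_one_zpow, mul_one]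
  ext σ
  constructor
  · rintro ⟨a, s, hs, h⟩
    exact ⟨a, s, hs, fun j => ⟨a - j, by push_cast; rfl, fun ξ hξ => by rw [h j ξ hξ, hsign]⟩⟩
  · rintro ⟨a, s, hs, h⟩
    obtain ⟨m, hm, -⟩ := h 0
    obtain rfl : a = m := by simpa using hm
    refine ⟨m, s, hs, fun j ξ hξ => ?_⟩
    obtain ⟨l, hl, hp⟩ := h j
    obtain rfl : m - (j : ℤ) = l := by exact_mod_cast hl
    rw [hp ξ hξ, hsign]

theorem oddClass_eq_symbolClass (χ : E n → ℝ) (hn : Odd n) :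
    oddClass χ = symbolClass χ OddParity := by
  rw [← parityClass_eq_symbolClass χ 0 (by
    have : Odd (n : ℤ) := by exact_mod_cast hn
    simpa using this.add_one)]
  simp [oddClass]

theorem evenClass_eq_symbolClass (χ : E n → ℝ) (hn : Even n) :
    evenClass χ = symbolClass χ OddParity :=
  parityClass_eq_symbolClass χ 1 (by simpa using hn)

theorem exists_degreeClass (hn : 2 ≤ n) (χ : E n → ℝ) {S : Set (E n → ℂ)}
    (hS : S = nonIntegerOrder χ ∨ (Odd n ∧ S = oddClass χ) ∨ (Even n ∧ S = evenClass χ)) :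
    ∃ P : ℂ → (E n → ℂ) → Prop, IsDegreeClass P ∧ S = symbolClass χ P := by
  rcases hS with rfl | ⟨ho, rfl⟩ | ⟨he, rfl⟩
  · exact ⟨_, isDegreeClass_nonIntegerDegree, nonIntegerOrder_eq_symbolClass χ⟩
  · exact ⟨_, isDegreeClass_oddParity hn, oddClass_eq_symbolClass χ ho⟩
  · exact ⟨_, isDegreeClass_oddParity hn, evenClass_eq_symbolClass χ he⟩

end ClosedForms

end CCSymbol

theorem mainTheorem4 (n : ℕ) (hn : 2 ≤ n)
    (χ : CCSymbol.E n → ℝ) (hχ : CCSymbol.IsCutoff χ)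
    (S : Set (CCSymbol.E n → ℂ))
    (hS : S = CCSymbol.nonIntegerOrder χ ∨
      (Odd n ∧ S = CCSymbol.oddClass χ) ∨
      (Even n ∧ S = CCSymbol.evenClass χ)) :
    -- a closed linear form is determined by its restriction to symbols of order `< -K`, any `K`
    (∀ K : ℝ, ∀ ρ₁ ρ₂ : S → ℂ,
      CCSymbol.IsLinearForm ρ₁ → CCSymbol.IsClosedForm ρ₁ →
      CCSymbol.IsLinearForm ρ₂ → CCSymbol.IsClosedForm ρ₂ →
      (∀ σ : S, (σ : CCSymbol.E n → ℂ) ∈ CCSymbol.CSlt χ (-K) → ρ₁ σ = ρ₂ σ) →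
        ρ₁ = ρ₂) ∧
    -- and even by its restriction to smoothing symbols
    (∀ ρ₁ ρ₂ : S → ℂ,
      CCSymbol.IsLinearForm ρ₁ → CCSymbol.IsClosedForm ρ₁ →
      CCSymbol.IsLinearForm ρ₂ → CCSymbol.IsClosedForm ρ₂ →
      (∀ σ : S, (σ : CCSymbol.E n → ℂ) ∈ CCSymbol.smoothing χ → ρ₁ σ = ρ₂ σ) →
        ρ₁ = ρ₂) ∧
    -- if it is continuous on symbols of constant order, it is proportional to the
    -- cut-off regularised integral
    (∀ ρ : S → ℂ,
      CCSymbol.IsLinearForm ρ → CCSymbol.IsClosedForm ρ → CCSymbol.IsContinuousForm χ ρ →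
        ∃ c : ℂ, ∀ σ : S, ρ σ = c * CCSymbol.cutoffIntegral χ (σ : CCSymbol.E n → ℂ)) := by
  obtain ⟨P, hP, rfl⟩ := CCSymbol.exists_degreeClass hn χ hS
  obtain ⟨h1, h2⟩ := CCSymbol.closedForm_classification hP (by omega) hχ
  -- A smoothing symbol has in particular order -K - 1, so agreement on orders below -K includes
  -- agreement on smoothing symbols.
  refine ⟨fun K ρ₁ ρ₂ hl₁ hc₁ hl₂ hc₂ h => h1 ρ₁ ρ₂ hl₁ hc₁ hl₂ hc₂ fun σ hσ =>
    h σ ⟨((-K - 1 : ℝ) : ℂ), by simp, hσ _⟩, h1, fun ρ hl hc _ => h2 ρ hl hc⟩
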